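/- Let $\mathbb{K}$ be a field of characteristic $0$. A dir-inv $\mathbb{K}$-module is a $\mathbb{K}$-module $M$ with submodules $F_jM$ ($j$ in a nonempty directed poset $J$, $F_jM\subset F_{j'}M$ for $j\le j'$) and, for each $j$, a decreasing sequence $F_jM\supset F^0F_jM\supset F^1F_jM\supset\cdots$ of submodules, such that for $j\le j'$ and every $i$ there is $i'$ with $F^{i'}F_jM\subset F^iF_{j'}M$. A linear map $\phi:M\to N$ is continuous if for every $j$ there is $k$ such that $\phi(F_jM)\subset F_kN$ and for every $i$ there is $i'$ with $\phi(F^{i'}F_jM)\subset F^iF_kN$; these are the morphisms of dir-inv modules. $M$ is complete if it is isomorphic, as a dir-inv module, to one for which $M=\bigcup_jF_jM$ and all the maps $F_jM\to\varprojlim_iF_jM/F^iF_jM$ are bijective. The completion is the module $\widehat M=\varinjlim_j\varprojlim_iF_jM/F^iF_jM$; for complete $M$ one has $\widehat M\cong M$. The tensor product $N\otimes M$ has $F_{(k,j)}(N\otimes M)$ equal to the image of $F_kN\otimes F_jM$, with $F^iF_{(k,j)}(N\otimes M)$ equal to the sum of the images of $F^iF_kN\otimes F_jM$ and $F_kN\otimes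 F^iF_jM$, and $N\widehat\otimes M$ is the completion of $N\otimes M$. Let $\Omega^q(\Delta^l)$ be the module of algebraic differential $q$-forms on $\operatorname{Spec}\mathbb{K}[t_0,\dots,t_l]/(t_0+\cdots+t_l-1)$, regarded as a dir-inv module with a single $F_0=\Omega^q(\Delta^l)$ and all $F^iF_0=0$. An order preserving $\alpha:[k]\to[l]$ induces $\alpha_*:\Omega^q(\Delta^l)\to\Omega^q(\Delta^k)$, the pullback along the linear map of simplices given by $\alpha$ on vertices. Let $\int_{\Delta^l}:\Omega^l(\Delta^l)\to\mathbb{K}$ be integration over the simplex, that is $$\int_{\Delta^l}t_0^{a_0}\cdots t_l^{a_l}\,dt_1\wedge\cdots\wedge dt_l=\frac{a_0!\cdots a_l!}{(l+a_0+\cdots+a_l)!}.$$ Let $M=\{M^q\}_{q\in\mathbb{N}}$ be a cosimplicial dir-inv $\mathbb{K}$-module (all the structure maps $\alpha^*:M^k\to M^l$ being continuous and linear) such that every $M^q$ is complete. Let $\mathrm{N}M$ be the standard normalization of $M$: $\mathrm{N}^qM=\bigcap_{i=0}^{q-1}\operatorname{Ker}(s^i:M^q\to M^{q-1})$, with differential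 $\sum_{i=0}^{q+1}(-1)^i\partial^i$. Let $\widehat{\widetilde{\mathrm N}}M$ be the complete Thom–Sullivan normalization: $\widehat{\widetilde{\mathrm N}}{}^qM$ consists of the sequences $(u_l)_{l\ge0}\in\prod_{l\ge 0}\Omega^q(\Delta^l)\widehat\otimes M^l$ such that $(1\otimes\alpha^*)(u_k)=(\alpha_*\otimes1)(u_l)$ in $\Omega^q(\Delta^k)\widehat\otimes M^l$ for all $k,l$ and all order preserving $\alpha:[k]\to[l]$, with differential induced by the exterior derivative. Then the maps $\int_{\Delta^q}:\Omega^q(\Delta^q)\widehat\otimes M^q\to\mathbb{K}\widehat\otimes M^q\cong M^q$ induce, by $(u_l)_{l\ge0}\mapsto\int_{\Delta^q}u_q$ in degree $q$, a homomorphism of complexes $$\int_\Delta:\widehat{\widetilde{\mathrm N}}M\to\mathrm{N}M,$$ and $\int_\Delta$ is a quasi-isomorphism, in fact a homotopy equivalence of complexes of $\mathbb{K}$-modules. -/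

import Mathlib

open CategoryTheory

universe u

namespace DirInv

noncomputable section

section InvModules

variable {C : Type u} [CommRing C]
variable {M N P : Type u} [AddCommGroup M] [Module C M] [AddCommGroup N] [Module C N]
  [AddCommGroup P] [Module C P]

/-- The inverse limit `lim_i M / F i` attached to an inv module structure
`F 0 ⊇ F 1 ⊇ ...` on `M`. -/
def invLim (F : ℕ → Submodule C M) (hF : Antitone F) : Submodule C (∀ i, M ⧸ F i) where
  carrier := {x | ∀ (i i' : ℕ) (h : i ≤ i'), Submodule.factor (hF h) (x i') = x i}
  add_mem' := by
    intro x y hx hy i i' h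
    simp only [Pi.add_apply, map_add, hx i i' h, hy i i' h]
  zero_mem' := by
    intro i i' h
    simp only [Pi.zero_apply, map_zero]
  smul_mem' := by
    intro c x hx i i' h
    simp only [Pi.smul_apply, map_smul, hx i i' h]

/-- The canonical map `M → lim_i M / F i`. -/
def toInvLim (F : ℕ → Submodule C M) (hF : Antitone F) : M →ₗ[C] invLim F hF :=
  LinearMap.codRestrict _ (LinearMap.pi fun i => (F i).mkQ) (by
    intro m i i' h
    simp [Submodule.factor])

/-- An inv module is complete if `M → lim_i M / F i` is bijective. -/
def InvComplete (F : ℕ → Submodule C M) (hF : Antitone F) : Prop :=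
  Function.Bijective (toInvLim F hF)

/-- Continuity of a linear map between inv modules. -/
def InvContinuous (F : ℕ → Submodule C M) (G : ℕ → Submodule C N) (φ : M →ₗ[C] N) : Prop :=
  ∀ i, ∃ i', F i' ≤ (G i).comap φ

theorem mapQ_eq_of_mem {F : ℕ → Submodule C M} {hF : Antitone F} {G : ℕ → Submodule C N}
    (φ : M →ₗ[C] N) {i a b : ℕ} (ha : F a ≤ (G i).comap φ) (hb : F b ≤ (G i).comap φ)
    (x : invLim F hF) :
    (F a).mapQ (G i) φ ha (x.1 a) = (F b).mapQ (G i) φ hb (x.1 b) := by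
  rw [← x.2 a (max a b) (le_max_left _ _), ← x.2 b (max a b) (le_max_right _ _)]
  obtain ⟨m, hm⟩ := Submodule.mkQ_surjective _ (x.1 (max a b))
  rw [← hm]
  simp [Submodule.factor]

/-- The map induced by a continuous linear map on the inverse limits. Its `i`-th component
is computed through any `i'` with `φ (F i') ⊆ G i`, see `invLimMap_apply`. -/
def invLimMap {F : ℕ → Submodule C M} {hF : Antitone F} {G : ℕ → Submodule C N}
    {hG : Antitone G} (φ : M →ₗ[C] N) (h : InvContinuous F G φ) :
    invLim F hF →ₗ[C] invLim G hG :=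
  LinearMap.codRestrict _
    (LinearMap.pi fun i => ((F (h i).choose).mapQ (G i) φ (h i).choose_spec) ∘ₗ
      LinearMap.proj (h i).choose ∘ₗ (invLim F hF).subtype) (by
    intro x i i' hii
    have h1 : F (h i').choose ≤ (G i).comap φ :=
      (h i').choose_spec.trans (Submodule.comap_mono (hG hii))
    have h2 := mapQ_eq_of_mem φ (h i).choose_spec h1 x
    simp only [LinearMap.pi_apply, LinearMap.comp_apply, LinearMap.proj_apply,
      Submodule.subtype_apply]
    rw [h2]
    obtain ⟨m, hm⟩ := Submodule.mkQ_surjective _ (x.1 (h i').choose)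
    rw [← hm]
    simp [Submodule.factor])

theorem invLimMap_apply {F : ℕ → Submodule C M} {hF : Antitone F} {G : ℕ → Submodule C N}
    {hG : Antitone G} (φ : M →ₗ[C] N) (h : InvContinuous F G φ) (x : invLim F hF) {i i' : ℕ}
    (hi : F i' ≤ (G i).comap φ) :
    (invLimMap (hG := hG) φ h x).1 i = (F i').mapQ (G i) φ hi (x.1 i') :=
  mapQ_eq_of_mem φ (h i).choose_spec hi x

theorem invLimMap_toInvLim {F : ℕ → Submodule C M} {hF : Antitone F} {G : ℕ → Submodule C N}
    {hG : Antitone G} (φ : M →ₗ[C] N) (h : InvContinuous F G φ) (m : M) :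
    invLimMap (hG := hG) φ h (toInvLim F hF m) = toInvLim G hG (φ m) := by
  apply Subtype.ext
  funext i
  rw [invLimMap_apply φ h _ (h i).choose_spec]
  rfl

theorem invLimMap_comp {F : ℕ → Submodule C M} {hF : Antitone F} {G : ℕ → Submodule C N}
    {hG : Antitone G} {H : ℕ → Submodule C P} {hH : Antitone H}
    (φ : M →ₗ[C] N) (h : InvContinuous F G φ) (ψ : N →ₗ[C] P) (h' : InvContinuous G H ψ)
    (χ : M →ₗ[C] P) (h'' : InvContinuous F H χ) (hχ : χ = ψ ∘ₗ φ) (x : invLim F hF) :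
    invLimMap (hG := hH) ψ h' (invLimMap (hG := hG) φ h x) = invLimMap (hG := hH) χ h'' x := by
  subst hχ
  apply Subtype.ext
  funext i
  obtain ⟨a, ha⟩ := h' i
  obtain ⟨b, hb⟩ := h a
  have hc : F b ≤ (H i).comap (ψ ∘ₗ φ) := fun y hy => ha (hb hy)
  rw [invLimMap_apply ψ h' _ ha, invLimMap_apply φ h _ hb, invLimMap_apply _ h'' _ hc]
  obtain ⟨m, hm⟩ := Submodule.mkQ_surjective _ (x.1 b)
  rw [← hm]
  simp

theorem invLimMap_id {F : ℕ → Submodule C M} {hF : Antitone F}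
    (φ : M →ₗ[C] M) (h : InvContinuous F F φ) (hφ : φ = LinearMap.id) (x : invLim F hF) :
    invLimMap (hG := hF) φ h x = x := by
  subst hφ
  apply Subtype.ext
  funext i
  rw [invLimMap_apply _ h x (le_refl (F i))]
  obtain ⟨m, hm⟩ := Submodule.mkQ_surjective _ (x.1 i)
  rw [← hm]
  simp

theorem invLimMap_zero {F : ℕ → Submodule C M} {hF : Antitone F} {G : ℕ → Submodule C N}
    {hG : Antitone G} (φ : M →ₗ[C] N) (h : InvContinuous F G φ) (hφ : φ = 0) (x : invLim F hF) :
    invLimMap (hG := hG) φ h x = 0 := by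
  subst hφ
  apply Subtype.ext
  funext i
  obtain ⟨a, ha⟩ := h i
  rw [invLimMap_apply _ h x ha]
  obtain ⟨m, hm⟩ := Submodule.mkQ_surjective _ (x.1 a)
  rw [← hm]
  simp

end InvModules

/-- A dir-inv `C`-module: a `C`-module `M` with a direct system of submodules `F j`, indexed by
a nonempty directed poset, and on each `F j` an inverse system `fil j 0 ⊇ fil j 1 ⊇ ...` of
submodules of `F j`, such that the inclusions `F j ⊆ F k` are continuous. -/
structure DirInvModule (C : Type u) [CommRing C] where
  carrier : Type u
  [addCommGroup : AddCommGroup carrier]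
  [module : Module C carrier]
  index : Type u
  [partialOrder : PartialOrder index]
  [nonempty : Nonempty index]
  [directed : IsDirectedOrder index]
  F : index → Submodule C carrier
  F_mono : Monotone F
  fil : index → ℕ → Submodule C carrier
  fil_le : ∀ j i, fil j i ≤ F j
  fil_anti : ∀ j, Antitone (fil j)
  fil_cont : ∀ j k, j ≤ k → ∀ i, ∃ i', fil j i' ≤ fil k i

namespace DirInvModule

attribute [instance] addCommGroup module partialOrder nonempty directed

variable {C : Type u} [CommRing C]

instance : CoeSort (DirInvModule C) (Type u) := ⟨carrier⟩

/-- A linear map sends `F j` into `F k` and is continuous between these two inv modules. -/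
structure PieceContinuous (M N : DirInvModule C) (φ : M →ₗ[C] N) (j : M.index) (k : N.index) :
    Prop where
  F_le : M.F j ≤ (N.F k).comap φ
  fil_le : ∀ i, ∃ i', M.fil j i' ≤ (N.fil k i).comap φ

/-- Continuity of a linear map between dir-inv modules. -/
def Continuous (M N : DirInvModule C) (φ : M →ₗ[C] N) : Prop :=
  ∀ j, ∃ k, PieceContinuous M N φ j k

/-- Morphisms of dir-inv modules: the continuous linear maps. -/
@[ext]
structure Hom (M N : DirInvModule C) where
  lin : M →ₗ[C] N
  cont : Continuous M N lin

theorem PieceContinuous.comp {M N P : DirInvModule C} {φ : M →ₗ[C] N} {ψ : N →ₗ[C] P}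
    {j : M.index} {k : N.index} {l : P.index} (h : PieceContinuous M N φ j k)
    (h' : PieceContinuous N P ψ k l) : PieceContinuous M P (ψ ∘ₗ φ) j l where
  F_le := fun _ hx => h'.F_le (h.F_le hx)
  fil_le := fun i => by
    obtain ⟨a, ha⟩ := h'.fil_le i
    obtain ⟨b, hb⟩ := h.fil_le a
    exact ⟨b, fun _ hx => ha (hb hx)⟩

theorem pieceContinuous_id {M : DirInvModule C} {j k : M.index} (h : j ≤ k) :
    PieceContinuous M M LinearMap.id j k where
  F_le := M.F_mono h
  fil_le := M.fil_cont j k h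

instance : Category (DirInvModule C) where
  Hom M N := Hom M N
  id M := ⟨LinearMap.id, fun j => ⟨j, pieceContinuous_id le_rfl⟩⟩
  comp f g := ⟨g.lin ∘ₗ f.lin, fun j => by
    obtain ⟨k, hk⟩ := f.cont j
    obtain ⟨l, hl⟩ := g.cont k
    exact ⟨l, hk.comp hl⟩⟩

@[simp]
theorem id_lin (M : DirInvModule C) : Hom.lin (𝟙 M) = LinearMap.id := rfl

@[simp]
theorem comp_lin {M N P : DirInvModule C} (f : M ⟶ N) (g : N ⟶ P) :
    Hom.lin (f ≫ g) = Hom.lin g ∘ₗ Hom.lin f := rfl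

theorem hom_ext {M N : DirInvModule C} {f g : M ⟶ N} (h : Hom.lin f = Hom.lin g) : f = g :=
  Hom.ext h

/-- The forgetful functor to modules. -/
def forgetToModule (C : Type u) [CommRing C] : DirInvModule C ⥤ ModuleCat.{u} C where
  obj M := ModuleCat.of C M
  map f := ModuleCat.ofHom (Hom.lin f)

/-- The inverse system of submodules of the module `F j`. -/
def filOn (M : DirInvModule C) (j : M.index) (i : ℕ) : Submodule C (M.F j) :=
  (M.fil j i).submoduleOf (M.F j)

theorem filOn_anti (M : DirInvModule C) (j : M.index) : Antitone (M.filOn j) :=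
  fun _ _ h => Submodule.comap_mono (M.fil_anti j h)

/-- The canonical map `colim_j F j → M`. -/
def colimToModule (M : DirInvModule C) [DecidableEq M.index] :
    Module.DirectLimit (fun j => M.F j) (fun _ _ h => Submodule.inclusion (M.F_mono h)) →ₗ[C] M :=
  Module.DirectLimit.lift C M.index _ _ (fun j => (M.F j).subtype) (fun _ _ _ _ => rfl)

open Classical in
/-- A dir-inv module is complete if it is isomorphic, in the category of dir-inv modules, to one
for which all the inv modules `F j` are complete and `colim_j F j → M` is bijective. -/
def IsComplete (M : DirInvModule C) : Prop :=
  ∃ M' : DirInvModule C, Nonempty (M ≅ M') ∧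
    (∀ j, InvComplete (M'.filOn j) (M'.filOn_anti j)) ∧ Function.Bijective M'.colimToModule

/-- The completion of the inv module `F j`. -/
abbrev piece (M : DirInvModule C) (j : M.index) : Submodule C (∀ i, M.F j ⧸ M.filOn j i) :=
  invLim (M.filOn j) (M.filOn_anti j)

theorem PieceContinuous.invContinuous {M N : DirInvModule C} {φ : M →ₗ[C] N} {j : M.index}
    {k : N.index} (h : PieceContinuous M N φ j k) :
    InvContinuous (M.filOn j) (N.filOn k) (φ.restrict h.F_le) := by
  intro i
  obtain ⟨a, ha⟩ := h.fil_le i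
  exact ⟨a, fun _ hx => ha hx⟩

/-- The map on completions of the `F j`'s induced by a continuous linear map. -/
def pieceMap {M N : DirInvModule C} {φ : M →ₗ[C] N} {j : M.index} {k : N.index}
    (h : PieceContinuous M N φ j k) : M.piece j →ₗ[C] N.piece k :=
  invLimMap (φ.restrict h.F_le) h.invContinuous

theorem pieceMap_comp {M N P : DirInvModule C} {φ : M →ₗ[C] N} {ψ : N →ₗ[C] P} {χ : M →ₗ[C] P}
    {j : M.index} {k : N.index} {l : P.index} (h : PieceContinuous M N φ j k)
    (h' : PieceContinuous N P ψ k l) (h'' : PieceContinuous M P χ j l) (hχ : χ = ψ ∘ₗ φ)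
    (x : M.piece j) : pieceMap h' (pieceMap h x) = pieceMap h'' x := by
  subst hχ
  exact invLimMap_comp _ _ _ _ _ _ rfl x

/-- The transition maps of the direct system of the completions of the `F j`'s. -/
def trans (M : DirInvModule C) (j k : M.index) (h : j ≤ k) : M.piece j →ₗ[C] M.piece k :=
  pieceMap (pieceContinuous_id h)

instance (M : DirInvModule C) : DirectedSystem (fun j => M.piece j) (M.trans · · ·) where
  map_self _ _ := invLimMap_id _ _ rfl _
  map_map _ _ _ h h' x := pieceMap_comp (pieceContinuous_id h) (pieceContinuous_id h')
    (pieceContinuous_id (h.trans h')) rfl x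

open Classical in
/-- The completion `colim_j lim_i F j / fil j i` of a dir-inv module, as a module. -/
def Completion (M : DirInvModule C) : Type u :=
  Module.DirectLimit (fun j => M.piece j) M.trans

open Classical in
instance (M : DirInvModule C) : AddCommGroup M.Completion :=
  @Module.DirectLimit.addCommGroup C _ M.index _ _ (fun j => M.piece j)
    (fun j => (M.piece j).addCommGroup) (fun j => (M.piece j).module) M.trans

open Classical in
instance (M : DirInvModule C) : Module C M.Completion :=
  Module.DirectLimit.module (fun j => M.piece j) M.trans

open Classical in
/-- The canonical map from the completion of `F j` to the completion of `M`. -/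
def Completion.of (M : DirInvModule C) (j : M.index) : M.piece j →ₗ[C] M.Completion :=
  Module.DirectLimit.of C M.index (fun j => M.piece j) M.trans j

theorem Completion.of_pieceMap {M N : DirInvModule C} {φ : M →ₗ[C] N} {j : M.index}
    {k k' : N.index} (h : PieceContinuous M N φ j k) (h' : PieceContinuous M N φ j k')
    (x : M.piece j) :
    Completion.of N k (pieceMap h x) = Completion.of N k' (pieceMap h' x) := by
  classical
  obtain ⟨l, hl, hl'⟩ := exists_ge_ge k k'
  have h1 : Completion.of N k (pieceMap h x) = Completion.of N l (N.trans k l hl (pieceMap h x)) :=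
    Module.DirectLimit.of_f.symm
  have h2 : Completion.of N k' (pieceMap h' x) =
      Completion.of N l (N.trans k' l hl' (pieceMap h' x)) :=
    Module.DirectLimit.of_f.symm
  rw [h1, h2, trans, trans,
    pieceMap_comp h (pieceContinuous_id hl) (h.comp (pieceContinuous_id hl)) rfl,
    pieceMap_comp h' (pieceContinuous_id hl') (h.comp (pieceContinuous_id hl)) rfl]

open Classical in
/-- The map induced on completions by a morphism of dir-inv modules. On the completion of
`F j` it is computed through any `k` such that `f : F j → F k` is continuous, see
`completionMap_of`. -/
def completionMap {M N : DirInvModule C} (f : M ⟶ N) : M.Completion →ₗ[C] N.Completion :=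
  Module.DirectLimit.lift C M.index (fun j => M.piece j) M.trans
    (fun j => Completion.of N (f.cont j).choose ∘ₗ pieceMap (f.cont j).choose_spec)
    (by
      intro j j' hjj x
      have h1 : PieceContinuous M N f.lin j (f.cont j').choose :=
        (pieceContinuous_id hjj).comp (f.cont j').choose_spec
      simp only [LinearMap.comp_apply]
      rw [trans, pieceMap_comp (pieceContinuous_id hjj) (f.cont j').choose_spec h1 rfl]
      exact Completion.of_pieceMap _ _ _)

theorem completionMap_of {M N : DirInvModule C} (f : M ⟶ N) {j : M.index} {k : N.index}
    (h : PieceContinuous M N (Hom.lin f) j k) (x : M.piece j) :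
    completionMap f (Completion.of M j x) = Completion.of N k (pieceMap h x) := by
  classical
  have : completionMap f (Completion.of M j x) =
      Completion.of N (f.cont j).choose (pieceMap (f.cont j).choose_spec x) :=
    Module.DirectLimit.lift_of (G := fun j => M.piece j) (f := M.trans) _ _ x
  rw [this]
  exact Completion.of_pieceMap _ _ _

theorem Completion.exists_of (M : DirInvModule C) (z : M.Completion) :
    ∃ j x, Completion.of M j x = z := by
  classical
  exact Module.DirectLimit.exists_of z

theorem completionMap_id (M : DirInvModule C) : completionMap (𝟙 M) = LinearMap.id := by
  ext z
  obtain ⟨j, x, rfl⟩ := Completion.exists_of M z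
  rw [completionMap_of (𝟙 M) (pieceContinuous_id (le_refl j))]
  exact congrArg _ (invLimMap_id _ _ rfl _)

theorem completionMap_comp {M N P : DirInvModule C} (f : M ⟶ N) (g : N ⟶ P) :
    completionMap (f ≫ g) = completionMap g ∘ₗ completionMap f := by
  ext z
  obtain ⟨j, x, rfl⟩ := Completion.exists_of M z
  obtain ⟨k, hk⟩ := f.cont j
  obtain ⟨l, hl⟩ := g.cont k
  rw [LinearMap.comp_apply, completionMap_of f hk, completionMap_of g hl,
    completionMap_of (f ≫ g) (hk.comp hl), pieceMap_comp hk hl (hk.comp hl) rfl]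

theorem completionMap_zero {M N : DirInvModule C} (f : M ⟶ N) (hf : Hom.lin f = 0) :
    completionMap f = 0 := by
  ext z
  obtain ⟨j, x, rfl⟩ := Completion.exists_of M z
  obtain ⟨k, hk⟩ := f.cont j
  have h0 : pieceMap hk x = 0 := invLimMap_zero _ _ (by
    ext y
    simp [hf]) x
  rw [completionMap_of f hk, h0, map_zero, LinearMap.zero_apply]

open Classical in
/-- The canonical map from `colim_j F j` to the completion. -/
def colimToCompletion (M : DirInvModule C) :
    Module.DirectLimit (fun j => M.F j) (fun _ _ h => Submodule.inclusion (M.F_mono h)) →ₗ[C]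
      M.Completion :=
  Module.DirectLimit.lift C M.index _ _
    (fun j => Completion.of M j ∘ₗ toInvLim (M.filOn j) (M.filOn_anti j)) (by
      intro j k h x
      have h1 : toInvLim (M.filOn k) (M.filOn_anti k) (Submodule.inclusion (M.F_mono h) x) =
          M.trans j k h (toInvLim (M.filOn j) (M.filOn_anti j) x) :=
        (invLimMap_toInvLim _ _ x).symm
      simp only [LinearMap.comp_apply]
      rw [h1]
      exact Module.DirectLimit.of_f)

theorem Completion.of_toInvLim (M : DirInvModule C) {j k : M.index} (m : M) (hj : m ∈ M.F j)
    (hk : m ∈ M.F k) :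
    Completion.of M j (toInvLim (M.filOn j) (M.filOn_anti j) ⟨m, hj⟩) =
      Completion.of M k (toInvLim (M.filOn k) (M.filOn_anti k) ⟨m, hk⟩) := by
  classical
  have key : ∀ (a b : M.index) (h : a ≤ b) (ha : m ∈ M.F a),
      Completion.of M a (toInvLim (M.filOn a) (M.filOn_anti a) ⟨m, ha⟩) =
      Completion.of M b (toInvLim (M.filOn b) (M.filOn_anti b) ⟨m, M.F_mono h ha⟩) := by
    intro a b h ha
    have h1 : M.trans a b h (toInvLim (M.filOn a) (M.filOn_anti a) ⟨m, ha⟩) =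
        toInvLim (M.filOn b) (M.filOn_anti b) ⟨m, M.F_mono h ha⟩ :=
      invLimMap_toInvLim _ _ _
    rw [← h1]
    exact Module.DirectLimit.of_f.symm
  obtain ⟨l, hl, hl'⟩ := exists_ge_ge j k
  rw [key j l hl hj, key k l hl' hk]

theorem completionMap_toInvLim {M N : DirInvModule C} (f : M ⟶ N) {j : M.index} {k : N.index}
    (m : M) (hj : m ∈ M.F j) (hk : Hom.lin f m ∈ N.F k) :
    completionMap f (Completion.of M j (toInvLim (M.filOn j) (M.filOn_anti j) ⟨m, hj⟩)) =
      Completion.of N k (toInvLim (N.filOn k) (N.filOn_anti k) ⟨Hom.lin f m, hk⟩) := by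
  obtain ⟨l, hl⟩ := f.cont j
  rw [completionMap_of f hl, pieceMap, invLimMap_toInvLim]
  exact Completion.of_toInvLim _ _ _ _

theorem colimToModule_of (M : DirInvModule C) [DecidableEq M.index] (j : M.index) (x : M.F j) :
    M.colimToModule (Module.DirectLimit.of C M.index _ _ j x) = x :=
  Module.DirectLimit.lift_of _ _ _

theorem IsComplete.colimToModule_bijective {M : DirInvModule C} (h : M.IsComplete)
    [DecidableEq M.index] : Function.Bijective M.colimToModule := by
  classical
  refine ⟨Module.DirectLimit.lift_injective _ _ fun j => (M.F j).injective_subtype, ?_⟩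
  intro m
  obtain ⟨M', ⟨e⟩, -, hM'⟩ := h
  obtain ⟨z, hz⟩ := hM'.2 (Hom.lin e.hom m)
  obtain ⟨k, x, rfl⟩ := Module.DirectLimit.exists_of z
  rw [colimToModule_of] at hz
  obtain ⟨j, hj⟩ := e.inv.cont k
  have h1 : Hom.lin e.inv (Hom.lin e.hom m) = m :=
    LinearMap.congr_fun (congrArg Hom.lin e.hom_inv_id) m
  have h2 : m ∈ M.F j := by
    rw [← h1, ← hz]
    exact hj.F_le x.2
  exact ⟨Module.DirectLimit.of C M.index _ _ j ⟨m, h2⟩, colimToModule_of _ _ _⟩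

theorem IsComplete.colimToCompletion_bijective {M : DirInvModule C} (h : M.IsComplete) :
    Function.Bijective M.colimToCompletion := by
  classical
  obtain ⟨M', ⟨e⟩, hM'c, hM'⟩ := h
  have hinv : ∀ z, completionMap e.inv (completionMap e.hom z) = z := by
    intro z
    rw [← LinearMap.comp_apply, ← completionMap_comp, e.hom_inv_id, completionMap_id]
    rfl
  have hinv' : ∀ m, Hom.lin e.inv (Hom.lin e.hom m) = m := fun m =>
    LinearMap.congr_fun (congrArg Hom.lin e.hom_inv_id) m
  have hinv'' : ∀ m, Hom.lin e.hom (Hom.lin e.inv m) = m := fun m =>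
    LinearMap.congr_fun (congrArg Hom.lin e.inv_hom_id) m
  have hof : ∀ (j : M.index) (x : M.F j), M.colimToCompletion
      (Module.DirectLimit.of C M.index _ _ j x) =
        Completion.of M j (toInvLim (M.filOn j) (M.filOn_anti j) x) :=
    fun j x => Module.DirectLimit.lift_of _ _ _
  constructor
  · rw [injective_iff_map_eq_zero]
    intro z hz
    obtain ⟨j, x, rfl⟩ := Module.DirectLimit.exists_of z
    rw [hof] at hz
    obtain ⟨k, hk⟩ := e.hom.cont j
    have h1 := completionMap_toInvLim e.hom x.1 x.2 (hk.F_le x.2)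
    rw [Subtype.coe_eta, hz, map_zero] at h1
    obtain ⟨l, hl, h2⟩ := Module.DirectLimit.of.zero_exact h1.symm
    have h3 : M'.trans k l hl (toInvLim (M'.filOn k) (M'.filOn_anti k)
        ⟨Hom.lin e.hom x.1, hk.F_le x.2⟩) = toInvLim (M'.filOn l) (M'.filOn_anti l)
        ⟨Hom.lin e.hom x.1, M'.F_mono hl (hk.F_le x.2)⟩ := invLimMap_toInvLim _ _ _
    rw [h3] at h2
    have h4 := (injective_iff_map_eq_zero _).1 (hM'c l).1 _ h2
    have h5 : Hom.lin e.hom x.1 = 0 := congrArg Subtype.val h4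
    have h6 : x = 0 := by
      apply Subtype.ext
      rw [← hinv' x.1, h5, map_zero]
      rfl
    rw [h6, map_zero]
  · intro z
    obtain ⟨k, y, hy⟩ := Completion.exists_of M' (completionMap e.hom z)
    obtain ⟨m, rfl⟩ := (hM'c k).2 y
    obtain ⟨j, hj⟩ := e.inv.cont k
    refine ⟨Module.DirectLimit.of C M.index _ _ j ⟨Hom.lin e.inv m.1, hj.F_le m.2⟩, ?_⟩
    rw [hof, ← hinv z, ← hy, completionMap_toInvLim e.inv m.1 m.2 (hj.F_le m.2)]

open Classical in
/-- For a complete dir-inv module, the canonical isomorphism from its completion to itself: it is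
the composition of the canonical bijections between the completion, `colim_j F j` and `M`. -/
def completionEquiv (M : DirInvModule C) (h : M.IsComplete) : M.Completion ≃ₗ[C] M :=
  (LinearEquiv.ofBijective M.colimToCompletion h.colimToCompletion_bijective).symm.trans
    (LinearEquiv.ofBijective M.colimToModule h.colimToModule_bijective)

/-- The tensor product of two dir-inv modules: `F (j, k)` is the image of `F j ⊗ F k`, and its
`i`-th submodule is the sum of the images of `fil j i ⊗ F k` and `F j ⊗ fil k i`. -/
def tensor (M N : DirInvModule C) : DirInvModule C where
  carrier := TensorProduct C M N
  index := M.index × N.index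
  partialOrder := inferInstance
  directed := ⟨fun a b => by
    obtain ⟨j, h1, h2⟩ := exists_ge_ge a.1 b.1
    obtain ⟨k, h3, h4⟩ := exists_ge_ge a.2 b.2
    exact ⟨(j, k), ⟨h1, h3⟩, ⟨h2, h4⟩⟩⟩
  F jk := Submodule.map₂ (TensorProduct.mk C M N) (M.F jk.1) (N.F jk.2)
  F_mono _ _ h := Submodule.map₂_le_map₂ (M.F_mono h.1) (N.F_mono h.2)
  fil jk i := Submodule.map₂ (TensorProduct.mk C M N) (M.fil jk.1 i) (N.F jk.2) ⊔
    Submodule.map₂ (TensorProduct.mk C M N) (M.F jk.1) (N.fil jk.2 i)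
  fil_le jk i := sup_le (Submodule.map₂_le_map₂ (M.fil_le _ _) le_rfl)
    (Submodule.map₂_le_map₂ le_rfl (N.fil_le _ _))
  fil_anti jk _ _ h := sup_le_sup (Submodule.map₂_le_map₂ (M.fil_anti _ h) le_rfl)
    (Submodule.map₂_le_map₂ le_rfl (N.fil_anti _ h))
  fil_cont jk jk' h i := by
    obtain ⟨a, ha⟩ := M.fil_cont _ _ h.1 i
    obtain ⟨b, hb⟩ := N.fil_cont _ _ h.2 i
    exact ⟨max a b, sup_le_sup
      (Submodule.map₂_le_map₂ ((M.fil_anti _ (le_max_left a b)).trans ha) (N.F_mono h.2))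
      (Submodule.map₂_le_map₂ (M.F_mono h.1) ((N.fil_anti _ (le_max_right a b)).trans hb))⟩

theorem map₂_mk_le_comap {M N M' N' : Type u} [AddCommGroup M] [Module C M] [AddCommGroup N]
    [Module C N] [AddCommGroup M'] [Module C M'] [AddCommGroup N'] [Module C N']
    (f : M →ₗ[C] M') (g : N →ₗ[C] N') {p : Submodule C M} {q : Submodule C N}
    {p' : Submodule C M'} {q' : Submodule C N'} (hp : p ≤ p'.comap f) (hq : q ≤ q'.comap g) :
    Submodule.map₂ (TensorProduct.mk C M N) p q ≤
      (Submodule.map₂ (TensorProduct.mk C M' N') p' q').comap (TensorProduct.map f g) := by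
  rw [Submodule.map₂_le]
  intro m hm n hn
  exact Submodule.apply_mem_map₂ (TensorProduct.mk C M' N') (hp hm) (hq hn)

/-- The tensor product of two morphisms of dir-inv modules. -/
def tensorMap {M N M' N' : DirInvModule C} (f : M ⟶ M') (g : N ⟶ N') :
    tensor M N ⟶ tensor M' N' where
  lin := TensorProduct.map (Hom.lin f) (Hom.lin g)
  cont := by
    rintro ⟨j, k⟩
    obtain ⟨j', hj⟩ := f.cont j
    obtain ⟨k', hk⟩ := g.cont k
    refine ⟨(j', k'), map₂_mk_le_comap _ _ hj.F_le hk.F_le, fun i => ?_⟩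
    obtain ⟨a, ha⟩ := hj.fil_le i
    obtain ⟨b, hb⟩ := hk.fil_le i
    refine ⟨max a b, sup_le ?_ ?_⟩
    · exact (map₂_mk_le_comap _ _ ((M.fil_anti _ (le_max_left a b)).trans ha) hk.F_le).trans
        (Submodule.comap_mono le_sup_left)
    · exact (map₂_mk_le_comap _ _ hj.F_le ((N.fil_anti _ (le_max_right a b)).trans hb)).trans
        (Submodule.comap_mono le_sup_right)

theorem tensorMap_comp {M N M' N' M'' N'' : DirInvModule C} (f : M ⟶ M') (g : N ⟶ N')
    (f' : M' ⟶ M'') (g' : N' ⟶ N'') :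
    tensorMap (f ≫ f') (g ≫ g') = tensorMap f g ≫ tensorMap f' g' :=
  hom_ext (TensorProduct.map_comp _ _ _ _)

/-- A module, viewed as a discrete inv module (with the zero filtration), and hence as a dir-inv
module indexed by a point. -/
def discrete (M : Type u) [AddCommGroup M] [Module C M] : DirInvModule C where
  carrier := M
  index := PUnit
  F _ := ⊤
  F_mono _ _ _ := le_rfl
  fil _ _ := ⊥
  fil_le _ _ := bot_le
  fil_anti _ _ _ _ := le_rfl
  fil_cont _ _ _ _ := ⟨0, le_rfl⟩

/-- A linear map, viewed as a morphism of discrete dir-inv modules. -/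
def discreteMap {M N : Type u} [AddCommGroup M] [Module C M] [AddCommGroup N] [Module C N]
    (f : M →ₗ[C] N) : discrete (C := C) M ⟶ discrete (C := C) N where
  lin := f
  cont _ := ⟨PUnit.unit, fun _ _ => trivial, fun _ => ⟨0, bot_le⟩⟩

/-- The canonical morphism `C ⊗ M → M` of dir-inv modules. -/
def lidHom (M : DirInvModule C) : tensor (discrete (C := C) C) M ⟶ M where
  lin := (TensorProduct.lid C M).toLinearMap
  cont := by
    rintro ⟨_, k⟩
    refine ⟨k, ?_, fun i => ⟨i, sup_le ?_ ?_⟩⟩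
    · refine Submodule.map₂_le.2 fun c _ m hm => ?_
      exact (M.F k).smul_mem c hm
    · refine Submodule.map₂_le.2 fun c hc m hm => ?_
      have hc0 : c = 0 := hc
      subst hc0
      change (0 : C) • m ∈ M.fil k i
      rw [zero_smul]
      exact zero_mem _
    · refine Submodule.map₂_le.2 fun c _ m hm => ?_
      exact (M.fil k i).smul_mem c hm

end DirInvModule

section Forms

variable (K : Type u) [Field K]

/-- The ideal of `K[t_0, ..., t_l]` generated by `t_0 + ... + t_l - 1`. -/
def simplexIdeal (l : ℕ) : Ideal (MvPolynomial (Fin (l + 1)) K) :=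
  Ideal.span {∑ i, MvPolynomial.X i - 1}

/-- The coordinate ring `K[t_0, ..., t_l] / (t_0 + ... + t_l - 1)` of the geometric simplex. -/
abbrev SimplexRing (l : ℕ) : Type u := MvPolynomial (Fin (l + 1)) K ⧸ simplexIdeal K l

/-- The space of translations of the affine space `t_0 + ... + t_l = 1`; it is the tangent space
of the geometric simplex at each of its points. -/
def simplexTangent (l : ℕ) : Submodule K (Fin (l + 1) → K) where
  carrier := {v | ∑ i, v i = 0}
  add_mem' := by
    intro v w hv hw
    simp only [Set.mem_ofPred_eq, Pi.add_apply, Finset.sum_add_distrib] at *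
    rw [hv, hw, add_zero]
  zero_mem' := by simp
  smul_mem' := by
    intro c v hv
    simp only [Set.mem_ofPred_eq, Pi.smul_apply, ← Finset.smul_sum] at *
    rw [hv, smul_zero]

variable {K}

/-- The linear map out of the coordinate ring of the simplex given by a linear map `φ` on
polynomials that vanishes on the multiples of `t_0 + ... + t_l - 1`. -/
def simplexLift {l : ℕ} {W : Type u} [AddCommGroup W] [Module K W]
    (φ : MvPolynomial (Fin (l + 1)) K →ₗ[K] W)
    (h : ∀ p, φ (p * (∑ i, MvPolynomial.X i - 1)) = 0) : SimplexRing K l →ₗ[K] W :=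
  ((simplexIdeal K l).restrictScalars K).liftQ φ (by
    intro x hx
    obtain ⟨p, rfl⟩ := Ideal.mem_span_singleton'.1 hx
    exact h p) ∘ₗ
  (Submodule.Quotient.restrictScalarsEquiv K (simplexIdeal K l)).symm.toLinearMap

theorem simplexLift_mk {l : ℕ} {W : Type u} [AddCommGroup W] [Module K W]
    (φ : MvPolynomial (Fin (l + 1)) K →ₗ[K] W)
    (h : ∀ p, φ (p * (∑ i, MvPolynomial.X i - 1)) = 0) (p : MvPolynomial (Fin (l + 1)) K) :
    simplexLift φ h (Ideal.Quotient.mk (simplexIdeal K l) p) = φ p := rfl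

/-- The derivation `∑ i, v i * ∂ / ∂ t_i` of the polynomial ring. -/
def polyDeriv {l : ℕ} (v : Fin (l + 1) → K) :
    Derivation K (MvPolynomial (Fin (l + 1)) K) (MvPolynomial (Fin (l + 1)) K) :=
  MvPolynomial.mkDerivation K fun i => MvPolynomial.C (v i)

theorem simplexRel_eq_zero (l : ℕ) :
    Ideal.Quotient.mk (simplexIdeal K l) (∑ i, MvPolynomial.X i - 1) = 0 :=
  Ideal.Quotient.eq_zero_iff_mem.2 (Ideal.subset_span rfl)

/-- The directional derivative `∂_v` on the coordinate ring of the simplex, for a tangent vector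
`v`. -/
def dirDeriv {l : ℕ} (v : simplexTangent K l) : SimplexRing K l →ₗ[K] SimplexRing K l :=
  simplexLift ((Ideal.Quotient.mkₐ K (simplexIdeal K l)).toLinearMap ∘ₗ
    (polyDeriv v.1 : MvPolynomial (Fin (l + 1)) K →ₗ[K] MvPolynomial (Fin (l + 1)) K)) (by
    intro p
    have h0 : polyDeriv v.1 (∑ i, MvPolynomial.X i - 1) = 0 := by
      have hv : ∑ i, v.1 i = 0 := v.2
      rw [map_sub, map_sum, Derivation.map_one_eq_zero, sub_zero]
      simp only [polyDeriv, MvPolynomial.mkDerivation_X]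
      rw [← map_sum, hv, map_zero]
    simp only [LinearMap.comp_apply, Derivation.coeFn_coe, AlgHom.toLinearMap_apply,
      Ideal.Quotient.mkₐ_eq_mk]
    rw [Derivation.leibniz, h0, smul_zero, zero_add, smul_eq_mul, map_mul, simplexRel_eq_zero,
      zero_mul])

theorem dirDeriv_mk {l : ℕ} (v : simplexTangent K l) (p : MvPolynomial (Fin (l + 1)) K) :
    dirDeriv v (Ideal.Quotient.mk _ p) = Ideal.Quotient.mk _ (polyDeriv v.1 p) := rfl

theorem polyDeriv_add {l : ℕ} (v w : Fin (l + 1) → K) :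
    polyDeriv (v + w) = polyDeriv v + polyDeriv w := by
  apply MvPolynomial.derivation_ext
  intro j
  simp [polyDeriv]

theorem polyDeriv_smul {l : ℕ} (c : K) (v : Fin (l + 1) → K) :
    polyDeriv (c • v) = c • polyDeriv v := by
  apply MvPolynomial.derivation_ext
  intro j
  simp [polyDeriv, MvPolynomial.smul_eq_C_mul]

/-- The directional derivative, as a linear map in the tangent vector. -/
def dirDerivLin (l : ℕ) :
    simplexTangent K l →ₗ[K] SimplexRing K l →ₗ[K] SimplexRing K l where
  toFun := dirDeriv
  map_add' v w := by
    refine LinearMap.ext fun f => ?_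
    obtain ⟨p, rfl⟩ := Ideal.Quotient.mk_surjective f
    rw [LinearMap.add_apply, dirDeriv_mk, dirDeriv_mk, dirDeriv_mk, Submodule.coe_add,
      polyDeriv_add, Derivation.add_apply, map_add]
  map_smul' c v := by
    refine LinearMap.ext fun f => ?_
    obtain ⟨p, rfl⟩ := Ideal.Quotient.mk_surjective f
    rw [RingHom.id_apply, LinearMap.smul_apply, dirDeriv_mk, dirDeriv_mk, Submodule.coe_smul,
      polyDeriv_smul, Derivation.smul_apply]
    rfl

theorem dirDeriv_comm {l : ℕ} (v w : simplexTangent K l) (f : SimplexRing K l) :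
    dirDeriv v (dirDeriv w f) = dirDeriv w (dirDeriv v f) := by
  obtain ⟨p, rfl⟩ := Ideal.Quotient.mk_surjective f
  rw [dirDeriv_mk, dirDeriv_mk, dirDeriv_mk, dirDeriv_mk]
  refine congrArg _ ?_
  have h : ⁅polyDeriv v.1, polyDeriv w.1⁆ = 0 := by
    apply MvPolynomial.derivation_ext
    intro i
    simp [Derivation.commutator_apply, polyDeriv]
  have h2 := congrArg (fun D => D p) h
  simpa [Derivation.commutator_apply, sub_eq_zero] using h2

variable (K) in
/-- The module of algebraic differential `q`-forms on the geometric simplex of dimension `l`.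
The simplex is an affine space with tangent space `simplexTangent K l`, so a `q`-form is an
alternating `q`-form on this vector space with values in the coordinate ring; for instance
`f * dt_{i_1} ∧ ... ∧ dt_{i_q}` is the form
`(v_1, ..., v_q) ↦ f * det (v_b (i_a))_{a, b}`. -/
abbrev Form (q l : ℕ) : Type u := (simplexTangent K l) [⋀^Fin q]→ₗ[K] (SimplexRing K l)

/-- The covariant differential: `(v, v_1, ..., v_q) ↦ ∂_v (ω (v_1, ..., v_q))`. -/
def formGrad (q l : ℕ) :
    Form K q l →ₗ[K] simplexTangent K l →ₗ[K] Form K q l :=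
  LinearMap.mk₂ K (fun ω v => (dirDerivLin l v).compAlternatingMap ω)
    (fun ω η v => by ext; simp) (fun c ω v => by ext; simp)
    (fun ω v w => by ext; simp) (fun c ω v => by ext; simp)

/-- The exterior derivative:
`dω (v_0, ..., v_q) = ∑ i, (-1) ^ i * ∂_{v_i} (ω (v_0, ..., v_{i-1}, v_{i+1}, ..., v_q))`. -/
def formD (q l : ℕ) : Form K q l →ₗ[K] Form K (q + 1) l :=
  AlternatingMap.alternatizeUncurryFinLM ∘ₗ formGrad q l

theorem formD_apply {q l : ℕ} (ω : Form K q l) (v : Fin (q + 1) → simplexTangent K l) :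
    formD (K := K) q l ω v = ∑ i : Fin (q + 1), (-1 : ℤ) ^ (i : ℕ) • dirDeriv (v i) (ω (i.removeNth v)) := by
  simp [formD, AlternatingMap.alternatizeUncurryFin_apply, formGrad, dirDerivLin]

theorem formD_formD (q l : ℕ) : formD (K := K) (q + 1) l ∘ₗ formD q l = 0 := by
  refine LinearMap.ext fun ω => ?_
  let f : simplexTangent K l →ₗ[K] simplexTangent K l →ₗ[K] Form K q l :=
    (formGrad (K := K) q l ∘ₗ formGrad (K := K) q l ω).flip
  have hf : ∀ x y, f x y = f y x := by
    intro x y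
    ext v
    exact dirDeriv_comm _ _ _
  have h : formGrad (K := K) (q + 1) l (formD (K := K) q l ω) =
      AlternatingMap.alternatizeUncurryFinLM ∘ₗ f := by
    refine LinearMap.ext fun x => AlternatingMap.ext fun v => ?_
    have h1 : formGrad (K := K) (q + 1) l (formD (K := K) q l ω) x v =
        dirDeriv x (formD (K := K) q l ω v) := rfl
    rw [h1, formD_apply, map_sum, LinearMap.comp_apply,
      AlternatingMap.alternatizeUncurryFinLM_apply, AlternatingMap.alternatizeUncurryFin_apply]
    refine Finset.sum_congr rfl fun i _ => ?_
    rw [map_zsmul]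
    rfl
  have h2 := AlternatingMap.alternatizeUncurryFin_alternatizeUncurryFinLM_comp_of_symmetric hf
  rw [← h] at h2
  exact h2

/-- The affine map of polynomial rings `t_j ↦ ∑_{α i = j} t_i` attached to `α`. -/
def polyPullback {k l : ℕ} (α : Fin (k + 1) → Fin (l + 1)) :
    MvPolynomial (Fin (l + 1)) K →ₐ[K] MvPolynomial (Fin (k + 1)) K :=
  MvPolynomial.aeval fun j => ∑ i with α i = j, MvPolynomial.X i

/-- The homomorphism of coordinate rings `t_j ↦ ∑_{α i = j} t_i`, which corresponds to the linear
morphism of simplices that sends the vertex `i` to the vertex `α i`. -/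
def ringPullback {k l : ℕ} (α : Fin (k + 1) → Fin (l + 1)) :
    SimplexRing K l →ₐ[K] SimplexRing K k :=
  Ideal.quotientMapₐ _ (polyPullback α) (by
    rw [simplexIdeal, Ideal.span_le, Set.singleton_subset_iff]
    have : polyPullback (K := K) α (∑ j, MvPolynomial.X j - 1) = ∑ i, MvPolynomial.X i - 1 := by
      simp only [polyPullback, map_sub, map_sum, MvPolynomial.aeval_X, map_one]
      rw [Finset.sum_fiberwise]
    change polyPullback α _ ∈ simplexIdeal K k
    rw [this]
    exact Ideal.subset_span rfl)

theorem ringPullback_mk {k l : ℕ} (α : Fin (k + 1) → Fin (l + 1))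
    (p : MvPolynomial (Fin (l + 1)) K) :
    ringPullback α (Ideal.Quotient.mk _ p) = Ideal.Quotient.mk _ (polyPullback α p) := rfl

/-- The tangent map `v ↦ (∑_{α i = j} v i)_j` of the linear morphism of simplices. -/
def tangentMap {k l : ℕ} (α : Fin (k + 1) → Fin (l + 1)) :
    simplexTangent K k →ₗ[K] simplexTangent K l where
  toFun v := ⟨fun j => ∑ i with α i = j, v.1 i, by
    have hv : ∑ i, v.1 i = 0 := v.2
    change ∑ j, ∑ i with α i = j, v.1 i = 0
    rw [Finset.sum_fiberwise, hv]⟩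
  map_add' v w := by
    ext j
    simp [Finset.sum_add_distrib]
  map_smul' c v := by
    ext j
    simp [Finset.mul_sum]

/-- The pullback of differential forms along the linear morphism of simplices. -/
def formPullback (q : ℕ) {k l : ℕ} (α : Fin (k + 1) → Fin (l + 1)) :
    Form K q l →ₗ[K] Form K q k where
  toFun ω := ((ringPullback α).toLinearMap.compAlternatingMap ω).compLinearMap (tangentMap α)
  map_add' ω η := by ext; simp
  map_smul' c ω := by ext; simp

theorem dirDeriv_ringPullback {k l : ℕ} (α : Fin (k + 1) → Fin (l + 1))
    (v : simplexTangent K k) (f : SimplexRing K l) :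
    dirDeriv v (ringPullback α f) = ringPullback α (dirDeriv (tangentMap α v) f) := by
  obtain ⟨p, rfl⟩ := Ideal.Quotient.mk_surjective f
  simp only [dirDeriv_mk, ringPullback_mk]
  congr 1
  induction p using MvPolynomial.induction_on with
  | C a => simp [polyPullback, polyDeriv]
  | add p q hp hq => simp only [map_add, hp, hq]
  | mul_X p j hp =>
    simp only [map_mul, Derivation.leibniz, map_add, smul_eq_mul, hp]
    congr 2
    simp [polyPullback, polyDeriv, tangentMap]

theorem formD_formPullback (q : ℕ) {k l : ℕ} (α : Fin (k + 1) → Fin (l + 1)) :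
    formD q k ∘ₗ formPullback (K := K) q α = formPullback (q + 1) α ∘ₗ formD q l := by
  ext ω v
  simp only [LinearMap.comp_apply, formD_apply, formPullback, LinearMap.coe_mk, AddHom.coe_mk,
    AlternatingMap.compLinearMap_apply, LinearMap.compAlternatingMap_apply,
    AlgHom.toLinearMap_apply, dirDeriv_ringPullback, map_sum, map_zsmul]
  rfl

/-- Integration of polynomials over the simplex with respect to `dt_1 ... dt_l`:
`∫ t_0 ^ a_0 ... t_l ^ a_l dt_1 ... dt_l = a_0! ... a_l! / (l + a_0 + ... + a_l)!`. -/
def polyIntegral (l : ℕ) : MvPolynomial (Fin (l + 1)) K →ₗ[K] K :=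
  (MvPolynomial.basisMonomials (Fin (l + 1)) K).constr K fun a =>
    (∏ i, ((a i).factorial : K)) / ((l + ∑ i, a i).factorial : K)

theorem polyIntegral_monomial (l : ℕ) (a : Fin (l + 1) →₀ ℕ) (c : K) :
    polyIntegral l (MvPolynomial.monomial a c) =
      c * ((∏ i, ((a i).factorial : K)) / ((l + ∑ i, a i).factorial : K)) := by
  have h : MvPolynomial.monomial a c =
      c • MvPolynomial.basisMonomials (Fin (l + 1)) K a := by
    rw [MvPolynomial.coe_basisMonomials, MvPolynomial.smul_monomial, smul_eq_mul, mul_one]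
  rw [h, map_smul, polyIntegral, Module.Basis.constr_basis, smul_eq_mul]

theorem polyIntegral_rel [CharZero K] (l : ℕ) (p : MvPolynomial (Fin (l + 1)) K) :
    polyIntegral l (p * (∑ i, MvPolynomial.X i - 1)) = 0 := by
  induction p using MvPolynomial.induction_on' with
  | add p q hp hq => rw [add_mul, map_add, hp, hq, add_zero]
  | monomial a c =>
    have hX : ∀ i : Fin (l + 1), MvPolynomial.monomial a c * MvPolynomial.X i =
        MvPolynomial.monomial (a + Finsupp.single i 1) c := by
      intro i
      rw [MvPolynomial.X, MvPolynomial.monomial_mul, mul_one]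
    have hs : ∀ i : Fin (l + 1), ∑ j, (a + Finsupp.single i 1 : Fin (l + 1) →₀ ℕ) j = ∑ j, a j + 1 := by
      intro i
      simp [Finset.sum_add_distrib, Finsupp.single_apply]
    have hp : ∀ i : Fin (l + 1), ∏ j, (((a + Finsupp.single i 1 : Fin (l + 1) →₀ ℕ) j).factorial : K) =
        (a i + 1) * ∏ j, ((a j).factorial : K) := by
      intro i
      rw [← Finset.mul_prod_erase _ _ (Finset.mem_univ i),
        ← Finset.mul_prod_erase _ (fun j => ((a j).factorial : K)) (Finset.mem_univ i), ← mul_assoc]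
      congr 1
      · simp [Nat.factorial_succ]
      · refine Finset.prod_congr rfl fun j hj => ?_
        have hji : j ≠ i := Finset.ne_of_mem_erase hj
        simp [hji.symm]
    rw [mul_sub, mul_one, Finset.mul_sum, map_sub, map_sum, sub_eq_zero]
    simp only [hX, polyIntegral_monomial, hs, hp]
    rw [← Finset.mul_sum, ← Finset.sum_div, ← Finset.sum_mul, Finset.sum_add_distrib]
    have h1 : (l + (∑ j, a j + 1)).factorial =
        (l + ∑ j, a j + 1) * (l + ∑ j, a j).factorial := by
      rw [← add_assoc, Nat.factorial_succ]
    have h2 : ((l + ∑ j, a j).factorial : K) ≠ 0 := Nat.cast_ne_zero.2 (Nat.factorial_ne_zero _)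
    have h3 : ((l + ∑ j, a j + 1 : ℕ) : K) ≠ 0 := Nat.cast_ne_zero.2 (Nat.succ_ne_zero _)
    rw [h1, Nat.cast_mul]
    have h4 : ∑ i, (a i : K) + ∑ i : Fin (l + 1), (1 : K) = ((l + ∑ j, a j + 1 : ℕ) : K) := by
      simp
      ring
    rw [h4, mul_div_mul_left _ _ h3]

/-- Integration over the simplex of functions, with respect to `dt_1 ... dt_l`. -/
def ringIntegral [CharZero K] (l : ℕ) : SimplexRing K l →ₗ[K] K :=
  simplexLift (polyIntegral l) (polyIntegral_rel l)

/-- The tangent vector from the vertex `0` to the vertex `i + 1`. -/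
def edgeVector {l : ℕ} (i : Fin l) : simplexTangent K l :=
  ⟨Pi.single i.succ (1 : K) - Pi.single (0 : Fin (l + 1)) (1 : K), by
    change ∑ j, ((Pi.single i.succ (1 : K) : Fin (l + 1) → K) j -
      (Pi.single (0 : Fin (l + 1)) (1 : K) : Fin (l + 1) → K) j) = 0
    simp⟩

/-- Integration of top degree forms on the simplex. A form of degree `l` is `f dt_1 ∧ ... ∧ dt_l`,
where `f` is its value on the vectors from the vertex `0` to the vertices `1, ..., l`. -/
def formIntegral [CharZero K] (l : ℕ) : Form K l l →ₗ[K] K where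
  toFun ω := ringIntegral l (ω edgeVector)
  map_add' ω η := by simp
  map_smul' c ω := by simp

end Forms

section Normalization

open Simplicial

variable {K : Type u} [CommRing K]

/-- The submodule `N^q X = ⋂_{i < q} Ker (s^i : X^q → X^{q-1})` of `X^q`. -/
def normSub (X : CosimplicialObject (ModuleCat.{u} K)) (q : ℕ) : Submodule K (X.obj ⦋q⦌) :=
  match q with
  | 0 => ⊤
  | q + 1 => ⨅ i : Fin (q + 1), LinearMap.ker (X.σ i).hom

theorem objD_mem_normSub (X : CosimplicialObject (ModuleCat.{u} K)) (q : ℕ) (m : X.obj ⦋q⦌)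
    (hm : m ∈ normSub X q) :
    (AlgebraicTopology.AlternatingCofaceMapComplex.objD X q).hom m ∈ normSub X (q + 1) := by
  simp only [normSub, Submodule.mem_iInf, LinearMap.mem_ker]
  intro j
  have hsum : (X.σ j).hom ((AlgebraicTopology.AlternatingCofaceMapComplex.objD X q).hom m) =
      ∑ i : Fin (q + 2), (-1 : ℤ) ^ (i : ℕ) • (X.δ i ≫ X.σ j).hom m := by
    simp [AlgebraicTopology.AlternatingCofaceMapComplex.objD, ModuleCat.hom_sum,
      LinearMap.sum_apply]
  rw [hsum, Fintype.sum_eq_add j.castSucc j.succ (Fin.castSucc_lt_succ).ne]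
  · rw [CosimplicialObject.δ_comp_σ_self, CosimplicialObject.δ_comp_σ_succ]
    simp [pow_succ]
  · rintro i ⟨hi1, hi2⟩
    cases q with
    | zero =>
      exfalso
      fin_cases i <;> fin_cases j <;> simp_all
    | succ n =>
      simp only [normSub, Submodule.mem_iInf, LinearMap.mem_ker] at hm
      rcases lt_or_gt_of_ne hi1 with h | h
      · have hi : (i : ℕ) < j := h
        have e2 : j = (⟨j - 1, by omega⟩ : Fin (n + 1)).succ := by
          ext
          simp
          omega
        have e3 : X.δ i ≫ X.σ j = X.σ (⟨j - 1, by omega⟩ : Fin (n + 1)) ≫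
            X.δ (⟨i, by omega⟩ : Fin (n + 2)) := by
          rw [← CosimplicialObject.δ_comp_σ_of_le X (by
            rw [Fin.le_def]
            simp
            omega), ← e2]
          rfl
        rw [e3, ModuleCat.hom_comp, LinearMap.comp_apply, hm, map_zero, smul_zero]
      · have hi : (j : ℕ) < i := h
        have hi' : (i : ℕ) ≠ j + 1 := fun h' => hi2 (Fin.ext h')
        have e1 : i = (⟨i - 1, by omega⟩ : Fin (n + 2)).succ := by
          ext
          simp
          omega
        have e3 : X.δ i ≫ X.σ j = X.σ (⟨j, by omega⟩ : Fin (n + 1)) ≫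
            X.δ (⟨i - 1, by omega⟩ : Fin (n + 2)) := by
          rw [← CosimplicialObject.δ_comp_σ_of_gt X (by
            rw [Fin.lt_def]
            simp
            omega), ← e1]
          rfl
        rw [e3, ModuleCat.hom_comp, LinearMap.comp_apply, hm, map_zero, smul_zero]

/-- The standard normalization of a cosimplicial module: the subcomplex `⋂_i Ker s^i` with the
differential `∑ i, (-1) ^ i ∂^i`. -/
def stdNormalization (X : CosimplicialObject (ModuleCat.{u} K)) :
    CochainComplex (ModuleCat.{u} K) ℕ :=
  CochainComplex.of (fun q => ModuleCat.of K (normSub X q))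
    (fun q => ModuleCat.ofHom
      ((AlgebraicTopology.AlternatingCofaceMapComplex.objD X q).hom.restrict
        (objD_mem_normSub X q)))
    (by
      intro q
      refine ModuleCat.hom_ext (LinearMap.ext fun m => Subtype.ext ?_)
      have := AlgebraicTopology.AlternatingCofaceMapComplex.d_squared X q
      exact congrArg (fun f => f.hom m.1) this)

end Normalization

section ThomSullivan

open Simplicial DirInvModule

variable {K : Type u} [Field K]

/-- The completed tensor product `Ω^q(Δ^k) ⊗̂ M^l`, where `Ω^q(Δ^k)` is discrete. -/
abbrev FormTensor (M : CosimplicialObject (DirInvModule K)) (q k l : ℕ) : Type u :=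
  (tensor (discrete (C := K) (Form K q k)) (M.obj ⦋l⦌)).Completion

/-- The map `1 ⊗̂ α^* : Ω^q(Δ^k) ⊗̂ M^k → Ω^q(Δ^k) ⊗̂ M^l`. -/
def coface (M : CosimplicialObject (DirInvModule K)) (q : ℕ) {k l : ℕ} (α : ⦋k⦌ ⟶ ⦋l⦌) :
    FormTensor M q k k →ₗ[K] FormTensor M q k l :=
  completionMap (tensorMap (𝟙 (discrete (C := K) (Form K q k))) (M.map α))

/-- The map `α_* ⊗̂ 1 : Ω^q(Δ^l) ⊗̂ M^l → Ω^q(Δ^k) ⊗̂ M^l`. -/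
def restrictForm (M : CosimplicialObject (DirInvModule K)) (q : ℕ) {k l : ℕ} (α : ⦋k⦌ ⟶ ⦋l⦌) :
    FormTensor M q l l →ₗ[K] FormTensor M q k l :=
  completionMap (tensorMap (discreteMap (formPullback q α.toOrderHom)) (𝟙 (M.obj ⦋l⦌)))

/-- The map `d ⊗̂ 1 : Ω^q(Δ^k) ⊗̂ M^l → Ω^{q+1}(Δ^k) ⊗̂ M^l`. -/
def completedD (M : CosimplicialObject (DirInvModule K)) (q k l : ℕ) :
    FormTensor M q k l →ₗ[K] FormTensor M (q + 1) k l :=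
  completionMap (tensorMap (discreteMap (formD q k)) (𝟙 (M.obj ⦋l⦌)))

/-- The degree `q` component of the complete Thom-Sullivan normalization: the sequences
`(u_0, u_1, ...)` with `u_l ∈ Ω^q(Δ^l) ⊗̂ M^l` such that `(1 ⊗ α^*)(u_k) = (α_* ⊗ 1)(u_l)` for
all `α : [k] → [l]`. -/
def thomSullivanSub (M : CosimplicialObject (DirInvModule K)) (q : ℕ) :
    Submodule K (∀ l, FormTensor M q l l) where
  carrier := {u | ∀ (k l : ℕ) (α : ⦋k⦌ ⟶ ⦋l⦌), coface M q α (u k) = restrictForm M q α (u l)}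
  add_mem' := by
    intro u v hu hv k l α
    rw [Pi.add_apply, Pi.add_apply, map_add, map_add, hu k l α, hv k l α]
  zero_mem' := by
    intro k l α
    rw [Pi.zero_apply, Pi.zero_apply, map_zero, map_zero]
  smul_mem' := by
    intro c u hu k l α
    rw [Pi.smul_apply, Pi.smul_apply, map_smul, map_smul, hu k l α]

theorem coface_completedD (M : CosimplicialObject (DirInvModule K)) (q : ℕ) {k l : ℕ}
    (α : ⦋k⦌ ⟶ ⦋l⦌) (x : FormTensor M q k k) :
    coface M (q + 1) α (completedD M q k k x) = completedD M q k l (coface M q α x) := by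
  simp only [coface, completedD]
  rw [← LinearMap.comp_apply, ← LinearMap.comp_apply, ← completionMap_comp,
    ← completionMap_comp, ← tensorMap_comp, ← tensorMap_comp, Category.comp_id,
    Category.id_comp, Category.comp_id, Category.id_comp]

theorem restrictForm_completedD (M : CosimplicialObject (DirInvModule K)) (q : ℕ) {k l : ℕ}
    (α : ⦋k⦌ ⟶ ⦋l⦌) (x : FormTensor M q l l) :
    restrictForm M (q + 1) α (completedD M q l l x) =
      completedD M q k l (restrictForm M q α x) := by
  simp only [restrictForm, completedD]
  rw [← LinearMap.comp_apply, ← LinearMap.comp_apply, ← completionMap_comp,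
    ← completionMap_comp, ← tensorMap_comp, ← tensorMap_comp]
  have h : discreteMap (formD (K := K) q l) ≫ discreteMap (formPullback (q + 1) α.toOrderHom) =
      discreteMap (formPullback q α.toOrderHom) ≫ discreteMap (formD q k) :=
    hom_ext (formD_formPullback (K := K) q α.toOrderHom).symm
  rw [h]

theorem completedD_completedD (M : CosimplicialObject (DirInvModule K)) (q k l : ℕ)
    (x : FormTensor M q k l) : completedD M (q + 1) k l (completedD M q k l x) = 0 := by
  simp only [completedD]
  rw [← LinearMap.comp_apply, ← completionMap_comp, ← tensorMap_comp, completionMap_zero]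
  · rfl
  · have h : Hom.lin (discreteMap (formD (K := K) q k) ≫ discreteMap (formD (q + 1) k)) = 0 :=
      formD_formD q k
    change TensorProduct.map _ _ = 0
    rw [h, TensorProduct.map_zero_left]

/-- The coboundary operator of the complete Thom-Sullivan normalization. -/
def thomSullivanD (M : CosimplicialObject (DirInvModule K)) (q : ℕ) :
    thomSullivanSub M q →ₗ[K] thomSullivanSub M (q + 1) :=
  LinearMap.restrict (LinearMap.pi fun l => completedD M q l l ∘ₗ LinearMap.proj l) (by
    intro u hu k l α
    simp only [LinearMap.pi_apply, LinearMap.comp_apply, LinearMap.proj_apply]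
    rw [coface_completedD, restrictForm_completedD, hu k l α])

/-- The complete Thom-Sullivan normalization of a cosimplicial dir-inv module. -/
def thomSullivan (M : CosimplicialObject (DirInvModule K)) :
    CochainComplex (ModuleCat.{u} K) ℕ :=
  CochainComplex.of (fun q => ModuleCat.of K (thomSullivanSub M q))
    (fun q => ModuleCat.ofHom (thomSullivanD M q))
    (by
      intro q
      refine ModuleCat.hom_ext (LinearMap.ext fun u => Subtype.ext (funext fun l => ?_))
      exact completedD_completedD M q l l (u.1 l))

/-- The underlying cosimplicial module of a cosimplicial dir-inv module. -/
def underlying (M : CosimplicialObject (DirInvModule K)) :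
    CosimplicialObject (ModuleCat.{u} K) :=
  M ⋙ forgetToModule K

/-- The integral `Ω^l(Δ^l) ⊗̂ M → K ⊗̂ M ≅ M`, for a complete dir-inv module `M`. -/
def completedIntegral [CharZero K] (l : ℕ) (M : DirInvModule K) (hM : M.IsComplete) :
    (tensor (discrete (C := K) (Form K l l)) M).Completion →ₗ[K] M :=
  (M.completionEquiv hM).toLinearMap ∘ₗ completionMap (lidHom M) ∘ₗ
    completionMap (tensorMap (discreteMap (formIntegral l)) (𝟙 M))

/-- The `l`-th entry `u_l` of an element `u = (u_0, u_1, ...)` of degree `q` of the complete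
Thom-Sullivan normalization. -/
def thomSullivanEntry (M : CosimplicialObject (DirInvModule K)) (q l : ℕ) :
    (thomSullivan M).X q →ₗ[K] FormTensor M q l l :=
  LinearMap.proj (φ := fun l => FormTensor M q l l) l ∘ₗ (thomSullivanSub M q).subtype

/-- The inclusion of the degree `q` component of the standard normalization into `M^q`. -/
def stdInclusion (M : CosimplicialObject (DirInvModule K)) (q : ℕ) :
    (stdNormalization (underlying M)).X q →ₗ[K] M.obj ⦋q⦌ :=
  (normSub (underlying M) q).subtype

end ThomSullivan

end

end DirInv

/-!
The argument is Dupont's, symmetrized over the vertices. The radial contraction of `Δ^l` to its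
vertex `i` gives a homotopy operator `h i` on the polynomial forms, with `d h + h d = 1` in positive
degrees and `h d f = f - f(e_i)` on functions. Summing over all tuples of vertices
`I = (i₁, …, iₖ)`, ordered or not, let `Pₖ = ∑ dt i₁ ⋯ dt iₖ h iₖ ⋯ h i₁` and
`Wₖ = ∑ w I h iₖ ⋯ h i₁`, where `w I = ∑ⱼ ± t iⱼ dt i₁ ⋯ dt iₖ` omits the factor `dt iⱼ`.
From `∑ t i = 1` and `∑ dt i = 0` one gets `d Wₖ₊₁ + Wₖ₊₁ d = (k + 1) (Pₖ₊₁ + Pₖ)`, so the sum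
`∑ (-1)ᵏ / (k + 1) Wₖ₊₁` telescopes to a homotopy between the identity and the projection
`ω ↦ ∑ (∫_I ω) ω_I` onto the Whitney forms.

Because all vertices enter symmetrically, this homotopy commutes with the pullback along every
simplicial map, and hence acts on the complete Thom–Sullivan normalization. The projection becomes
integration followed by its section `m ↦ ∑ ω_α ⊗ α^* m`. Integration is a morphism of complexes by
Stokes' theorem, with normalized values because a degeneracy pulls a form of degree `q + 1` back
from `Δ^q`, where there are none.
-/

namespace DirInv

noncomputable section

section AbstractHomotopy

theorem sum_sum_filter_eq {ι ι' M : Type*} [Fintype ι] [Fintype ι'] [DecidableEq ι]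
    [AddCommMonoid M] (F : ι → ι' → M) (α : ι' → ι) :
    ∑ j, ∑ i with α i = j, F j i = ∑ i, F (α i) i := by
  simp only [Finset.sum_filter]
  rw [Finset.sum_comm]
  simp

/-- Operators on a graded module `A` modelled on the polynomial differential forms on the simplex
with vertex set `ι`: the differential `d`, multiplication `t i` by the barycentric coordinate of the
vertex `i`, exterior multiplication `dt i` by its differential, the homotopy operator `h i` of the
radial contraction to `i`, and evaluation `p i` at `i`, viewed as a constant function. -/
structure SimplexOperators (K : Type*) [Field K] (ι : Type*) [Fintype ι] (A : ℕ → Type*)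
    [∀ n, AddCommGroup (A n)] [∀ n, Module K (A n)] where
  d : ∀ n, A n →ₗ[K] A (n + 1)
  t : ι → ∀ n, A n →ₗ[K] A n
  dt : ι → ∀ n, A n →ₗ[K] A (n + 1)
  h : ι → ∀ n, A (n + 1) →ₗ[K] A n
  p : ι → A 0 →ₗ[K] A 0
  d_t : ∀ i n x, d n (t i n x) = t i (n + 1) (d n x) + dt i n x
  d_dt : ∀ i n x, d (n + 1) (dt i n x) = -dt i (n + 1) (d n x)
  sum_t : ∀ n x, ∑ i, t i n x = x
  sum_dt : ∀ n x, ∑ i, dt i n x = 0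
  h_d_zero : ∀ i x, h i 0 (d 0 x) = x - p i x
  h_d : ∀ i n x, h i (n + 1) (d (n + 1) x) = x - d n (h i n x)

namespace SimplexOperators

variable {K : Type*} [Field K] {ι : Type*} [Fintype ι] {A : ℕ → Type*}
  [∀ n, AddCommGroup (A n)] [∀ n, Module K (A n)] (S : SimplexOperators K ι A)

/-- The sum of `dt i₁ ⋯ dt iₖ h iₖ ⋯ h i₁` over all `k`-tuples of vertices. -/
def wedgeCone : ∀ _k n : ℕ, A n →ₗ[K] A n
  | 0, _ => LinearMap.id
  | _ + 1, 0 => 0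
  | k + 1, n + 1 => ∑ i, S.dt i n ∘ₗ wedgeCone k n ∘ₗ S.h i n

/-- The sum of `w I h iₖ ⋯ h i₁` over all `k`-tuples `I` of vertices, where `w I` is multiplication
by `∑ⱼ (-1)ʲ⁻¹ t iⱼ dt i₁ ⋯ dt iₖ`, with the factor `dt iⱼ` omitted. -/
def whitneyCone : ∀ _k n : ℕ, A (n + 1) →ₗ[K] A n
  | 0, _ => 0
  | k + 1, 0 => ∑ i, S.t i 0 ∘ₗ S.wedgeCone k 0 ∘ₗ S.h i 0
  | k + 1, n + 1 => ∑ i, (S.t i (n + 1) ∘ₗ S.wedgeCone k (n + 1) ∘ₗ S.h i (n + 1) -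
      S.dt i n ∘ₗ whitneyCone k n ∘ₗ S.h i (n + 1))

/-- The sum of `dt i₀ ⋯ dt iₙ p iₙ h iₙ₋₁ ⋯ h i₀` over all `(n + 1)`-tuples of vertices. -/
def wedgeVertex : ∀ n : ℕ, A n →ₗ[K] A (n + 1)
  | 0 => ∑ i, S.dt i 0 ∘ₗ S.p i
  | n + 1 => ∑ i, S.dt i (n + 1) ∘ₗ wedgeVertex n ∘ₗ S.h i n

/-- The analogue of `whitneyCone` with the innermost homotopy replaced by an evaluation: the sum of
`w I p iₙ h iₙ₋₁ ⋯ h i₀` over all `(n + 1)`-tuples `I` of vertices. -/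
def whitneyVertex : ∀ n : ℕ, A n →ₗ[K] A n
  | 0 => ∑ i, S.t i 0 ∘ₗ S.p i
  | n + 1 => ∑ i, (S.t i (n + 1) ∘ₗ S.wedgeVertex n ∘ₗ S.h i n -
      S.dt i n ∘ₗ whitneyVertex n ∘ₗ S.h i n)

theorem wedgeCone_zero (n : ℕ) (x : A n) : S.wedgeCone 0 n x = x := by
  simp [wedgeCone]

theorem wedgeCone_succ (k n : ℕ) (x : A (n + 1)) :
    S.wedgeCone (k + 1) (n + 1) x = ∑ i, S.dt i n (S.wedgeCone k n (S.h i n x)) := by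
  simp [wedgeCone]

theorem whitneyCone_one (n : ℕ) (x : A (n + 1)) :
    S.whitneyCone 1 n x = ∑ i, S.t i n (S.h i n x) := by
  cases n <;> simp [whitneyCone, wedgeCone]

theorem whitneyCone_succ (k n : ℕ) (x : A (n + 2)) :
    S.whitneyCone (k + 1) (n + 1) x =
      ∑ i, (S.t i (n + 1) (S.wedgeCone k (n + 1) (S.h i (n + 1) x)) -
        S.dt i n (S.whitneyCone k n (S.h i (n + 1) x))) := by
  simp [whitneyCone]

theorem wedgeVertex_zero (x : A 0) : S.wedgeVertex 0 x = ∑ i, S.dt i 0 (S.p i x) := by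
  simp [wedgeVertex]

theorem wedgeVertex_succ (n : ℕ) (x : A (n + 1)) :
    S.wedgeVertex (n + 1) x = ∑ i, S.dt i (n + 1) (S.wedgeVertex n (S.h i n x)) := by
  simp [wedgeVertex]

theorem whitneyVertex_zero (x : A 0) : S.whitneyVertex 0 x = ∑ i, S.t i 0 (S.p i x) := by
  simp [whitneyVertex]

theorem whitneyVertex_succ (n : ℕ) (x : A (n + 1)) :
    S.whitneyVertex (n + 1) x = ∑ i, (S.t i (n + 1) (S.wedgeVertex n (S.h i n x)) -
      S.dt i n (S.whitneyVertex n (S.h i n x))) := by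
  simp [whitneyVertex]

theorem d_wedgeCone {k n : ℕ} (hk : k ≤ n) (x : A n) :
    S.d n (S.wedgeCone k n x) = S.wedgeCone k (n + 1) (S.d n x) := by
  induction k generalizing n with
  | zero => rfl
  | succ k ih =>
    obtain _ | n := n
    · omega
    simp only [wedgeCone_succ, map_sum, S.d_dt, ih (Nat.le_of_succ_le_succ hk), S.h_d, map_sub,
      Finset.sum_sub_distrib, S.sum_dt, Finset.sum_neg_distrib, zero_sub]

theorem wedgeCone_d (n : ℕ) (x : A n) :
    S.wedgeCone (n + 1) (n + 1) (S.d n x) = (-1 : K) ^ (n + 1) • S.wedgeVertex n x := by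
  induction n with
  | zero =>
    simp [wedgeCone_succ, wedgeVertex_zero, wedgeCone_zero, S.h_d_zero, S.sum_dt]
  | succ n ih =>
    rw [wedgeCone_succ, wedgeVertex_succ, pow_succ]
    simp only [S.h_d, map_sub, ih, Finset.sum_sub_distrib, S.sum_dt, zero_sub, map_smul,
      Finset.smul_sum, mul_neg, mul_one, neg_smul, Finset.sum_neg_distrib]

theorem d_whitneyCone {k n : ℕ} (hk : k ≤ n) (x : A (n + 1)) :
    S.d n (S.whitneyCone (k + 1) n x) + S.whitneyCone (k + 1) (n + 1) (S.d (n + 1) x) =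
      (k + 1 : K) • (S.wedgeCone (k + 1) (n + 1) x + S.wedgeCone k (n + 1) x) := by
  induction k generalizing n with
  | zero =>
    simp only [zero_add, whitneyCone_one, map_sum, S.d_t, S.h_d, map_sub, wedgeCone_succ,
      wedgeCone_zero, Finset.sum_sub_distrib, Finset.sum_add_distrib, S.sum_t, Nat.cast_zero,
      one_smul]
    abel
  | succ k ih =>
    obtain _ | n := n
    · omega
    have hkn : k ≤ n := Nat.le_of_succ_le_succ hk
    have ih_sum : ∑ i, S.dt i (n + 1) (S.d n (S.whitneyCone (k + 1) n (S.h i (n + 1) x)) +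
        S.whitneyCone (k + 1) (n + 1) (S.d (n + 1) (S.h i (n + 1) x))) =
        (k + 1 : K) • (S.wedgeCone (k + 2) (n + 2) x + S.wedgeCone (k + 1) (n + 2) x) := by
      simp only [ih hkn, map_smul, map_add, ← Finset.smul_sum, Finset.sum_add_distrib,
        ← wedgeCone_succ]
    rw [Nat.cast_succ, add_smul (k + 1 : K), one_smul, ← ih_sum, S.whitneyCone_succ (k + 1) (n + 1),
      S.whitneyCone_succ (k + 1) n, S.wedgeCone_succ (k + 1) (n + 1)]
    simp only [map_sum, map_sub, map_add, S.d_t, S.d_dt, S.h_d, S.d_wedgeCone hk,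
      Finset.sum_sub_distrib, Finset.sum_add_distrib, Finset.sum_neg_distrib, S.sum_t, S.sum_dt]
    abel

theorem whitneyCone_d (n : ℕ) (x : A n) :
    S.whitneyCone (n + 1) n (S.d n x) =
      (n + 1 : K) • S.wedgeCone n n x - (-1 : K) ^ n • S.whitneyVertex n x := by
  induction n with
  | zero =>
    simp [whitneyCone_one, whitneyVertex_zero, wedgeCone_zero, S.h_d_zero, S.sum_t]
  | succ n ih =>
    rw [whitneyCone_succ, whitneyVertex_succ, Nat.cast_succ, add_smul _ (1 : K), one_smul]
    simp only [S.h_d, map_sub, wedgeCone_d, ih, Finset.sum_sub_distrib, S.sum_t, S.sum_dt, map_smul,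
      map_neg, ← Finset.smul_sum, ← wedgeCone_succ, pow_succ, mul_neg, mul_one, neg_smul,
      Finset.sum_neg_distrib, smul_sub]
    abel

/-- Dupont's homotopy operator, with the tuples of vertices neither ordered nor required to be
injective; the symmetrization accounts for the coefficients `1 / (k + 1)`. -/
def homotopy (n : ℕ) : A (n + 1) →ₗ[K] A n :=
  ∑ k ∈ Finset.range (n + 1), ((-1 : K) ^ k / (k + 1)) • S.whitneyCone (k + 1) n

theorem homotopy_apply (n : ℕ) (x : A (n + 1)) :
    S.homotopy n x =
      ∑ k ∈ Finset.range (n + 1), ((-1 : K) ^ k / (k + 1)) • S.whitneyCone (k + 1) n x := by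
  simp [homotopy]

theorem homotopy_d_zero (x : A 0) : S.homotopy 0 (S.d 0 x) = x - S.whitneyVertex 0 x := by
  have h := S.whitneyCone_d 0 x
  simpa [homotopy_apply, wedgeCone_zero] using h

theorem d_homotopy [CharZero K] (n : ℕ) (x : A (n + 1)) :
    S.d n (S.homotopy n x) + S.homotopy (n + 1) (S.d (n + 1) x) =
      x - (n + 2 : K)⁻¹ • S.whitneyVertex (n + 1) x := by
  have telescope : ∀ m, ∑ k ∈ Finset.range m,
      (-1 : K) ^ k • (S.wedgeCone (k + 1) (n + 1) x + S.wedgeCone k (n + 1) x) =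
        x - (-1 : K) ^ m • S.wedgeCone m (n + 1) x := by
    intro m
    induction m with
    | zero => simp [wedgeCone_zero]
    | succ m ih =>
      rw [Finset.sum_range_succ, ih, pow_succ, smul_add]
      simp
  have hterm : ∀ k ∈ Finset.range (n + 1),
      ((-1 : K) ^ k / (k + 1)) • (S.d n (S.whitneyCone (k + 1) n x) +
        S.whitneyCone (k + 1) (n + 1) (S.d (n + 1) x)) =
      (-1 : K) ^ k • (S.wedgeCone (k + 1) (n + 1) x + S.wedgeCone k (n + 1) x) := by
    intro k hk
    have hk1 : (k + 1 : K) ≠ 0 := Nat.cast_add_one_ne_zero k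
    rw [S.d_whitneyCone (Nat.le_of_lt_succ (Finset.mem_range.1 hk)), smul_smul,
      div_mul_cancel₀ _ hk1]
  have hn : (n + 1 + 1 : K) ≠ 0 := by exact_mod_cast Nat.succ_ne_zero (n + 1)
  have hsign : (-1 : K) ^ (n + 1) * (-1 : K) ^ (n + 1) = 1 := by
    rw [← mul_pow]
    simp
  rw [homotopy_apply, homotopy_apply, Finset.sum_range_succ _ (n + 1), whitneyCone_d, map_sum,
    ← add_assoc, ← Finset.sum_add_distrib]
  simp only [map_smul, ← smul_add]
  rw [Finset.sum_congr rfl hterm, telescope, smul_sub, smul_smul, smul_smul, Nat.cast_succ,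
    div_mul_cancel₀ _ hn, div_mul_eq_mul_div, hsign, one_div, add_assoc (n : K), one_add_one_eq_two]
  abel

variable {ι' : Type*} [Fintype ι'] {A' : ℕ → Type*} [∀ n, AddCommGroup (A' n)]
  [∀ n, Module K (A' n)]

/-- `ψ` is compatible with the operators in the way the pullback of forms along the affine map of
simplices given by `α` on vertices is. -/
structure IsPullback [DecidableEq ι] (S : SimplexOperators K ι A) (S' : SimplexOperators K ι' A')
    (α : ι' → ι) (ψ : ∀ n, A n →ₗ[K] A' n) : Prop where
  map_t : ∀ j n x, ψ n (S.t j n x) = ∑ i with α i = j, S'.t i n (ψ n x)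
  map_dt : ∀ j n x, ψ (n + 1) (S.dt j n x) = ∑ i with α i = j, S'.dt i n (ψ n x)
  map_h : ∀ i n x, ψ n (S.h (α i) n x) = S'.h i n (ψ (n + 1) x)

namespace IsPullback

variable [DecidableEq ι] {S} {S' : SimplexOperators K ι' A'} {α : ι' → ι} {ψ : ∀ n, A n →ₗ[K] A' n}

theorem map_wedgeCone (hψ : S.IsPullback S' α ψ) (k n : ℕ) (x : A n) :
    ψ n (S.wedgeCone k n x) = S'.wedgeCone k n (ψ n x) := by
  induction k generalizing n with
  | zero => rfl
  | succ k ih =>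
    obtain _ | n := n
    · exact map_zero _
    simp only [wedgeCone_succ, map_sum, hψ.map_dt, ih, sum_sum_filter_eq, hψ.map_h]

theorem map_whitneyCone (hψ : S.IsPullback S' α ψ) (k n : ℕ) (x : A (n + 1)) :
    ψ n (S.whitneyCone k n x) = S'.whitneyCone k n (ψ (n + 1) x) := by
  induction k generalizing n with
  | zero => exact map_zero _
  | succ k ih =>
    obtain _ | n := n
    · simp only [whitneyCone, LinearMap.sum_apply, LinearMap.comp_apply, map_sum, hψ.map_t,
        hψ.map_wedgeCone, sum_sum_filter_eq, hψ.map_h]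
    · simp only [whitneyCone_succ, map_sum, map_sub, hψ.map_t, hψ.map_dt, hψ.map_wedgeCone, ih,
        Finset.sum_sub_distrib, sum_sum_filter_eq, hψ.map_h]

theorem map_homotopy (hψ : S.IsPullback S' α ψ) (n : ℕ) (x : A (n + 1)) :
    ψ n (S.homotopy n x) = S'.homotopy n (ψ (n + 1) x) := by
  simp only [homotopy_apply, map_sum, map_smul, hψ.map_whitneyCone]

end IsPullback

end SimplexOperators

end AbstractHomotopy

section UnitIntegral

open Polynomial

variable {K : Type*} [Field K] {A : Type*} [CommRing A] [Algebra K A]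

/-- The derivation of `A[X]` that applies the derivation `D` of `A` to the coefficients. -/
def coeffDerivation (D : Derivation K A A) : Derivation K A[X] A[X] :=
  (PolynomialModule.equivPolynomialSelf (R := A)).toLinearMap.compDer D.mapCoeffs

theorem coeffDerivation_monomial (D : Derivation K A A) (n : ℕ) (a : A) :
    coeffDerivation D (monomial n a) = monomial n (D a) := by
  simp [coeffDerivation]

theorem coeffDerivation_C (D : Derivation K A A) (a : A) : coeffDerivation D (C a) = C (D a) :=
  coeffDerivation_monomial D 0 a

theorem coeffDerivation_X (D : Derivation K A A) : coeffDerivation D X = 0 := by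
  rw [← monomial_one_one_eq_X, coeffDerivation_monomial, D.map_one_eq_zero, map_zero]

variable (K) in
/-- Integration `p ↦ ∫₀¹ p(s) ds` of polynomials over the unit interval. -/
def unitIntegral : A[X] →ₗ[A] A :=
  Polynomial.lsum fun n => algebraMap K A ((n + 1 : K)⁻¹) • LinearMap.id

theorem unitIntegral_monomial (n : ℕ) (a : A) :
    unitIntegral K (monomial n a) = algebraMap K A ((n + 1 : K)⁻¹) * a := by
  simp [unitIntegral, Polynomial.lsum, sum_monomial_index, Algebra.smul_def]

theorem unitIntegral_derivative [CharZero K] (p : A[X]) :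
    unitIntegral K (derivative p) = p.eval 1 - p.eval 0 := by
  induction p using Polynomial.induction_on' with
  | add p q hp hq => simp only [map_add, hp, hq, eval_add, add_sub_add_comm]
  | monomial n a =>
    rw [derivative_monomial, unitIntegral_monomial]
    cases n with
    | zero => simp
    | succ n =>
      have hn : algebraMap K A ((n + 1 : K)⁻¹) * ((n + 1 : ℕ) : A) = 1 := by
        rw [← map_natCast (algebraMap K A), ← map_mul, Nat.cast_succ,
          inv_mul_cancel₀ (Nat.cast_add_one_ne_zero n), map_one]
      rw [Nat.add_sub_cancel, mul_left_comm, hn]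
      simp

theorem unitIntegral_coeffDerivation (D : Derivation K A A) (p : A[X]) :
    unitIntegral K (coeffDerivation D p) = D (unitIntegral K p) := by
  induction p using Polynomial.induction_on' with
  | add p q hp hq => simp only [map_add, hp, hq]
  | monomial n a =>
    rw [coeffDerivation_monomial, unitIntegral_monomial, unitIntegral_monomial, ← Algebra.smul_def,
      ← Algebra.smul_def, D.map_smul]

theorem unitIntegral_map {B : Type*} [CommRing B] [Algebra K B] (φ : A →ₐ[K] B) (p : A[X]) :
    unitIntegral K (p.map (φ : A →+* B)) = φ (unitIntegral K p) := by
  induction p using Polynomial.induction_on' with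
  | add p q hp hq => simp only [Polynomial.map_add, map_add, hp, hq]
  | monomial n a =>
    rw [Polynomial.map_monomial, unitIntegral_monomial, unitIntegral_monomial, map_mul,
      AlgHom.commutes, RingHom.coe_coe]

theorem unitIntegral_X_pow_mul_one_sub_X_pow [CharZero K] (m n : ℕ) :
    unitIntegral K (X ^ m * (1 - X) ^ n : A[X]) =
      algebraMap K A (m.factorial * n.factorial / (m + n + 1).factorial) := by
  induction n generalizing m with
  | zero =>
    have hm : (m.factorial : K) ≠ 0 := Nat.cast_ne_zero.2 m.factorial_ne_zero
    rw [pow_zero, mul_one, ← monomial_one_right_eq_X_pow, unitIntegral_monomial, mul_one,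
      add_zero, Nat.factorial_succ, Nat.factorial_zero, Nat.cast_one, mul_one, Nat.cast_mul,
      Nat.cast_succ, div_mul_cancel_right₀ hm]
  | succ n ih =>
    have hsplit : (X ^ m * (1 - X) ^ (n + 1) : A[X]) =
        X ^ m * (1 - X) ^ n - X ^ (m + 1) * (1 - X) ^ n := by ring
    have hmn : ((m + n + 1).factorial : K) ≠ 0 := Nat.cast_ne_zero.2 (Nat.factorial_ne_zero _)
    have hmn' : (m + n + 1 + 1 : K) ≠ 0 := by exact_mod_cast Nat.succ_ne_zero (m + n + 1)
    rw [hsplit, map_sub, ih, ih, ← map_sub, Nat.add_right_comm m 1 n, ← Nat.add_assoc m n 1,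
      Nat.factorial_succ (m + n + 1), Nat.factorial_succ m, Nat.factorial_succ n]
    congr 1
    push_cast
    field_simp
    ring

end UnitIntegral

section SimplexRing

variable {K : Type u} [Field K] {k l : ℕ}

/-- The barycentric coordinate `t_j`. -/
def coord (j : Fin (l + 1)) : SimplexRing K l :=
  Ideal.Quotient.mk (simplexIdeal K l) (MvPolynomial.X j)

theorem sum_coord : ∑ j, (coord j : SimplexRing K l) = 1 := by
  have h := simplexRel_eq_zero (K := K) l
  rwa [map_sub, map_one, sub_eq_zero, map_sum] at h

theorem simplexRing_induction {motive : SimplexRing K l → Prop}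
    (const : ∀ c : K, motive (algebraMap K _ c))
    (add : ∀ f g, motive f → motive g → motive (f + g))
    (mul_coord : ∀ f j, motive f → motive (f * coord j)) (f : SimplexRing K l) : motive f := by
  obtain ⟨p, rfl⟩ := Ideal.Quotient.mk_surjective f
  induction p using MvPolynomial.induction_on with
  | C a => exact const a
  | add p q hp hq => rw [map_add]; exact add _ _ hp hq
  | mul_X p j hp => rw [map_mul]; exact mul_coord _ _ hp

section Hom

variable {B : Type*} [CommRing B] [Algebra K B]

theorem simplexRing_algHom_ext {φ ψ : SimplexRing K l →ₐ[K] B}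
    (h : ∀ j, φ (coord j) = ψ (coord j)) : φ = ψ :=
  Ideal.Quotient.algHom_ext _ (MvPolynomial.algHom_ext h)

theorem simplexRing_leibniz_ext (φ : SimplexRing K l →ₐ[K] B) {D D' : SimplexRing K l →ₗ[K] B}
    (hD : ∀ f g, D (f * g) = φ f * D g + φ g * D f)
    (hD' : ∀ f g, D' (f * g) = φ f * D' g + φ g * D' f)
    (h : ∀ j, D (coord j) = D' (coord j)) : D = D' := by
  have map_one {E : SimplexRing K l →ₗ[K] B} (hE : ∀ f g, E (f * g) = φ f * E g + φ g * E f) :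
      E 1 = 0 := by
    simpa using hE 1 1
  refine LinearMap.ext fun f => ?_
  induction f using simplexRing_induction with
  | const c => rw [Algebra.algebraMap_eq_smul_one, map_smul, map_smul, map_one hD, map_one hD']
  | add f g hf hg => rw [map_add, map_add, hf, hg]
  | mul_coord f j hf => rw [hD, hD', hf, h]

/-- The homomorphism out of the coordinate ring given by the images of the coordinates. -/
def simplexEval (x : Fin (l + 1) → B) (hx : ∑ j, x j = 1) : SimplexRing K l →ₐ[K] B :=
  Ideal.Quotient.liftₐ _ (MvPolynomial.aeval x) (by
    intro p hp
    obtain ⟨q, rfl⟩ := Ideal.mem_span_singleton'.1 hp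
    simp [hx])

theorem simplexEval_coord (x : Fin (l + 1) → B) (hx : ∑ j, x j = 1) (j : Fin (l + 1)) :
    simplexEval (K := K) x hx (coord j) = x j :=
  MvPolynomial.aeval_X x j

end Hom

theorem ringPullback_coord (α : Fin (k + 1) → Fin (l + 1)) (j : Fin (l + 1)) :
    ringPullback (K := K) α (coord j) = ∑ i with α i = j, coord i := by
  rw [coord, ringPullback_mk]
  simp [polyPullback, coord]

theorem dirDeriv_mul (v : simplexTangent K l) (f g : SimplexRing K l) :
    dirDeriv v (f * g) = f * dirDeriv v g + g * dirDeriv v f := by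
  obtain ⟨p, rfl⟩ := Ideal.Quotient.mk_surjective f
  obtain ⟨q, rfl⟩ := Ideal.Quotient.mk_surjective g
  rw [← map_mul, dirDeriv_mk, dirDeriv_mk, dirDeriv_mk, Derivation.leibniz]
  simp

theorem dirDeriv_coord (v : simplexTangent K l) (j : Fin (l + 1)) :
    dirDeriv v (coord j) = algebraMap K (SimplexRing K l) (v.1 j) := by
  rw [coord, dirDeriv_mk, polyDeriv, MvPolynomial.mkDerivation_X]
  rfl

/-- The directional derivative `dirDeriv v`, bundled as a derivation. -/
def dirDerivation (v : simplexTangent K l) : Derivation K (SimplexRing K l) (SimplexRing K l) :=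
  Derivation.mk' (dirDeriv v) (dirDeriv_mul v)

/-- The tangent vector from the vertex `i` to the vertex `j`. -/
def vertexVector (i j : Fin (l + 1)) : simplexTangent K l :=
  ⟨Pi.single j (1 : K) - Pi.single i (1 : K), by
    change ∑ a, ((Pi.single j (1 : K) : Fin (l + 1) → K) a -
      (Pi.single i (1 : K) : Fin (l + 1) → K) a) = 0
    simp⟩

theorem vertexVector_val (i j a : Fin (l + 1)) :
    (vertexVector (K := K) i j).1 a = (if a = j then 1 else 0) - if a = i then 1 else 0 := by
  simp [vertexVector, Pi.single_apply]

theorem sum_smul_vertexVector (v : simplexTangent K l) (i : Fin (l + 1)) :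
    ∑ j, v.1 j • vertexVector i j = v := by
  have hv : ∑ j, v.1 j = 0 := v.2
  apply Subtype.ext
  funext a
  simp [vertexVector, Finset.sum_apply, mul_sub, Pi.single_apply, hv]

theorem tangentMap_vertexVector (α : Fin (k + 1) → Fin (l + 1)) (i j : Fin (k + 1)) :
    tangentMap (K := K) α (vertexVector i j) = vertexVector (α i) (α j) := by
  apply Subtype.ext
  funext a
  change ∑ b with α b = a, (vertexVector (K := K) i j).1 b = _
  have hsum (c : Fin (k + 1)) : ∑ b with α b = a, (if b = c then (1 : K) else 0) =
      if a = α c then 1 else 0 := by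
    rw [Finset.sum_ite_eq']
    simp [eq_comm]
  simp only [vertexVector_val, Finset.sum_sub_distrib, hsum]

section Radial

open Polynomial

/-- The value of a function at the vertex `i`. -/
def vertexEval (i : Fin (l + 1)) : SimplexRing K l →ₐ[K] K :=
  simplexEval (Pi.single i 1) (by simp)

/-- The homomorphism `f ↦ f (e_i + X (x - e_i))`. -/
def dilation (i : Fin (l + 1)) : SimplexRing K l →ₐ[K] (SimplexRing K l)[X] :=
  simplexEval (fun j => C (coord j) * X + if j = i then 1 - X else 0) (by
    rw [Finset.sum_add_distrib, ← Finset.sum_mul, ← map_sum, sum_coord]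
    simp)

theorem dilation_coord (i j : Fin (l + 1)) :
    dilation (K := K) i (coord j) = C (coord j) * X + if j = i then 1 - X else 0 :=
  simplexEval_coord _ _ _

theorem coeffDerivation_dilation (i : Fin (l + 1)) (v : simplexTangent K l)
    (f : SimplexRing K l) :
    coeffDerivation (dirDerivation v) (dilation i f) = X * dilation i (dirDeriv v f) := by
  refine LinearMap.congr_fun (simplexRing_leibniz_ext (dilation i)
    (D := (coeffDerivation (dirDerivation v)).toLinearMap ∘ₗ (dilation i).toLinearMap)
    (D' := LinearMap.mulLeft K X ∘ₗ (dilation i).toLinearMap ∘ₗ dirDeriv v) ?_ ?_ ?_) f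
  · intro f g
    simp [Derivation.leibniz]
  · intro f g
    simp only [LinearMap.comp_apply, dirDeriv_mul, map_add, map_mul, AlgHom.toLinearMap_apply,
      LinearMap.mulLeft_apply, mul_left_comm]
  · intro j
    have hj : dirDerivation v (coord j) = algebraMap K _ (v.1 j) := dirDeriv_coord v j
    have h1 : coeffDerivation (dirDerivation v) (if j = i then 1 - X else 0) = 0 := by
      split_ifs <;> simp [coeffDerivation_X]
    simp [dilation_coord, coeffDerivation_X, coeffDerivation_C, hj, dirDeriv_coord, h1,
      Polynomial.algebraMap_apply]

theorem derivative_dilation (i : Fin (l + 1)) (f : SimplexRing K l) :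
    derivative (dilation i f) =
      ∑ j, C (coord j) * dilation i (dirDeriv (vertexVector i j) f) := by
  have h : (derivative.restrictScalars K) ∘ₗ (dilation (K := K) i).toLinearMap =
      ∑ j, LinearMap.mulLeft K (C (coord j : SimplexRing K l)) ∘ₗ (dilation i).toLinearMap ∘ₗ
        dirDeriv (vertexVector i j) := by
    refine simplexRing_leibniz_ext (B := (SimplexRing K l)[X]) (dilation i) ?_ ?_ ?_
    · intro f g
      simp only [LinearMap.comp_apply, LinearMap.restrictScalars_apply, AlgHom.toLinearMap_apply,
        map_mul, derivative_mul]
      ring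
    · intro f g
      simp only [LinearMap.sum_apply, LinearMap.comp_apply, dirDeriv_mul, map_add, map_mul,
        AlgHom.toLinearMap_apply, LinearMap.mulLeft_apply, Finset.mul_sum,
        ← Finset.sum_add_distrib]
      exact Finset.sum_congr rfl fun j _ => by ring
    · intro m
      have hC : ∑ j, C (coord j : SimplexRing K l) = 1 := by rw [← map_sum, sum_coord, map_one]
      simp only [LinearMap.sum_apply, LinearMap.comp_apply, LinearMap.mulLeft_apply,
        AlgHom.toLinearMap_apply, LinearMap.restrictScalars_apply, dirDeriv_coord,
        AlgHom.commutes, dilation_coord, vertexVector_val, map_sub,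
        Finset.sum_sub_distrib, ← Finset.sum_mul, hC]
      split_ifs <;> simp [apply_ite, sub_eq_add_neg]
  simpa using LinearMap.congr_fun h f

theorem eval_one_dilation (i : Fin (l + 1)) (f : SimplexRing K l) :
    (dilation i f).eval 1 = f := by
  have h : ((aeval (R := SimplexRing K l) (1 : SimplexRing K l)).restrictScalars K).comp
      (dilation i) = AlgHom.id K _ :=
    simplexRing_algHom_ext fun j => by simp [dilation_coord, apply_ite]
  simpa [aeval_def, eval₂_eq_eval_map] using DFunLike.congr_fun h f

theorem eval_zero_dilation (i : Fin (l + 1)) (f : SimplexRing K l) :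
    (dilation i f).eval 0 = algebraMap K _ (vertexEval i f) := by
  have h : ((aeval (R := SimplexRing K l) (0 : SimplexRing K l)).restrictScalars K).comp
      (dilation i) = (Algebra.ofId K _).comp (vertexEval i) :=
    simplexRing_algHom_ext fun j => by
      simp only [AlgHom.comp_apply, dilation_coord, vertexEval, simplexEval_coord, Pi.single_apply]
      split_ifs <;> simp
  simpa [aeval_def, eval₂_eq_eval_map, Algebra.ofId_apply] using DFunLike.congr_fun h f

theorem dilation_ringPullback (α : Fin (k + 1) → Fin (l + 1)) (i : Fin (k + 1))
    (f : SimplexRing K l) :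
    dilation i (ringPullback α f) =
      (dilation (α i) f).map (ringPullback (K := K) α : SimplexRing K l →+* SimplexRing K k) := by
  have h : (dilation i).comp (ringPullback (K := K) α) =
      (Polynomial.mapAlgHom (ringPullback (K := K) α)).comp (dilation (α i)) := by
    refine simplexRing_algHom_ext (B := (SimplexRing K k)[X]) fun j => ?_
    simp only [AlgHom.comp_apply, ringPullback_coord, map_sum, dilation_coord, map_add, map_mul,
      coe_mapAlgHom, map_C, map_X, RingHom.coe_coe, Finset.sum_add_distrib, ← Finset.sum_mul]
    simp only [Finset.sum_ite_eq', Finset.mem_filter_univ, @eq_comm _ (α i)]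
    split_ifs <;> simp
  exact DFunLike.congr_fun h f

/-- The operator `f ↦ ∫₀¹ sⁿ f(e_i + s(x - e_i)) ds`. -/
def radialIntegral (i : Fin (l + 1)) (n : ℕ) : SimplexRing K l →ₗ[K] SimplexRing K l :=
  (unitIntegral K).restrictScalars K ∘ₗ
    LinearMap.mulLeft K (X ^ n : (SimplexRing K l)[X]) ∘ₗ (dilation i).toLinearMap

theorem radialIntegral_apply (i : Fin (l + 1)) (n : ℕ) (f : SimplexRing K l) :
    radialIntegral i n f = unitIntegral K (X ^ n * dilation i f) := rfl

theorem dirDeriv_radialIntegral (v : simplexTangent K l) (i : Fin (l + 1)) (n : ℕ)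
    (f : SimplexRing K l) :
    dirDeriv v (radialIntegral i n f) = radialIntegral i (n + 1) (dirDeriv v f) := by
  change dirDerivation v _ = _
  rw [radialIntegral_apply, radialIntegral_apply, ← unitIntegral_coeffDerivation,
    Derivation.leibniz, Derivation.leibniz_pow, coeffDerivation_X, coeffDerivation_dilation]
  simp [pow_succ, mul_assoc]

theorem radialIntegral_euler [CharZero K] (i : Fin (l + 1)) (n : ℕ) (f : SimplexRing K l) :
    (n + 1 : SimplexRing K l) * radialIntegral i n f +
      ∑ j, coord j * radialIntegral i (n + 1) (dirDeriv (vertexVector i j) f) = f := by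
  have h := unitIntegral_derivative (K := K) (X ^ (n + 1) * dilation i f)
  rw [derivative_mul, derivative_X_pow, derivative_dilation, map_add, Finset.mul_sum, map_sum,
    eval_mul, eval_mul, eval_one_dilation, eval_pow, eval_pow, eval_X, eval_X, one_pow, one_mul,
    zero_pow n.succ_ne_zero, zero_mul, sub_zero, mul_assoc, ← smul_eq_C_mul, map_smul,
    Nat.add_sub_cancel, Nat.cast_succ] at h
  have hcoord (j : Fin (l + 1)) (p : (SimplexRing K l)[X]) :
      X ^ (n + 1) * (C (coord j) * p) = (coord j : SimplexRing K l) • (X ^ (n + 1) * p) := by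
    rw [smul_eq_C_mul]
    ring
  simp only [hcoord, map_smul] at h
  exact h

theorem radialIntegral_euler_zero [CharZero K] (i : Fin (l + 1)) (f : SimplexRing K l) :
    ∑ j, coord j * radialIntegral i 0 (dirDeriv (vertexVector i j) f) =
      f - algebraMap K _ (vertexEval i f) := by
  have h := unitIntegral_derivative (K := K) (dilation i f)
  rw [derivative_dilation, map_sum, eval_one_dilation, eval_zero_dilation] at h
  simpa only [← smul_eq_C_mul, map_smul, smul_eq_mul, radialIntegral_apply, pow_zero, one_mul]
    using h

theorem radialIntegral_ringPullback (α : Fin (k + 1) → Fin (l + 1)) (i : Fin (k + 1))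
    (n : ℕ) (f : SimplexRing K l) :
    radialIntegral i n (ringPullback α f) = ringPullback α (radialIntegral (α i) n f) := by
  rw [radialIntegral_apply, radialIntegral_apply, dilation_ringPullback, ← unitIntegral_map]
  simp

end Radial

end SimplexRing

section AlternatingMap

variable {R M N ι : Type*} [Semiring R] [AddCommMonoid M] [Module R M] [AddCommMonoid N]
  [Module R N]

theorem alternatingMap_sum_apply {κ : Type*} (s : Finset κ) (f : κ → M [⋀^ι]→ₗ[R] N) (v : ι → M) :
    (∑ a ∈ s, f a) v = ∑ a ∈ s, f a v :=
  map_sum ({ toFun := fun g => g v, map_zero' := rfl, map_add' := fun _ _ => rfl } :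
    (M [⋀^ι]→ₗ[R] N) →+ N) f s

end AlternatingMap

section FormOperators

variable {K : Type u} [Field K] {q k l : ℕ}

/-- The operator on forms that applies a linear endomorphism of the coordinate ring to the
values. -/
def postComp (q : ℕ) (g : SimplexRing K l →ₗ[K] SimplexRing K l) : Form K q l →ₗ[K] Form K q l where
  toFun ω := g.compAlternatingMap ω
  map_add' ω η := by ext; simp
  map_smul' c ω := by ext; simp

@[simp]
theorem postComp_apply (g : SimplexRing K l →ₗ[K] SimplexRing K l) (ω : Form K q l)
    (v : Fin q → simplexTangent K l) : postComp q g ω v = g (ω v) := rfl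

/-- The bilinear map sending `ω` and `v` to the form `(v₁, …, v_q) ↦ T v (ω (v₁, …, v_q))`. -/
def gradOp (q : ℕ) (T : simplexTangent K l →ₗ[K] SimplexRing K l →ₗ[K] SimplexRing K l) :
    Form K q l →ₗ[K] simplexTangent K l →ₗ[K] Form K q l :=
  LinearMap.mk₂ K (fun ω v => (T v).compAlternatingMap ω)
    (fun ω η v => by ext; simp) (fun c ω v => by ext; simp)
    (fun ω v w => by ext; simp) (fun c ω v => by ext; simp)

/-- The antisymmetrization of `gradOp q T`. It is the exterior derivative for `T v = ∂_v`, and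
exterior multiplication by `dt_j` for `T v = v_j`. -/
def wedgeOp (q : ℕ) (T : simplexTangent K l →ₗ[K] SimplexRing K l →ₗ[K] SimplexRing K l) :
    Form K q l →ₗ[K] Form K (q + 1) l :=
  AlternatingMap.alternatizeUncurryFinLM ∘ₗ gradOp q T

theorem wedgeOp_apply (T : simplexTangent K l →ₗ[K] SimplexRing K l →ₗ[K] SimplexRing K l)
    (ω : Form K q l) (v : Fin (q + 1) → simplexTangent K l) :
    wedgeOp q T ω v = ∑ i : Fin (q + 1), (-1 : ℤ) ^ (i : ℕ) • T (v i) (ω (i.removeNth v)) := by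
  simp [wedgeOp, AlternatingMap.alternatizeUncurryFin_apply, gradOp]

theorem wedgeOp_wedgeOp (T T' : simplexTangent K l →ₗ[K] SimplexRing K l →ₗ[K] SimplexRing K l)
    (ω : Form K q l) :
    wedgeOp (q + 1) T (wedgeOp q T' ω) = AlternatingMap.alternatizeUncurryFin
      (AlternatingMap.alternatizeUncurryFinLM ∘ₗ (gradOp q T ∘ₗ gradOp q T' ω).flip) := by
  have h : gradOp (q + 1) T (wedgeOp q T' ω) =
      AlternatingMap.alternatizeUncurryFinLM ∘ₗ (gradOp q T ∘ₗ gradOp q T' ω).flip := by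
    ext x v
    change T x (wedgeOp q T' ω v) = AlternatingMap.alternatizeUncurryFin _ v
    rw [wedgeOp_apply, map_sum, AlternatingMap.alternatizeUncurryFin_apply]
    exact Finset.sum_congr rfl fun i _ => map_zsmul _ _ _
  rw [← h]
  rfl

theorem wedgeOp_anticomm {T T' : simplexTangent K l →ₗ[K] SimplexRing K l →ₗ[K] SimplexRing K l}
    (h : ∀ v w f, T v (T' w f) + T' v (T w f) = T w (T' v f) + T' w (T v f)) (ω : Form K q l) :
    wedgeOp (q + 1) T (wedgeOp q T' ω) = -wedgeOp (q + 1) T' (wedgeOp q T ω) := by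
  rw [← add_eq_zero_iff_eq_neg, wedgeOp_wedgeOp, wedgeOp_wedgeOp,
    ← AlternatingMap.alternatizeUncurryFin_add, ← LinearMap.comp_add]
  refine AlternatingMap.alternatizeUncurryFin_alternatizeUncurryFinLM_comp_of_symmetric ?_
  intro x y
  ext v
  exact h x y (ω v)

theorem wedgeOp_postComp {T T' T'' : simplexTangent K l →ₗ[K] SimplexRing K l →ₗ[K] SimplexRing K l}
    {g : SimplexRing K l →ₗ[K] SimplexRing K l}
    (h : ∀ v f, T v (g f) = g (T' v f) + T'' v f) (ω : Form K q l) :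
    wedgeOp q T (postComp q g ω) = postComp (q + 1) g (wedgeOp q T' ω) + wedgeOp q T'' ω := by
  ext v
  simp only [wedgeOp_apply, postComp_apply, AlternatingMap.add_apply, map_sum, map_zsmul, h,
    smul_add, Finset.sum_add_distrib]

/-- The differential `v ↦ v_j` of `t_j`, acting on functions by multiplication. -/
def coordDiff (j : Fin (l + 1)) :
    simplexTangent K l →ₗ[K] SimplexRing K l →ₗ[K] SimplexRing K l :=
  LinearMap.toSpanSingleton K _ LinearMap.id ∘ₗ LinearMap.proj j ∘ₗ (simplexTangent K l).subtype

variable (K q) in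
/-- Multiplication by `t_j`. -/
def mulCoord (j : Fin (l + 1)) : Form K q l →ₗ[K] Form K q l :=
  postComp q (LinearMap.mulLeft K (coord j))

variable (K q) in
/-- Exterior multiplication by `dt_j`. -/
def wedgeCoord (j : Fin (l + 1)) : Form K q l →ₗ[K] Form K (q + 1) l := wedgeOp q (coordDiff j)

theorem wedgeCoord_apply (j : Fin (l + 1)) (ω : Form K q l)
    (v : Fin (q + 1) → simplexTangent K l) :
    wedgeCoord K q j ω v =
      ∑ i : Fin (q + 1), (-1 : ℤ) ^ (i : ℕ) • (v i).1 j • ω (i.removeNth v) :=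
  wedgeOp_apply _ _ _

theorem formD_mulCoord (j : Fin (l + 1)) (ω : Form K q l) :
    formD (K := K) q l (mulCoord K q j ω) =
      mulCoord K (q + 1) j (formD (K := K) q l ω) + wedgeCoord K q j ω := by
  refine wedgeOp_postComp (fun v f => ?_) ω
  change dirDeriv v (coord j * f) = coord j * dirDeriv v f + v.1 j • f
  rw [dirDeriv_mul, dirDeriv_coord, Algebra.smul_def (A := SimplexRing K l), mul_comm f]

theorem formD_wedgeCoord (j : Fin (l + 1)) (ω : Form K q l) :
    formD (K := K) (q + 1) l (wedgeCoord K q j ω) =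
      -wedgeCoord K (q + 1) j (formD (K := K) q l ω) := by
  refine wedgeOp_anticomm (fun v w f => ?_) ω
  change dirDeriv v (w.1 j • f) + v.1 j • dirDeriv w f =
    dirDeriv w (v.1 j • f) + w.1 j • dirDeriv v f
  rw [map_smul, map_smul, add_comm]

theorem sum_mulCoord (ω : Form K q l) : ∑ j, mulCoord K q j ω = ω := by
  ext v
  simp [mulCoord, alternatingMap_sum_apply, ← Finset.sum_mul, sum_coord]

theorem sum_wedgeCoord (ω : Form K q l) : ∑ j, wedgeCoord K q j ω = 0 := by
  ext v
  simp only [alternatingMap_sum_apply, wedgeCoord_apply]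
  rw [Finset.sum_comm]
  refine Finset.sum_eq_zero fun a _ => ?_
  have hv : ∑ j, (v a).1 j = 0 := (v a).2
  rw [← Finset.smul_sum, ← Finset.sum_smul, hv, zero_smul, smul_zero]

variable (K q) in
/-- The homotopy operator `ω ↦ ∫₀¹ s^q ι_{x - e_i} ω (e_i + s(x - e_i)) ds` of the contraction of
the simplex to the vertex `i`, where `x - e_i = ∑ j, t_j (e_j - e_i)`. -/
def coneForm (i : Fin (l + 1)) : Form K (q + 1) l →ₗ[K] Form K q l :=
  ∑ j, postComp q (LinearMap.mulLeft K (coord j) ∘ₗ radialIntegral i q) ∘ₗ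
    AlternatingMap.curryLeftLinearMap.flip (vertexVector i j)

theorem coneForm_apply (i : Fin (l + 1)) (ω : Form K (q + 1) l)
    (v : Fin q → simplexTangent K l) :
    coneForm K q i ω v =
      ∑ j, coord j * radialIntegral i q (ω (Matrix.vecCons (vertexVector i j) v)) := by
  simp [coneForm, alternatingMap_sum_apply]

theorem sum_smul_form_vecCons_vertexVector (i : Fin (l + 1)) (ω : Form K (q + 1) l)
    (x : simplexTangent K l) (v : Fin q → simplexTangent K l) :
    ∑ j, x.1 j • ω (Matrix.vecCons (vertexVector i j) v) = ω (Matrix.vecCons x v) := by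
  have h : ω.curryLeft (∑ j, x.1 j • vertexVector i j) v =
      ∑ j, x.1 j • ω.curryLeft (vertexVector i j) v := by
    simp [alternatingMap_sum_apply]
  rw [sum_smul_vertexVector] at h
  exact h.symm

theorem dirDeriv_coneForm (i : Fin (l + 1)) (ω : Form K (q + 1) l) (x : simplexTangent K l)
    (v : Fin q → simplexTangent K l) :
    dirDeriv x (coneForm K q i ω v) =
      radialIntegral i q (ω (Matrix.vecCons x v)) + ∑ j, coord j *
        radialIntegral i (q + 1) (dirDeriv x (ω (Matrix.vecCons (vertexVector i j) v))) := by
  rw [coneForm_apply, map_sum, ← sum_smul_form_vecCons_vertexVector i ω x, map_sum,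
    ← Finset.sum_add_distrib]
  refine Finset.sum_congr rfl fun j _ => ?_
  rw [dirDeriv_mul, dirDeriv_coord, dirDeriv_radialIntegral, map_smul,
    Algebra.smul_def (A := SimplexRing K l)]
  ring

theorem formD_vecCons (ω : Form K (q + 1) l) (x : simplexTangent K l)
    (v : Fin (q + 1) → simplexTangent K l) :
    formD (K := K) (q + 1) l ω (Matrix.vecCons x v) = dirDeriv x (ω v) -
      ∑ a : Fin (q + 1), (-1 : ℤ) ^ (a : ℕ) •
        dirDeriv (v a) (ω (Matrix.vecCons x (a.removeNth v))) := by
  have hremove (a : Fin (q + 1)) :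
      a.succ.removeNth (Matrix.vecCons x v) = Matrix.vecCons x (a.removeNth v) :=
    Fin.cons_comp_succ_succAbove ..
  rw [formD_apply, Fin.sum_univ_succ]
  simp only [hremove, Fin.val_zero, pow_zero, one_smul, Matrix.cons_val_zero,
    Matrix.cons_val_succ, Fin.val_succ, pow_succ, mul_neg, mul_one, neg_smul,
    Finset.sum_neg_distrib, sub_eq_add_neg]
  rfl

theorem sum_form_vecCons_removeNth (ω : Form K (q + 1) l)
    (v : Fin (q + 1) → simplexTangent K l) :
    ∑ a : Fin (q + 1), (-1 : ℤ) ^ (a : ℕ) • ω (Matrix.vecCons (v a) (a.removeNth v)) =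
      (q + 1) • ω v := by
  have h := DFunLike.congr_fun (AlternatingMap.alternatizeUncurryFin_curryLeft ω) v
  rwa [AlternatingMap.alternatizeUncurryFin_apply] at h

theorem formD_coneForm [CharZero K] (i : Fin (l + 1)) (ω : Form K (q + 1) l) :
    formD (K := K) q l (coneForm K q i ω) + coneForm K (q + 1) i (formD (K := K) (q + 1) l ω) =
      ω := by
  ext v
  have hradial : ∑ a : Fin (q + 1), (-1 : ℤ) ^ (a : ℕ) •
      radialIntegral i q (ω (Matrix.vecCons (v a) (a.removeNth v))) =
        (q + 1 : SimplexRing K l) * radialIntegral i q (ω v) := by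
    have h := congrArg (radialIntegral i q) (sum_form_vecCons_removeNth ω v)
    rwa [map_sum, map_nsmul, nsmul_eq_mul, Nat.cast_succ,
      Finset.sum_congr rfl fun a _ => map_zsmul (radialIntegral i q) _ _] at h
  have hmixed : ∑ a : Fin (q + 1), (-1 : ℤ) ^ (a : ℕ) • ∑ j, coord j * radialIntegral i (q + 1)
      (dirDeriv (v a) (ω (Matrix.vecCons (vertexVector i j) (a.removeNth v)))) =
      ∑ j, coord j * ∑ a : Fin (q + 1), (-1 : ℤ) ^ (a : ℕ) • radialIntegral i (q + 1)
      (dirDeriv (v a) (ω (Matrix.vecCons (vertexVector i j) (a.removeNth v)))) := by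
    simp only [Finset.smul_sum, Finset.mul_sum, mul_smul_comm]
    exact Finset.sum_comm
  rw [AlternatingMap.add_apply, formD_apply, coneForm_apply]
  simp only [dirDeriv_coneForm, formD_vecCons, smul_add, Finset.sum_add_distrib, hradial, hmixed,
    map_sub, map_sum, map_zsmul, mul_sub, Finset.sum_sub_distrib]
  conv_rhs => rw [← radialIntegral_euler i q (ω v)]
  ring

/-- The constant functions, as forms of degree `0`. -/
def constForm (l : ℕ) : K →ₗ[K] Form K 0 l where
  toFun c := AlternatingMap.constOfIsEmpty K _ (Fin 0) (algebraMap K (SimplexRing K l) c)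
  map_add' c c' := by ext; simp
  map_smul' c c' := by
    ext
    exact map_smul (Algebra.linearMap K (SimplexRing K l)) c c'

theorem constForm_apply (c : K) (v : Fin 0 → simplexTangent K l) :
    constForm (K := K) l c v = algebraMap K (SimplexRing K l) c := rfl

/-- The value at the vertex `i` of a form of degree `0`. -/
def evalForm (i : Fin (l + 1)) : Form K 0 l →ₗ[K] K where
  toFun ω := vertexEval i (ω Fin.elim0)
  map_add' ω η := by simp
  map_smul' c ω := by simp

theorem coneForm_formD_zero [CharZero K] (i : Fin (l + 1)) (ω : Form K 0 l) :
    coneForm K 0 i (formD (K := K) 0 l ω) = ω - constForm (K := K) l (evalForm (K := K) i ω) := by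
  ext v
  obtain rfl : v = Fin.elim0 := Subsingleton.elim _ _
  rw [AlternatingMap.sub_apply, constForm_apply, coneForm_apply]
  refine Eq.trans (Finset.sum_congr rfl fun j _ => ?_) (radialIntegral_euler_zero i (ω Fin.elim0))
  rw [formD_apply]
  simp

variable (K l) in
/-- The operators `d`, `t_j`, `dt_j ∧`, the cone contractions to the vertices and the evaluations
at the vertices on the forms on the simplex. -/
def formOperators [CharZero K] : SimplexOperators K (Fin (l + 1)) (fun n => Form K n l) where
  d n := formD n l
  t i n := mulCoord K n i
  dt i n := wedgeCoord K n i
  h i n := coneForm K n i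
  p i := constForm l ∘ₗ evalForm i
  d_t i _ ω := formD_mulCoord i ω
  d_dt i _ ω := formD_wedgeCoord i ω
  sum_t _ ω := sum_mulCoord ω
  sum_dt _ ω := sum_wedgeCoord ω
  h_d_zero i ω := coneForm_formD_zero i ω
  h_d i _ ω := eq_sub_of_add_eq' (formD_coneForm i ω)

end FormOperators

section FormPullback

variable {K : Type u} [Field K] {q k l : ℕ}

theorem formPullback_apply (α : Fin (k + 1) → Fin (l + 1)) (ω : Form K q l)
    (v : Fin q → simplexTangent K k) :
    formPullback (K := K) q α ω v = ringPullback α (ω (fun a => tangentMap α (v a))) := rfl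

theorem formPullback_mulCoord (α : Fin (k + 1) → Fin (l + 1)) (j : Fin (l + 1))
    (ω : Form K q l) :
    formPullback (K := K) q α (mulCoord K q j ω) =
      ∑ i with α i = j, mulCoord K q i (formPullback (K := K) q α ω) := by
  ext v
  simp only [alternatingMap_sum_apply, formPullback_apply, mulCoord, postComp_apply,
    LinearMap.mulLeft_apply, map_mul, ringPullback_coord, Finset.sum_mul]

theorem formPullback_wedgeCoord (α : Fin (k + 1) → Fin (l + 1)) (j : Fin (l + 1))
    (ω : Form K q l) :
    formPullback (K := K) (q + 1) α (wedgeCoord K q j ω) =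
      ∑ i with α i = j, wedgeCoord K q i (formPullback (K := K) q α ω) := by
  ext v
  simp only [alternatingMap_sum_apply, formPullback_apply, wedgeCoord_apply, map_sum, map_zsmul]
  rw [Finset.sum_comm]
  refine Finset.sum_congr rfl fun a _ => ?_
  rw [← Finset.smul_sum, ← Finset.sum_smul, map_smul]
  rfl

theorem formPullback_coneForm (α : Fin (k + 1) → Fin (l + 1)) (i : Fin (k + 1))
    (ω : Form K (q + 1) l) :
    formPullback (K := K) q α (coneForm K q (α i) ω) =
      coneForm K q i (formPullback (K := K) (q + 1) α ω) := by
  ext v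
  have hcons (m : Fin (k + 1)) :
      (fun a => tangentMap (K := K) α ((Matrix.vecCons (vertexVector i m) v :
        Fin (q + 1) → simplexTangent K k) a)) =
      Matrix.vecCons (vertexVector (α i) (α m)) fun a => tangentMap α (v a) := by
    rw [← tangentMap_vertexVector]
    funext a
    cases a using Fin.cases <;> rfl
  rw [formPullback_apply, coneForm_apply, coneForm_apply, map_sum]
  simp only [formPullback_apply, hcons, radialIntegral_ringPullback, map_mul, ringPullback_coord,
    Finset.sum_mul]
  exact sum_sum_filter_eq _ _

theorem vertexEval_ringPullback (α : Fin (k + 1) → Fin (l + 1)) (i : Fin (k + 1))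
    (f : SimplexRing K l) : vertexEval i (ringPullback α f) = vertexEval (α i) f := by
  have h : (vertexEval i).comp (ringPullback (K := K) α) = vertexEval (α i) := by
    refine simplexRing_algHom_ext fun j => ?_
    simp only [AlgHom.comp_apply, ringPullback_coord, map_sum, vertexEval, simplexEval_coord,
      Pi.single_apply, Finset.sum_ite_eq', Finset.mem_filter_univ, @eq_comm _ (α i)]
  exact DFunLike.congr_fun h f

theorem evalForm_formPullback (α : Fin (k + 1) → Fin (l + 1)) (i : Fin (k + 1)) (ω : Form K 0 l) :
    evalForm (K := K) i (formPullback (K := K) 0 α ω) = evalForm (K := K) (α i) ω := by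
  change vertexEval i (formPullback (K := K) 0 α ω Fin.elim0) = vertexEval (α i) (ω Fin.elim0)
  rw [formPullback_apply, vertexEval_ringPullback]
  congr 2
  exact Subsingleton.elim _ _

theorem isPullback_formPullback [CharZero K] (α : Fin (k + 1) → Fin (l + 1)) :
    (formOperators K l).IsPullback (formOperators K k) α (fun n => formPullback n α) where
  map_t j _ ω := formPullback_mulCoord α j ω
  map_dt j _ ω := formPullback_wedgeCoord α j ω
  map_h i _ ω := formPullback_coneForm α i ω

end FormPullback

section AlternatingMapShear

variable {R M N ι : Type*} [CommRing R] [AddCommGroup M] [Module R M] [AddCommGroup N]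
  [Module R N]

theorem alternatingMap_map_add_smul [Finite ι] (f : M [⋀^ι]→ₗ[R] N) {i : ι} {c : ι → R}
    (hc : c i = 0) (v : ι → M) : f (fun j => v j + c j • v i) = f v := by
  classical
  have := Fintype.ofFinite ι
  suffices h : ∀ s : Finset ι, f (fun j => v j + if j ∈ s then c j • v i else 0) = f v by
    simpa using h Finset.univ
  intro s
  induction s using Finset.induction_on with
  | empty => simp
  | insert j s hj ih =>
    by_cases hji : j = i
    · rw [← ih]
      congr 1 with a
      by_cases ha : a = i <;> simp [ha, hji, hc]
    set w : ι → M := fun a => v a + if a ∈ s then c a • v i else 0 with hw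
    have hupdate : (fun a => v a + if a ∈ insert j s then c a • v i else 0) =
        Function.update w j (w j + c j • w i) := by
      funext a
      by_cases ha : a = j
      · simp [ha, hw, hj, hc]
      · simp [ha, hw]
    rw [hupdate, f.map_update_add, f.map_update_smul, f.map_update_self _ hji,
      Function.update_eq_self, smul_zero, add_zero, ih]

theorem alternatingMap_map_sub_swap_zero {q : ℕ} (f : M [⋀^Fin q]→ₗ[R] N) (u : Fin (q + 1) → M)
    (b : Fin q) :
    f (fun a => u (Equiv.swap 0 b.succ a.succ) - u (Equiv.swap 0 b.succ 0)) =
      -f fun a => u a.succ - u 0 := by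
  set w : Fin q → M := fun a => u a.succ - u 0 with hw
  rw [← Function.update_eq_self b w, ← f.map_update_neg,
    ← alternatingMap_map_add_smul f (i := b) (c := Function.update 1 b 0) (by simp)
      (Function.update w b _)]
  congr 1 with a
  by_cases hab : a = b
  · simp [hab, hw]
  · have hswap : Equiv.swap 0 b.succ a.succ = a.succ :=
      Equiv.swap_apply_of_ne_of_ne a.succ_ne_zero (Fin.succ_injective q |>.ne hab)
    simp [hab, hw, hswap]

theorem alternatingMap_map_sub_swap {q : ℕ} (f : M [⋀^Fin q]→ₗ[R] N) (u : Fin (q + 1) → M)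
    {x y : Fin (q + 1)} (hxy : x ≠ y) :
    f (fun a => u (Equiv.swap x y a.succ) - u (Equiv.swap x y 0)) =
      -f fun a => u a.succ - u 0 := by
  cases x using Fin.cases with
  | zero =>
    obtain ⟨b, rfl⟩ := Fin.exists_succ_eq.2 hxy.symm
    exact alternatingMap_map_sub_swap_zero f u b
  | succ x =>
    cases y using Fin.cases with
    | zero =>
      rw [Equiv.swap_comm]
      exact alternatingMap_map_sub_swap_zero f u x
    | succ y =>
      rw [← f.map_swap _ (ne_of_apply_ne Fin.succ hxy)]
      congr 1 with a
      have hzero : Equiv.swap x.succ y.succ 0 = 0 :=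
        Equiv.swap_apply_of_ne_of_ne (Fin.succ_ne_zero _).symm (Fin.succ_ne_zero _).symm
      rw [hzero, (Fin.succ_injective q).swap_apply, Function.comp_apply]

theorem alternatingMap_map_sub_perm {q : ℕ} (f : M [⋀^Fin q]→ₗ[R] N) (u : Fin (q + 1) → M)
    (σ : Equiv.Perm (Fin (q + 1))) :
    f (fun a => u (σ a.succ) - u (σ 0)) = Equiv.Perm.sign σ • f fun a => u a.succ - u 0 := by
  induction σ using Equiv.Perm.swap_induction_on generalizing u with
  | one => simp
  | swap_mul σ x y hxy ih =>
    refine (ih (u ∘ Equiv.swap x y)).trans ?_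
    rw [Equiv.Perm.sign_mul, Equiv.Perm.sign_swap hxy]
    simp [alternatingMap_map_sub_swap f u hxy]

end AlternatingMapShear

section Integral

variable {K : Type u} [Field K] {q l : ℕ}

theorem mk_monomial (a : Fin (l + 1) →₀ ℕ) (c : K) :
    Ideal.Quotient.mk (simplexIdeal K l) (MvPolynomial.monomial a c) =
      c • ∏ i, coord i ^ a i := by
  rw [MvPolynomial.monomial_eq, Finsupp.prod_fintype _ _ fun i => pow_zero _, map_mul, map_prod,
    Algebra.smul_def (A := SimplexRing K l)]
  simp only [map_pow]
  rfl

theorem simplexRing_linearMap_ext {W : Type*} [AddCommGroup W] [Module K W]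
    {φ ψ : SimplexRing K l →ₗ[K] W}
    (h : ∀ a : Fin (l + 1) → ℕ, φ (∏ i, coord i ^ a i) = ψ (∏ i, coord i ^ a i)) : φ = ψ := by
  refine LinearMap.ext fun f => ?_
  obtain ⟨p, rfl⟩ := Ideal.Quotient.mk_surjective f
  induction p using MvPolynomial.induction_on' with
  | add p q hp hq => rw [map_add, map_add, map_add, hp, hq]
  | monomial a c => rw [mk_monomial, map_smul, map_smul, h]

open Polynomial in
theorem prod_C_mul_X_pow {A ι : Type*} [CommRing A] [Fintype ι] (c : ι → A) (a : ι → ℕ) :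
    ∏ i, (C (c i) * X) ^ a i = C (∏ i, c i ^ a i) * X ^ (∑ i, a i) := by
  simp only [mul_pow, Finset.prod_mul_distrib, Finset.prod_pow_eq_pow_sum, map_prod, map_pow]

open Polynomial in
theorem dilation_zero_map_ringPullback_succ (a : Fin (l + 2) → ℕ) :
    (dilation 0 (∏ i, coord i ^ a i)).map
        ((ringPullback Fin.succ : SimplexRing K (l + 1) →ₐ[K] SimplexRing K l) :
          SimplexRing K (l + 1) →+* SimplexRing K l) =
      C (∏ i : Fin (l + 1), coord i ^ a i.succ) *
        (X ^ (∑ i : Fin (l + 1), a i.succ) * (1 - X) ^ a 0) := by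
  let φ : SimplexRing K (l + 1) →ₐ[K] (SimplexRing K l)[X] :=
    (Polynomial.mapAlgHom (ringPullback Fin.succ)).comp (dilation 0)
  have hzero : φ (coord 0) = 1 - X := by
    simp [φ, dilation_coord, ringPullback_coord]
  have hsucc (j : Fin (l + 1)) : φ (coord j.succ) = C (coord j) * X := by
    simp [φ, dilation_coord, ringPullback_coord, Finset.filter_eq']
  have hprod : φ (∏ i : Fin (l + 1), coord i.succ ^ a i.succ) =
      C (∏ i : Fin (l + 1), coord i ^ a i.succ) * X ^ (∑ i : Fin (l + 1), a i.succ) :=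
    calc φ (∏ i : Fin (l + 1), coord i.succ ^ a i.succ)
      _ = ∏ i : Fin (l + 1), φ (coord i.succ ^ a i.succ) := map_prod φ _ _
      _ = ∏ i : Fin (l + 1), (C (coord i) * X) ^ a i.succ := by simp only [map_pow, hsucc]
      _ = _ := prod_C_mul_X_pow _ _
  change φ _ = _
  rw [Fin.prod_univ_succ, map_mul, map_pow, hzero, hprod]
  ring

section RingIntegral

variable [CharZero K]

theorem ringIntegral_prod_coord_pow (a : Fin (l + 1) → ℕ) :
    ringIntegral l (∏ i, coord (K := K) i ^ a i) =
      (∏ i, ((a i).factorial : K)) / ((l + ∑ i, a i).factorial : K) := by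
  have h := mk_monomial (K := K) (Finsupp.equivFunOnFinite.symm a) 1
  rw [one_smul] at h
  change ringIntegral l (∏ i, coord (K := K) i ^ Finsupp.equivFunOnFinite.symm a i) = _
  rw [← h, ringIntegral, simplexLift_mk, polyIntegral_monomial, one_mul]
  rfl

theorem ringIntegral_one : ringIntegral l (1 : SimplexRing K l) = (l.factorial : K)⁻¹ := by
  simpa using ringIntegral_prod_coord_pow (K := K) (l := l) 0

theorem ringIntegral_ringPullback_perm (σ : Equiv.Perm (Fin (l + 1))) (f : SimplexRing K l) :
    ringIntegral l (ringPullback σ f) = ringIntegral l f := by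
  refine LinearMap.congr_fun (f := ringIntegral l ∘ₗ (ringPullback (K := K) σ).toLinearMap)
    (simplexRing_linearMap_ext fun a => ?_) f
  have h : ringPullback (K := K) σ (∏ i, coord i ^ a i) = ∏ i, coord i ^ a (σ i) := by
    simp only [map_prod, map_pow, ringPullback_coord]
    rw [← Equiv.prod_comp σ]
    exact Finset.prod_congr rfl fun i _ => by
      simp [Finset.filter_eq']
  rw [LinearMap.comp_apply, AlgHom.toLinearMap_apply, h, ringIntegral_prod_coord_pow,
    ringIntegral_prod_coord_pow, Equiv.sum_comp σ,
    Equiv.prod_comp σ fun i => ((a i).factorial : K)]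

theorem ringIntegral_zero (f : SimplexRing K 0) : ringIntegral 0 f = vertexEval 0 f := by
  refine LinearMap.congr_fun (g := (vertexEval 0).toLinearMap)
    (simplexRing_linearMap_ext fun a => ?_) f
  rw [ringIntegral_prod_coord_pow, AlgHom.toLinearMap_apply]
  simp [vertexEval, simplexEval_coord, Nat.factorial_ne_zero]

/-- Fubini in the coordinates `x = e_0 + s(y - e_0)`, where `y` is on the face opposite to the
vertex `0`: the Jacobian determinant is `s ^ l`. -/
theorem ringIntegral_succ (f : SimplexRing K (l + 1)) :
    ringIntegral (l + 1) f =
      ringIntegral l (ringPullback Fin.succ (radialIntegral 0 l f)) := by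
  refine LinearMap.congr_fun (g := ringIntegral l ∘ₗ (ringPullback (K := K) Fin.succ).toLinearMap ∘ₗ
    radialIntegral 0 l) (simplexRing_linearMap_ext fun a => ?_) f
  have hradial : ringPullback (K := K) Fin.succ (radialIntegral 0 l (∏ i, coord i ^ a i)) =
      ((l + ∑ i : Fin (l + 1), a i.succ).factorial * (a 0).factorial /
        (l + ∑ i : Fin (l + 1), a i.succ + a 0 + 1).factorial : K) •
          ∏ i : Fin (l + 1), coord i ^ a i.succ := by
    rw [radialIntegral_apply, ← unitIntegral_map, Polynomial.map_mul,
      dilation_zero_map_ringPullback_succ, mul_left_comm, Polynomial.map_pow, Polynomial.map_X,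
      ← mul_assoc (Polynomial.X ^ l), ← pow_add, ← Polynomial.smul_eq_C_mul, map_smul,
      unitIntegral_X_pow_mul_one_sub_X_pow, smul_eq_mul, mul_comm,
      ← Algebra.smul_def (A := SimplexRing K l)]
  have hfactorial : ((l + ∑ i : Fin (l + 1), a i.succ).factorial : K) ≠ 0 :=
    Nat.cast_ne_zero.2 (Nat.factorial_ne_zero _)
  have hdegree : l + 1 + ∑ i, a i = l + ∑ i : Fin (l + 1), a i.succ + a 0 + 1 := by
    rw [Fin.sum_univ_succ]
    ring
  rw [LinearMap.comp_apply, LinearMap.comp_apply, AlgHom.toLinearMap_apply, hradial, map_smul,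
    ringIntegral_prod_coord_pow, ringIntegral_prod_coord_pow, hdegree, Fin.prod_univ_succ,
    smul_eq_mul]
  field_simp

end RingIntegral

section FormIntegral

theorem vertexVector_self (i : Fin (l + 1)) : vertexVector (K := K) i i = 0 :=
  Subtype.ext (sub_self _)

theorem vertexVector_add_vertexVector (a b c : Fin (l + 1)) :
    vertexVector (K := K) a b + vertexVector b c = vertexVector a c :=
  Subtype.ext (sub_add_sub_cancel' _ _ _)

theorem form_vecCons_vertexVector (ω : Form K (q + 1) (q + 1)) (j : Fin (q + 1)) :
    ω (Matrix.vecCons (vertexVector 0 j.succ) fun a => vertexVector 1 a.succ.succ) =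
      ω fun a => vertexVector 0 a.succ := by
  have hfirst : ω (Matrix.vecCons (vertexVector 0 j.succ) fun a => vertexVector 1 a.succ.succ) =
      ω (Matrix.vecCons (vertexVector 0 1) fun a => vertexVector 1 a.succ.succ) := by
    cases j using Fin.cases with
    | zero => rfl
    | succ b =>
      rw [← alternatingMap_map_add_smul ω (i := b.succ) (c := Pi.single 0 (-1)) (by simp)
        (Matrix.vecCons _ _)]
      congr 1 with a
      cases a using Fin.cases with
      | zero => simp [← vertexVector_add_vertexVector 0 1 b.succ.succ]
      | succ a => simp
  rw [hfirst, ← alternatingMap_map_add_smul ω (i := 0) (c := Fin.cons 0 1) rfl (Matrix.vecCons _ _)]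
  congr 1 with a
  cases a using Fin.cases with
  | zero => simp
  | succ a => simp [← vertexVector_add_vertexVector 0 1 a.succ.succ, add_comm]

variable [CharZero K]

theorem formIntegral_apply (ω : Form K q q) :
    formIntegral (K := K) q ω = ringIntegral q (ω fun a => vertexVector 0 a.succ) := rfl

theorem formIntegral_succ (ω : Form K (q + 1) (q + 1)) :
    formIntegral (K := K) (q + 1) ω =
      formIntegral (K := K) q (formPullback (K := K) q Fin.succ (coneForm K q 0 ω)) := by
  have hsucc (j : Fin (q + 1)) : ringPullback (K := K) Fin.succ (coord j.succ) = coord j := by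
    simp [ringPullback_coord, Finset.filter_eq']
  have hzero (v : Fin q → simplexTangent K (q + 1)) :
      ω (Matrix.vecCons (vertexVector 0 0) v) = 0 :=
    ω.map_coord_zero 0 (vertexVector_self 0)
  rw [formIntegral_apply, formIntegral_apply, formPullback_apply, coneForm_apply,
    Fin.sum_univ_succ, ringIntegral_succ]
  simp only [tangentMap_vertexVector, Fin.succ_zero_eq_one, hzero, map_zero, mul_zero, zero_add,
    form_vecCons_vertexVector, map_sum, map_mul, hsucc]
  rw [← map_sum, ← Finset.sum_mul, sum_coord, one_mul]

end FormIntegral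

end Integral

section FaceIntegral

variable {K : Type u} [Field K] {q k l m : ℕ}

theorem ringPullback_ringPullback (α : Fin (k + 1) → Fin (l + 1)) (β : Fin (m + 1) → Fin (k + 1))
    (f : SimplexRing K l) : ringPullback β (ringPullback α f) = ringPullback (α ∘ β) f := by
  have h : (ringPullback (K := K) β).comp (ringPullback α) = ringPullback (α ∘ β) := by
    refine simplexRing_algHom_ext fun j => ?_
    simp only [AlgHom.comp_apply, ringPullback_coord, map_sum, Function.comp_apply]
    rw [Finset.sum_filter, Finset.sum_filter,
      ← sum_sum_filter_eq (fun i b => if α i = j then coord b else 0) β]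
    exact Finset.sum_congr rfl fun i _ => by split_ifs <;> simp
  exact DFunLike.congr_fun h f

theorem tangentMap_tangentMap (α : Fin (k + 1) → Fin (l + 1)) (β : Fin (m + 1) → Fin (k + 1))
    (v : simplexTangent K m) : tangentMap α (tangentMap β v) = tangentMap (α ∘ β) v := by
  rw [← sum_smul_vertexVector v 0]
  simp only [map_sum, map_smul, tangentMap_vertexVector, Function.comp_apply]

theorem formPullback_formPullback (α : Fin (k + 1) → Fin (l + 1))
    (β : Fin (m + 1) → Fin (k + 1)) (ω : Form K q l) :
    formPullback (K := K) q β (formPullback (K := K) q α ω) =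
      formPullback (K := K) q (α ∘ β) ω := by
  ext v
  simp only [formPullback_apply, ringPullback_ringPullback, tangentMap_tangentMap]

theorem formPullback_id (ω : Form K q l) : formPullback (K := K) q id ω = ω := by
  have hring : ringPullback (K := K) id = AlgHom.id K (SimplexRing K l) :=
    simplexRing_algHom_ext fun j => by simp [ringPullback_coord, Finset.filter_eq']
  have htangent (v : simplexTangent K l) : tangentMap id v = v := by
    rw [← sum_smul_vertexVector v 0]
    simp only [map_sum, map_smul, tangentMap_vertexVector, id]
  ext v
  simp only [formPullback_apply, hring, htangent, AlgHom.id_apply]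

theorem evalForm_constForm (i : Fin (l + 1)) (c : K) :
    evalForm (K := K) i (constForm (K := K) l c) = c :=
  (vertexEval i).commutes c

variable [CharZero K]

/-- The integral over the face, possibly degenerate, with vertices `I 0, …, I q`. -/
def faceIntegral (I : Fin (q + 1) → Fin (l + 1)) : Form K q l →ₗ[K] K :=
  formIntegral q ∘ₗ formPullback q I

theorem faceIntegral_id (ω : Form K q q) :
    faceIntegral (K := K) id ω = formIntegral (K := K) q ω :=
  congrArg (formIntegral (K := K) q) (formPullback_id ω)

theorem faceIntegral_formPullback (I : Fin (q + 1) → Fin (k + 1)) (α : Fin (k + 1) → Fin (l + 1))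
    (ω : Form K q l) :
    faceIntegral (K := K) I (formPullback (K := K) q α ω) = faceIntegral (K := K) (α ∘ I) ω :=
  congrArg (formIntegral (K := K) q) (formPullback_formPullback α I ω)

theorem faceIntegral_zero (I : Fin 1 → Fin (l + 1)) (ω : Form K 0 l) :
    faceIntegral (K := K) I ω = evalForm (K := K) (I 0) ω := by
  rw [← evalForm_formPullback]
  exact (ringIntegral_zero _).trans (congrArg (fun v => vertexEval 0
    (formPullback (K := K) 0 I ω v)) (Subsingleton.elim _ _))

theorem faceIntegral_succ (I : Fin (q + 2) → Fin (l + 1)) (ω : Form K (q + 1) l) :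
    faceIntegral (K := K) I ω =
      faceIntegral (K := K) (I ∘ Fin.succ) (coneForm K q (I 0) ω) := by
  rw [← faceIntegral_formPullback, formPullback_coneForm]
  exact formIntegral_succ _

/-- Stokes' theorem, by induction on the dimension: the face is a cone with apex `I 0`. -/
theorem faceIntegral_formD (I : Fin (q + 2) → Fin (l + 1)) (ω : Form K q l) :
    faceIntegral (K := K) I (formD (K := K) q l ω) =
      ∑ i : Fin (q + 2), (-1) ^ (i : ℕ) * faceIntegral (K := K) (I ∘ i.succAbove) ω := by
  induction q with
  | zero =>
    rw [faceIntegral_succ, coneForm_formD_zero, map_sub]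
    simp [faceIntegral_zero, evalForm_constForm, Fin.sum_univ_two, sub_eq_add_neg]
  | succ q ih =>
    rw [faceIntegral_succ, eq_sub_of_add_eq' (formD_coneForm (I 0) ω), map_sub, ih,
      Fin.sum_univ_succ (n := q + 2), sub_eq_add_neg, ← Finset.sum_neg_distrib]
    congr 1
    · rw [Fin.val_zero, pow_zero, one_mul]
      rfl
    · refine Finset.sum_congr rfl fun i _ => ?_
      have hsucc : (I ∘ i.succ.succAbove) ∘ Fin.succ = (I ∘ Fin.succ) ∘ i.succAbove := by
        funext a
        simp
      rw [faceIntegral_succ (I ∘ i.succ.succAbove), hsucc, Function.comp_apply,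
        Fin.succ_succAbove_zero, Fin.val_succ, pow_succ]
      ring

theorem formIntegral_formPullback_perm (σ : Equiv.Perm (Fin (q + 1))) (ω : Form K q q) :
    formIntegral (K := K) q (formPullback (K := K) q σ ω) =
      Equiv.Perm.sign σ • formIntegral (K := K) q ω := by
  have hedge (a b : Fin (q + 1)) :
      vertexVector (K := K) a b = vertexVector 0 b - vertexVector 0 a := by
    rw [← vertexVector_add_vertexVector 0 a b, add_sub_cancel_left]
  have hsign (f : SimplexRing K q) :
      ringIntegral q (Equiv.Perm.sign σ • f) = Equiv.Perm.sign σ • ringIntegral q f :=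
    map_zsmul (ringIntegral q) _ f
  have h := alternatingMap_map_sub_perm ω (vertexVector 0) σ
  simp only [← hedge] at h
  rw [formIntegral_apply, formIntegral_apply, formPullback_apply, ringIntegral_ringPullback_perm,
    ← hsign, ← h]
  simp only [tangentMap_vertexVector]

theorem faceIntegral_comp_perm (I : Fin (q + 1) → Fin (l + 1)) (σ : Equiv.Perm (Fin (q + 1)))
    (ω : Form K q l) :
    faceIntegral (K := K) (I ∘ σ) ω = Equiv.Perm.sign σ • faceIntegral (K := K) I ω := by
  rw [← faceIntegral_formPullback]
  exact formIntegral_formPullback_perm σ _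

theorem faceIntegral_of_not_injective {I : Fin (q + 1) → Fin (l + 1)}
    (hI : ¬Function.Injective I) (ω : Form K q l) : faceIntegral (K := K) I ω = 0 := by
  obtain ⟨a, b, hab, hne⟩ : ∃ a b, I a = I b ∧ a ≠ b := by
    simpa [Function.Injective] using hI
  have hswap : I ∘ Equiv.swap a b = I := by
    rw [Equiv.comp_swap_eq_update, hab, Function.update_eq_self, ← hab, Function.update_eq_self]
  have h := faceIntegral_comp_perm I (Equiv.swap a b) ω
  rw [hswap, Equiv.Perm.sign_swap hne, Units.neg_smul, one_smul] at h
  exact self_eq_neg.1 h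

end FaceIntegral

section WhitneyForms

open Simplicial

variable {K : Type u} [Field K] {q k l n : ℕ}

/-- The form `dt_{I 0} ∧ ⋯ ∧ dt_{I (n - 1)}`. -/
def wedgeForm (I : Fin n → Fin (l + 1)) : Form K n l :=
  (Algebra.linearMap K (SimplexRing K l)).compAlternatingMap
    (Matrix.detRowAlternating.compLinearMap
      (LinearMap.funLeft K K I ∘ₗ (simplexTangent K l).subtype))

theorem wedgeForm_apply (I : Fin n → Fin (l + 1)) (v : Fin n → simplexTangent K l) :
    wedgeForm I v =
      (Matrix.of fun b a => algebraMap K (SimplexRing K l) ((v a).1 (I b))).det :=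
  ((algebraMap K (SimplexRing K l)).map_det (Matrix.of fun a b => (v a).1 (I b))).trans
    (Matrix.det_transpose _).symm

/-- The form `∑ j, (-1)^j t_{I j} dt_{I 0} ∧ ⋯ ∧ dt_{I (j-1)} ∧ dt_{I (j+1)} ∧ ⋯ ∧ dt_{I q}`,
which is Whitney's form of the face `I` up to the factor `q!`. -/
def elementaryForm (I : Fin (q + 1) → Fin (l + 1)) : Form K q l :=
  ∑ j : Fin (q + 1), (-1 : ℤ) ^ (j : ℕ) • mulCoord K q (I j) (wedgeForm (I ∘ j.succAbove))

/-- The values at the vectors `v` of the barycentric coordinate `t_i` and of its differential, as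
a row of the determinant computing `elementaryForm`. -/
def whitneyRow (v : Fin q → simplexTangent K l) (i : Fin (l + 1)) : Fin (q + 1) → SimplexRing K l :=
  Fin.cons (coord i) fun a => algebraMap K (SimplexRing K l) ((v a).1 i)

theorem elementaryForm_apply (I : Fin (q + 1) → Fin (l + 1)) (v : Fin q → simplexTangent K l) :
    elementaryForm I v = Matrix.detRowAlternating fun b => whitneyRow v (I b) := by
  refine Eq.trans ?_ (Matrix.det_succ_column_zero _).symm
  rw [elementaryForm, alternatingMap_sum_apply]
  refine Finset.sum_congr rfl fun j _ => ?_
  rw [AlternatingMap.smul_apply, mulCoord, postComp_apply, wedgeForm_apply, zsmul_eq_mul,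
    LinearMap.mulLeft_apply, mul_assoc]
  push_cast
  rfl

theorem wedgeForm_cons (i : Fin (l + 1)) (J : Fin n → Fin (l + 1)) :
    wedgeForm (K := K) (Fin.cons i J : Fin (n + 1) → Fin (l + 1)) =
      wedgeCoord K n i (wedgeForm J) := by
  ext v
  rw [wedgeForm_apply, Matrix.det_succ_row_zero, wedgeCoord_apply]
  refine Finset.sum_congr rfl fun a _ => ?_
  rw [wedgeForm_apply, zsmul_eq_mul, Algebra.smul_def (A := SimplexRing K l), mul_assoc]
  push_cast
  rfl

theorem elementaryForm_cons (i : Fin (l + 1)) (J : Fin (q + 1) → Fin (l + 1)) :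
    elementaryForm (K := K) (Fin.cons i J : Fin (q + 2) → Fin (l + 1)) =
      mulCoord K (q + 1) i (wedgeForm J) - wedgeCoord K q i (elementaryForm J) := by
  ext v
  rw [elementaryForm_apply]
  refine (Matrix.det_succ_row_zero _).trans ?_
  rw [Fin.sum_univ_succ, AlternatingMap.sub_apply, wedgeCoord_apply, sub_eq_add_neg,
    ← Finset.sum_neg_distrib]
  congr 1
  · rw [mulCoord, postComp_apply, wedgeForm_apply, LinearMap.mulLeft_apply, Fin.val_zero, pow_zero,
      one_mul]
    rfl
  · refine Finset.sum_congr rfl fun a _ => ?_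
    have hminor : Matrix.submatrix
        (fun b => whitneyRow (K := K) v ((Fin.cons i J : Fin (q + 2) → Fin (l + 1)) b)) Fin.succ
        a.succ.succAbove = fun b => whitneyRow (a.removeNth v) (J b) := by
      ext b c
      cases c using Fin.cases with
      | zero => rfl
      | succ c =>
        change whitneyRow v (J b) (a.succ.succAbove c.succ) = _
        rw [Fin.succ_succAbove_succ]
        rfl
    rw [hminor, elementaryForm_apply, zsmul_eq_mul, Algebra.smul_def (A := SimplexRing K l),
      Fin.val_succ, pow_succ]
    change (-1) ^ (a : ℕ) * -1 * algebraMap K _ ((v a).1 i) * Matrix.detRowAlternating _ = _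
    push_cast
    ring

theorem elementaryForm_comp_perm (I : Fin (q + 1) → Fin (l + 1)) (σ : Equiv.Perm (Fin (q + 1))) :
    elementaryForm (K := K) (I ∘ σ) = Equiv.Perm.sign σ • elementaryForm I := by
  ext v
  rw [AlternatingMap.smul_apply, elementaryForm_apply, elementaryForm_apply]
  refine (AlternatingMap.map_perm (Matrix.detRowAlternating (R := SimplexRing K l))
    (fun b => whitneyRow v (I b)) σ).trans ?_
  simp only [Units.smul_def, zsmul_eq_mul]

theorem formPullback_elementaryForm (α : Fin (k + 1) → Fin (l + 1))
    (I : Fin (q + 1) → Fin (l + 1)) :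
    formPullback (K := K) q α (elementaryForm I) =
      ∑ J : Fin (q + 1) → Fin (k + 1) with α ∘ J = I, elementaryForm J := by
  ext v
  have hrow (i : Fin (l + 1)) :
      ringPullback α ∘ whitneyRow (fun a => tangentMap α (v a)) i =
        ∑ j with α j = i, whitneyRow v j := by
    ext c
    cases c using Fin.cases with
    | zero => simp [whitneyRow, ringPullback_coord]
    | succ c =>
      simp [whitneyRow, tangentMap]
  have hpi : ({J | α ∘ J = I} : Finset (Fin (q + 1) → Fin (k + 1))) =
      Fintype.piFinset fun b => {j | α j = I b} := by
    ext J
    simp [funext_iff]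
  have hdet := (ringPullback (K := K) α).map_det
    (Matrix.of fun b => whitneyRow (fun a => tangentMap α (v a)) (I b))
  rw [formPullback_apply, elementaryForm_apply, hpi, alternatingMap_sum_apply]
  refine hdet.trans ((congrArg Matrix.det (funext fun b => hrow (I b))).trans ?_)
  simp only [elementaryForm_apply]
  exact Matrix.detRowAlternating.toMultilinearMap.map_sum_finset (fun _ j => whitneyRow v j) _

/-- Adding all the other rows of the determinant to the first one makes it unitriangular. -/
theorem elementaryForm_id_apply_vertexVector :
    elementaryForm (K := K) id (fun a : Fin q => vertexVector 0 a.succ) = 1 := by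
  set A : Matrix (Fin (q + 1)) (Fin (q + 1)) (SimplexRing K q) :=
    fun i => whitneyRow (fun a => vertexVector 0 a.succ) i
  have hsum (c : Fin (q + 1)) : (∑ i, A i) c = if c = 0 then 1 else 0 := by
    rw [Finset.sum_apply]
    cases c using Fin.cases with
    | zero => simpa [A, whitneyRow] using sum_coord
    | succ c =>
      have hv : ∑ i, (vertexVector (K := K) 0 c.succ).1 i = 0 := (vertexVector 0 c.succ).2
      simp [whitneyRow, ← map_sum, hv]
  have hentry (i c : Fin q) : A i.succ c.succ = if i = c then 1 else 0 := by
    simp [A, whitneyRow, vertexVector_val]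
  have hlower : (A.updateRow 0 (∑ i, A i)).IsLowerTriangular := by
    intro i c hic
    replace hic : i < c := hic
    obtain ⟨c, rfl⟩ := Fin.exists_succ_eq.2 (Fin.ne_zero_of_lt hic)
    cases i using Fin.cases with
    | zero => simp [hsum]
    | succ i => simp [hentry, (Fin.succ_lt_succ_iff.1 hic).ne]
  have hdet : (A.updateRow 0 (∑ i, A i)).det = A.det := by
    simpa using A.det_updateRow_sum 0 1
  rw [elementaryForm_apply]
  refine hdet.symm.trans ?_
  rw [Matrix.det_of_isLowerTriangular _ hlower]
  refine Finset.prod_eq_one fun i _ => ?_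
  cases i using Fin.cases with
  | zero => simp [hsum]
  | succ i => simp [hentry]

theorem sum_tuple_succ {κ M : Type*} [Fintype κ] [AddCommMonoid M] (f : (Fin (n + 1) → κ) → M) :
    ∑ I, f I = ∑ i, ∑ J : Fin n → κ, f (Fin.cons i J) := by
  rw [← Fintype.sum_prod_type', ← (Fin.consEquiv fun _ => κ).sum_comp]
  rfl

theorem wedgeForm_empty (I : Fin 0 → Fin (l + 1)) :
    wedgeForm (K := K) I = constForm (K := K) l 1 := by
  ext v
  rw [wedgeForm_apply, Matrix.det_isEmpty, constForm_apply, map_one]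

theorem elementaryForm_singleton (i : Fin (l + 1)) (J : Fin 0 → Fin (l + 1)) :
    elementaryForm (K := K) (Fin.cons i J : Fin 1 → Fin (l + 1)) =
      mulCoord K 0 i (wedgeForm J) := by
  simp [elementaryForm, Subsingleton.elim _ J]

/-- Whitney's form of the face with vertices `I 0, …, I q`; its integral over this face is `1`. -/
def whitneyForm (I : Fin (q + 1) → Fin (l + 1)) : Form K q l :=
  (q.factorial : K) • elementaryForm I

theorem formPullback_whitneyForm (α : Fin (k + 1) → Fin (l + 1)) (I : Fin (q + 1) → Fin (l + 1)) :
    formPullback (K := K) q α (whitneyForm I) =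
      ∑ J : Fin (q + 1) → Fin (k + 1) with α ∘ J = I, whitneyForm J := by
  rw [whitneyForm, map_smul, formPullback_elementaryForm, Finset.smul_sum]
  rfl

instance {x y : SimplexCategory} : Fintype (x ⟶ y) := Fintype.ofFinite _

theorem sum_strictMono_eq_sum_hom {M : Type*} [AddCommMonoid M]
    {f : (Fin (q + 1) → Fin (l + 1)) → M} (hinj : ∀ I, ¬Function.Injective I → f I = 0) :
    ∑ I with StrictMono I, f I = ∑ α : ⦋q⦌ ⟶ ⦋l⦌, f α.toOrderHom := by
  rw [← Finset.sum_filter_of_ne (p := fun α : ⦋q⦌ ⟶ ⦋l⦌ => StrictMono α.toOrderHom) fun α _ hα =>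
    α.toOrderHom.monotone.strictMono_of_injective (by_contra fun h => hα (hinj _ h))]
  symm
  refine Finset.sum_nbij (fun α => α.toOrderHom) ?_ ?_ ?_ fun _ _ => rfl
  · intro α hα
    simpa using hα
  · intro α _ β _ h
    exact SimplexCategory.Hom.ext _ _ (OrderHom.ext _ _ h)
  · intro I hI
    have hI' : StrictMono I := by simpa using hI
    exact ⟨SimplexCategory.mkHom ⟨I, hI'.monotone⟩, by simpa using hI', rfl⟩

open Classical in
theorem formPullback_whitneyForm_of_injective (α : ⦋k⦌ ⟶ ⦋l⦌) {β : ⦋q⦌ ⟶ ⦋l⦌}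
    (hβ : Function.Injective β.toOrderHom) :
    formPullback (K := K) q α.toOrderHom (whitneyForm β.toOrderHom) =
      ∑ γ : ⦋q⦌ ⟶ ⦋k⦌ with γ ≫ α = β, whitneyForm γ.toOrderHom := by
  have hstrict (J : Fin (q + 1) → Fin (k + 1)) (hJ : α.toOrderHom ∘ J = β.toOrderHom) :
      StrictMono J := fun a b hab => lt_of_not_ge fun hba =>
    ((β.toOrderHom.monotone.strictMono_of_injective hβ) hab).not_ge
      (by rw [← hJ]; exact α.toOrderHom.monotone hba)
  rw [formPullback_whitneyForm]
  symm
  refine Finset.sum_nbij (fun γ => γ.toOrderHom) ?_ ?_ ?_ fun _ _ => rfl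
  · intro γ hγ
    rw [Finset.mem_filter_univ] at hγ ⊢
    rw [← hγ]
    rfl
  · intro γ _ δ _ h
    exact SimplexCategory.Hom.ext _ _ (OrderHom.ext _ _ h)
  · intro J hJ
    have hJ' : α.toOrderHom ∘ J = β.toOrderHom := by simpa using hJ
    refine ⟨SimplexCategory.mkHom ⟨J, (hstrict J hJ').monotone⟩, ?_, rfl⟩
    exact Finset.mem_filter_univ _ |>.2 <| SimplexCategory.Hom.ext _ _ (OrderHom.ext _ _ hJ')

variable [CharZero K]

theorem formIntegral_whitneyForm_id :
    formIntegral (K := K) q (whitneyForm id) = 1 := by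
  have hq : (q.factorial : K) ≠ 0 := Nat.cast_ne_zero.2 q.factorial_ne_zero
  rw [whitneyForm, map_smul, formIntegral_apply, elementaryForm_id_apply_vertexVector,
    ringIntegral_one, smul_eq_mul, mul_inv_cancel₀ hq]

theorem wedgeVertex_eq_sum (ω : Form K n l) :
    (formOperators K l).wedgeVertex n ω =
      ∑ I : Fin (n + 1) → Fin (l + 1), faceIntegral (K := K) I ω • wedgeForm I := by
  induction n with
  | zero =>
    rw [SimplexOperators.wedgeVertex_zero, sum_tuple_succ]
    refine Finset.sum_congr rfl fun i _ => ?_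
    rw [Fintype.sum_unique, wedgeForm_cons, faceIntegral_zero, wedgeForm_empty,
      ← map_smul, ← map_smul, smul_eq_mul, mul_one]
    rfl
  | succ n ih =>
    rw [SimplexOperators.wedgeVertex_succ, sum_tuple_succ]
    refine Finset.sum_congr rfl fun i _ => ?_
    rw [ih, map_sum]
    refine Finset.sum_congr rfl fun J _ => ?_
    rw [map_smul, wedgeForm_cons, faceIntegral_succ]
    rfl

theorem whitneyVertex_eq_sum (ω : Form K n l) :
    (formOperators K l).whitneyVertex n ω =
      ∑ I : Fin (n + 1) → Fin (l + 1), faceIntegral (K := K) I ω • elementaryForm I := by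
  induction n with
  | zero =>
    rw [SimplexOperators.whitneyVertex_zero, sum_tuple_succ]
    refine Finset.sum_congr rfl fun i _ => ?_
    rw [Fintype.sum_unique, elementaryForm_singleton, faceIntegral_zero, wedgeForm_empty,
      ← map_smul, ← map_smul, smul_eq_mul, mul_one]
    rfl
  | succ n ih =>
    rw [SimplexOperators.whitneyVertex_succ, sum_tuple_succ]
    refine Finset.sum_congr rfl fun i _ => ?_
    rw [ih, wedgeVertex_eq_sum, map_sum, map_sum, ← Finset.sum_sub_distrib]
    refine Finset.sum_congr rfl fun J _ => ?_
    rw [map_smul, map_smul, elementaryForm_cons, faceIntegral_succ]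
    exact (smul_sub _ _ _).symm

theorem sum_tuple_eq_factorial_smul {κ M : Type*} [Fintype κ] [LinearOrder κ] [AddCommMonoid M]
    {f : (Fin n → κ) → M} (hperm : ∀ I (σ : Equiv.Perm (Fin n)), f (I ∘ σ) = f I)
    (hinj : ∀ I, ¬Function.Injective I → f I = 0) :
    ∑ I, f I = n.factorial • ∑ I with StrictMono I, f I := by
  have hsort : ∑ p ∈ ({I | StrictMono I} : Finset (Fin n → κ)) ×ˢ
      (Finset.univ : Finset (Equiv.Perm (Fin n))), f (p.1 ∘ p.2) =
      ∑ I with Function.Injective I, f I := by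
    refine Finset.sum_nbij (fun p => p.1 ∘ p.2) ?_ ?_ ?_ fun _ _ => rfl
    · rintro ⟨I, σ⟩ hI
      have hI' : StrictMono I := by simpa using hI
      simpa using hI'.injective
    · rintro ⟨I, σ⟩ hI ⟨J, τ⟩ hJ (h : I ∘ σ = J ∘ τ)
      have hI' : StrictMono I := by simpa using hI
      have hJ' : StrictMono J := by simpa using hJ
      have hrange : Set.range I = Set.range J := by
        rw [← σ.surjective.range_comp I, ← τ.surjective.range_comp J, h]
      obtain rfl := (hI'.range_inj hJ').1 hrange
      rw [Prod.mk.injEq]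
      exact ⟨rfl, Equiv.ext fun a => hI'.injective (congrFun h a)⟩
    · intro I hI
      have hI' : Function.Injective I := by simpa using hI
      refine ⟨(I ∘ Tuple.sort I, (Tuple.sort I)⁻¹), ?_, ?_⟩
      · simpa using (Tuple.monotone_sort I).strictMono_of_injective
          (hI'.comp (Tuple.sort I).injective)
      · funext a
        simp
  have hinjective : ∑ I with Function.Injective I, f I = ∑ I, f I :=
    Finset.sum_filter_of_ne fun I _ hI => by_contra fun h => hI (hinj I h)
  rw [Finset.sum_product] at hsort
  simp only [hperm, Finset.sum_const, Finset.card_univ, Fintype.card_perm,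
    Fintype.card_fin] at hsort
  rw [← hinjective, ← hsort, Finset.smul_sum]

/-- Dupont's projection onto the span of the Whitney forms. -/
def whitneyProjection (q l : ℕ) : Form K q l →ₗ[K] Form K q l :=
  ∑ α : ⦋q⦌ ⟶ ⦋l⦌, (faceIntegral α.toOrderHom).smulRight (whitneyForm α.toOrderHom)

theorem whitneyProjection_eq_smul_whitneyVertex (ω : Form K q l) :
    whitneyProjection (K := K) q l ω = (q + 1 : K)⁻¹ • (formOperators K l).whitneyVertex q ω := by
  have hinj (I : Fin (q + 1) → Fin (l + 1)) (hI : ¬Function.Injective I) :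
      faceIntegral (K := K) I ω • elementaryForm (K := K) I = 0 := by
    rw [faceIntegral_of_not_injective hI, zero_smul]
  have hperm (I : Fin (q + 1) → Fin (l + 1)) (σ : Equiv.Perm (Fin (q + 1))) :
      faceIntegral (K := K) (I ∘ σ) ω • elementaryForm (K := K) (I ∘ σ) =
        faceIntegral (K := K) I ω • elementaryForm I := by
    rw [faceIntegral_comp_perm, elementaryForm_comp_perm]
    obtain h | h := Int.units_eq_one_or (Equiv.Perm.sign σ) <;> simp [h]
  have hq : (q + 1 : K) ≠ 0 := Nat.cast_add_one_ne_zero q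
  rw [whitneyVertex_eq_sum, sum_tuple_eq_factorial_smul hperm hinj,
    sum_strictMono_eq_sum_hom hinj, ← Nat.cast_smul_eq_nsmul K, smul_smul, Nat.factorial_succ,
    Nat.cast_mul, Nat.cast_succ, inv_mul_cancel_left₀ hq, Finset.smul_sum, whitneyProjection,
    LinearMap.sum_apply]
  refine Finset.sum_congr rfl fun α _ => ?_
  rw [LinearMap.smulRight_apply, whitneyForm, smul_comm]

end WhitneyForms

section CompletedTensor

open DirInvModule

variable {C : Type u} [CommRing C]

theorem pieceMap_add {M N : DirInvModule C} {φ ψ χ : M →ₗ[C] N} {j : M.index} {k : N.index}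
    (hφ : PieceContinuous M N φ j k) (hψ : PieceContinuous M N ψ j k)
    (hχ : PieceContinuous M N χ j k) (h : χ = φ + ψ) (x : M.piece j) :
    pieceMap hχ x = pieceMap hφ x + pieceMap hψ x := by
  subst h
  refine Subtype.ext (funext fun i => ?_)
  obtain ⟨a, ha⟩ := hφ.invContinuous i
  obtain ⟨b, hb⟩ := hψ.invContinuous i
  have ha' := (M.filOn_anti j (le_max_left a b)).trans ha
  have hb' := (M.filOn_anti j (le_max_right a b)).trans hb
  have hc : M.filOn j (max a b) ≤ (N.filOn k i).comap ((φ + ψ).restrict hχ.F_le) :=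
    fun y hy => by
      have h : (φ + ψ).restrict hχ.F_le y = φ.restrict hφ.F_le y + ψ.restrict hψ.F_le y := rfl
      rw [Submodule.mem_comap, h]
      exact add_mem (ha' hy) (hb' hy)
  change (pieceMap hχ x).1 i = (pieceMap hφ x).1 i + (pieceMap hψ x).1 i
  rw [pieceMap, pieceMap, pieceMap, invLimMap_apply _ _ _ ha', invLimMap_apply _ _ _ hb',
    invLimMap_apply _ _ _ hc]
  obtain ⟨m, hm⟩ := Submodule.mkQ_surjective _ (x.1 (max a b))
  rw [← hm]
  rfl

theorem completionMap_add {M N : DirInvModule C} (f g h : M ⟶ N)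
    (hfg : Hom.lin h = Hom.lin f + Hom.lin g) :
    completionMap h = completionMap f + completionMap g := by
  refine LinearMap.ext fun z => ?_
  obtain ⟨j, x, rfl⟩ := Completion.exists_of M z
  obtain ⟨k₁, h₁⟩ := f.cont j
  obtain ⟨k₂, h₂⟩ := g.cont j
  obtain ⟨k₃, h₃⟩ := h.cont j
  obtain ⟨k₄, h₁₄, h₂₄⟩ := exists_ge_ge k₁ k₂
  obtain ⟨k, h₃k, h₄k⟩ := exists_ge_ge k₃ k₄
  have hf : PieceContinuous M N (Hom.lin f) j k := h₁.comp (pieceContinuous_id (h₁₄.trans h₄k))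
  have hg : PieceContinuous M N (Hom.lin g) j k := h₂.comp (pieceContinuous_id (h₂₄.trans h₄k))
  have hh : PieceContinuous M N (Hom.lin h) j k := h₃.comp (pieceContinuous_id h₃k)
  rw [LinearMap.add_apply, completionMap_of f hf, completionMap_of g hg, completionMap_of h hh,
    pieceMap_add hf hg hh hfg, map_add]

theorem completionEquiv_of_toInvLim {M : DirInvModule C} (hM : M.IsComplete) {j : M.index}
    (m : M.F j) :
    M.completionEquiv hM (Completion.of M j (toInvLim (M.filOn j) (M.filOn_anti j) m)) = m := by
  classical
  rw [← LinearEquiv.eq_symm_apply]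
  have hof : M.colimToCompletion (Module.DirectLimit.of C M.index (fun j => M.F j)
      (fun _ _ h => Submodule.inclusion (M.F_mono h)) j m) =
        Completion.of M j (toInvLim (M.filOn j) (M.filOn_anti j) m) :=
    Module.DirectLimit.lift_of _ _ _
  rw [completionEquiv, LinearEquiv.trans_symm, LinearEquiv.trans_apply, LinearEquiv.symm_symm,
    LinearEquiv.ofBijective_apply, ← hof]
  congr 1
  rw [LinearEquiv.eq_symm_apply, LinearEquiv.ofBijective_apply]
  exact colimToModule_of _ _ _

theorem completionEquiv_completionMap {M N : DirInvModule C} (hM : M.IsComplete)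
    (hN : N.IsComplete) (f : M ⟶ N) (z : M.Completion) :
    N.completionEquiv hN (completionMap f z) = Hom.lin f (M.completionEquiv hM z) := by
  classical
  obtain ⟨y, rfl⟩ := hM.colimToCompletion_bijective.2 z
  obtain ⟨j, m, rfl⟩ := Module.DirectLimit.exists_of y
  have hof : M.colimToCompletion (Module.DirectLimit.of C M.index (fun j => M.F j)
      (fun _ _ h => Submodule.inclusion (M.F_mono h)) j m) =
        Completion.of M j (toInvLim (M.filOn j) (M.filOn_anti j) m) :=
    Module.DirectLimit.lift_of _ _ _
  obtain ⟨k, hk⟩ := f.cont j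
  rw [hof, completionMap_toInvLim f m.1 m.2 (hk.F_le m.2), completionEquiv_of_toInvLim,
    completionEquiv_of_toInvLim]

variable {A B D : Type u} [AddCommGroup A] [Module C A] [AddCommGroup B] [Module C B]
  [AddCommGroup D] [Module C D]

/-- The map `g ⊗̂ f` of completed tensor products, as an additive function of the map `g` of
discrete modules. -/
def completedTensor {M N : DirInvModule C} (f : M ⟶ N) : (A →ₗ[C] B) →+
    ((tensor (discrete (C := C) A) M).Completion →ₗ[C]
      (tensor (discrete (C := C) B) N).Completion) where
  toFun g := completionMap (tensorMap (discreteMap g) f)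
  map_zero' := completionMap_zero _ (TensorProduct.map_zero_left _)
  map_add' _ _ := completionMap_add _ _ _ (TensorProduct.map_add_left _ _ _)

theorem completedTensor_comp {M N P : DirInvModule C} (f : M ⟶ N) (f' : N ⟶ P) (g : A →ₗ[C] B)
    (g' : B →ₗ[C] D) (z : (tensor (discrete (C := C) A) M).Completion) :
    completedTensor f' g' (completedTensor f g z) = completedTensor (f ≫ f') (g' ∘ₗ g) z := by
  change completionMap _ (completionMap _ z) = completionMap _ z
  rw [← LinearMap.comp_apply, ← completionMap_comp, ← tensorMap_comp]
  rfl

theorem completedTensor_id (M : DirInvModule C)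
    (z : (tensor (discrete (C := C) A) M).Completion) :
    completedTensor (𝟙 M) (LinearMap.id : A →ₗ[C] A) z = z := by
  have h : tensorMap (discreteMap (LinearMap.id : A →ₗ[C] A)) (𝟙 M) =
      𝟙 (tensor (discrete (C := C) A) M) := hom_ext TensorProduct.map_id
  change completionMap _ z = z
  rw [h, completionMap_id]
  rfl

theorem completedTensor_id_sub (M : DirInvModule C) (g : A →ₗ[C] A)
    (z : (tensor (discrete (C := C) A) M).Completion) :
    completedTensor (𝟙 M) (LinearMap.id - g) z = z - completedTensor (𝟙 M) g z := by
  have h : completedTensor (𝟙 M) (LinearMap.id - g) + completedTensor (𝟙 M) g =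
      completedTensor (𝟙 M) (LinearMap.id : A →ₗ[C] A) := by
    rw [← AddMonoidHom.map_add, sub_add_cancel]
  rw [eq_sub_iff_add_eq, ← LinearMap.add_apply, h, completedTensor_id]

/-- The inverse `m ↦ 1 ⊗ m` of the canonical morphism `C ⊗ M → M`. -/
def lidInv (M : DirInvModule C) : M ⟶ tensor (discrete (C := C) C) M where
  lin := (TensorProduct.lid C M).symm.toLinearMap
  cont j := ⟨(PUnit.unit, j), fun _ hm => Submodule.apply_mem_map₂ (TensorProduct.mk C C M)
    (Submodule.mem_top (x := (1 : C))) hm, fun i => ⟨i, fun _ hm =>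
      Submodule.mem_sup_right (Submodule.apply_mem_map₂ (TensorProduct.mk C C M)
        (Submodule.mem_top (x := (1 : C))) hm)⟩⟩

theorem lidInv_lidHom (M : DirInvModule C) :
    completionMap (lidHom M) ∘ₗ completionMap (lidInv M) = LinearMap.id := by
  have h : lidInv M ≫ lidHom M = 𝟙 M :=
    hom_ext (LinearMap.ext fun m => (TensorProduct.lid C M).apply_symm_apply m)
  rw [← completionMap_comp, h, completionMap_id]

theorem lidHom_lidInv (M : DirInvModule C) :
    completionMap (lidInv M) ∘ₗ completionMap (lidHom M) = LinearMap.id := by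
  have h : lidHom M ≫ lidInv M = 𝟙 _ :=
    hom_ext (LinearMap.ext fun m => (TensorProduct.lid C M).symm_apply_apply m)
  rw [← completionMap_comp, h, completionMap_id]

/-- The canonical isomorphism `C ⊗̂ M ≅ M` for a complete dir-inv module. -/
def completedLid (M : DirInvModule C) (hM : M.IsComplete) :
    (tensor (discrete (C := C) C) M).Completion ≃ₗ[C] M :=
  { (M.completionEquiv hM).toLinearMap ∘ₗ completionMap (lidHom M) with
    invFun := fun m => completionMap (lidInv M) ((M.completionEquiv hM).symm m)
    left_inv := fun z => by
      have h := LinearMap.congr_fun (lidHom_lidInv M) z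
      simpa using h
    right_inv := fun m => by
      have h := LinearMap.congr_fun (lidInv_lidHom M) ((M.completionEquiv hM).symm m)
      exact (congrArg (M.completionEquiv hM) h).trans ((M.completionEquiv hM).apply_symm_apply m) }

theorem completedLid_completedTensor {M N : DirInvModule C} (hM : M.IsComplete)
    (hN : N.IsComplete) (f : M ⟶ N) (z : (tensor (discrete (C := C) C) M).Completion) :
    completedLid N hN (completedTensor f (LinearMap.id : C →ₗ[C] C) z) =
      Hom.lin f (completedLid M hM z) := by
  change N.completionEquiv hN (completionMap (lidHom N) (completionMap _ z)) =
    Hom.lin f (M.completionEquiv hM (completionMap (lidHom M) z))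
  rw [← completionEquiv_completionMap hM hN, ← LinearMap.comp_apply, ← LinearMap.comp_apply,
    ← completionMap_comp, ← completionMap_comp]
  congr 3
  refine hom_ext (TensorProduct.ext' fun c m => ?_)
  exact (map_smul (Hom.lin f) (show C from c) m).symm

theorem completedTensor_completedLid_symm {M N : DirInvModule C} (hM : M.IsComplete)
    (hN : N.IsComplete) (f : M ⟶ N) (g : C →ₗ[C] A) (m : M) :
    completedTensor f g ((completedLid M hM).symm m) =
      completedTensor (𝟙 N) g ((completedLid N hN).symm (Hom.lin f m)) := by
  have h : (completedLid N hN).symm (Hom.lin f m) =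
      completedTensor f (LinearMap.id : C →ₗ[C] C) ((completedLid M hM).symm m) := by
    rw [LinearEquiv.symm_apply_eq, completedLid_completedTensor hM, LinearEquiv.apply_symm_apply]
  rw [h, completedTensor_comp, LinearMap.comp_id, Category.comp_id]

/-- The element `a ⊗ m` of `A ⊗̂ M`, for a discrete module `A` and a complete dir-inv module
`M`. -/
def pureTensor {M : DirInvModule C} (hM : M.IsComplete) (m : M) :
    A →+ (tensor (discrete (C := C) A) M).Completion where
  toFun a := completedTensor (𝟙 M) (LinearMap.toSpanSingleton C A a) ((completedLid M hM).symm m)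
  map_zero' := by
    rw [LinearMap.toSpanSingleton_zero, map_zero, LinearMap.zero_apply]
  map_add' a b := by
    have h : LinearMap.toSpanSingleton C A (a + b) =
        LinearMap.toSpanSingleton C A a + LinearMap.toSpanSingleton C A b := by
      ext
      simp
    rw [h, map_add, LinearMap.add_apply]

theorem pureTensor_zero_right {M : DirInvModule C} (hM : M.IsComplete) (a : A) :
    pureTensor hM 0 a = 0 := by
  change completedTensor (𝟙 M) _ _ = 0
  rw [map_zero, map_zero]

theorem completedTensor_pureTensor {M N : DirInvModule C} (hM : M.IsComplete)
    (hN : N.IsComplete) (f : M ⟶ N) (g : A →ₗ[C] B) (m : M) (a : A) :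
    completedTensor f g (pureTensor hM m a) = pureTensor hN (Hom.lin f m) (g a) := by
  change completedTensor f g (completedTensor (𝟙 M) _ _) = completedTensor (𝟙 N) _ _
  rw [completedTensor_comp, Category.id_comp, completedTensor_completedLid_symm hM hN]
  congr 3
  ext
  simp

theorem completedLid_pureTensor_one {M : DirInvModule C} (hM : M.IsComplete) (m : M) :
    completedLid M hM (pureTensor hM m (1 : C)) = m := by
  have h : LinearMap.toSpanSingleton C C 1 = LinearMap.id := by
    ext
    simp
  change completedLid M hM (completedTensor (𝟙 M) _ _) = m
  rw [h, completedTensor_id, LinearEquiv.apply_symm_apply]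

theorem pureTensor_completedLid {M : DirInvModule C} (hM : M.IsComplete) (g : A →ₗ[C] C) (b : B)
    (z : (tensor (discrete (C := C) A) M).Completion) :
    pureTensor hM (completedLid M hM (completedTensor (𝟙 M) g z)) b =
      completedTensor (𝟙 M) (LinearMap.toSpanSingleton C B b ∘ₗ g) z := by
  change completedTensor (𝟙 M) _ _ = _
  rw [LinearEquiv.symm_apply_apply, completedTensor_comp, Category.id_comp]

theorem lin_completedLid_completedTensor {M N : DirInvModule C} (hM : M.IsComplete)
    (hN : N.IsComplete) (f : M ⟶ N) (g : A →ₗ[C] C)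
    (z : (tensor (discrete (C := C) A) M).Completion) :
    Hom.lin f (completedLid M hM (completedTensor (𝟙 M) g z)) =
      completedLid N hN (completedTensor (𝟙 N) g (completedTensor f LinearMap.id z)) := by
  rw [← completedLid_completedTensor hM hN, completedTensor_comp, completedTensor_comp,
    Category.id_comp, Category.comp_id, LinearMap.id_comp, LinearMap.comp_id]

end CompletedTensor

section Comparison

open Simplicial DirInvModule

variable {K : Type u} [Field K]

theorem coface_eq (M : CosimplicialObject (DirInvModule K)) (q : ℕ) {k l : ℕ} (α : ⦋k⦌ ⟶ ⦋l⦌) :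
    coface M q α = completedTensor (M.map α) (LinearMap.id : Form K q k →ₗ[K] Form K q k) := rfl

theorem restrictForm_eq (M : CosimplicialObject (DirInvModule K)) (q : ℕ) {k l : ℕ}
    (α : ⦋k⦌ ⟶ ⦋l⦌) : restrictForm M q α =
      completedTensor (𝟙 (M.obj ⦋l⦌)) (formPullback (K := K) q α.toOrderHom) := rfl

theorem completedD_eq (M : CosimplicialObject (DirInvModule K)) (q k l : ℕ) :
    completedD M q k l = completedTensor (𝟙 (M.obj ⦋l⦌)) (formD (K := K) q k) := rfl

theorem completedIntegral_eq [CharZero K] (l : ℕ) (M : DirInvModule K) (hM : M.IsComplete)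
    (z : (tensor (discrete (C := K) (Form K l l)) M).Completion) :
    completedIntegral l M hM z =
      completedLid M hM (completedTensor (𝟙 M) (formIntegral (K := K) l) z) := rfl

theorem mem_normSub_succ (X : CosimplicialObject (ModuleCat.{u} K)) (q : ℕ)
    (m : X.obj ⦋q + 1⦌) : m ∈ normSub X (q + 1) ↔ ∀ i, (X.σ i).hom m = 0 := by
  simp only [normSub, Submodule.mem_iInf, LinearMap.mem_ker]

variable (M : CosimplicialObject (DirInvModule K)) (hM : ∀ q : ℕ, (M.obj ⦋q⦌).IsComplete)

theorem map_completedIntegral [CharZero K] {q l : ℕ} (α : ⦋q⦌ ⟶ ⦋l⦌) (u : thomSullivanSub M q) :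
    Hom.lin (M.map α) (completedIntegral q (M.obj ⦋q⦌) (hM q) (u.1 q)) =
      completedLid (M.obj ⦋l⦌) (hM l) (completedTensor (𝟙 _)
        (faceIntegral (K := K) α.toOrderHom) (u.1 l)) := by
  have h := u.2 q l α
  rw [coface_eq, restrictForm_eq] at h
  rw [completedIntegral_eq, lin_completedLid_completedTensor (hM q) (hM l), h,
    completedTensor_comp, Category.id_comp]
  rfl

theorem completedIntegral_mem_normSub [CharZero K] (q : ℕ) (u : thomSullivanSub M q) :
    (completedIntegral q (M.obj ⦋q⦌) (hM q) (u.1 q) : M.obj ⦋q⦌) ∈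
      normSub (underlying M) q := by
  cases q with
  | zero => exact Submodule.mem_top (M := (underlying M).obj ⦋0⦌)
  | succ q =>
    refine (mem_normSub_succ (underlying M) q _).2 fun i =>
      (map_completedIntegral M hM (SimplexCategory.σ i) u).trans ?_
    have hσ : ¬Function.Injective (SimplexCategory.σ i).toOrderHom := fun h =>
      i.castSucc_lt_succ.ne (h ((Fin.predAbove_castSucc_self i).trans
        (Fin.predAbove_succ_self i).symm))
    have hzero : faceIntegral (K := K) (SimplexCategory.σ i).toOrderHom = 0 :=
      LinearMap.ext (faceIntegral_of_not_injective hσ)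
    rw [hzero, map_zero, LinearMap.zero_apply, map_zero]
    rfl

/-- The map `u ↦ ∫ u_q` from the Thom–Sullivan to the standard normalization, in degree `q`. -/
def integrate [CharZero K] (q : ℕ) : thomSullivanSub M q →ₗ[K] normSub (underlying M) q :=
  LinearMap.codRestrict _ (completedIntegral q (M.obj ⦋q⦌) (hM q) ∘ₗ
    LinearMap.proj (φ := fun l => FormTensor M q l l) q ∘ₗ (thomSullivanSub M q).subtype)
    (completedIntegral_mem_normSub M hM q)

theorem integrate_thomSullivanD [CharZero K] (q : ℕ) (u : thomSullivanSub M q) :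
    (integrate M hM (q + 1) (thomSullivanD M q u)).1 =
      (AlgebraicTopology.AlternatingCofaceMapComplex.objD (underlying M) q).hom
        (integrate M hM q u).1 := by
  have objD_integrate : (AlgebraicTopology.AlternatingCofaceMapComplex.objD (underlying M) q).hom
      (integrate M hM q u).1 = ∑ i : Fin (q + 2), (-1 : ℤ) ^ (i : ℕ) •
        Hom.lin (M.map (SimplexCategory.δ i))
          (completedIntegral q (M.obj ⦋q⦌) (hM q) (u.1 q)) := by
    rw [AlgebraicTopology.AlternatingCofaceMapComplex.objD, ModuleCat.hom_sum,
      LinearMap.sum_apply]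
    rfl
  have stokes : formIntegral (K := K) (q + 1) ∘ₗ formD (K := K) q (q + 1) =
      ∑ i : Fin (q + 2), (-1 : ℤ) ^ (i : ℕ) •
        faceIntegral (K := K) (SimplexCategory.δ i).toOrderHom := by
    refine LinearMap.ext fun ω => ?_
    rw [LinearMap.comp_apply, ← faceIntegral_id, faceIntegral_formD, LinearMap.sum_apply]
    refine Finset.sum_congr rfl fun i _ => ?_
    rw [LinearMap.smul_apply, zsmul_eq_mul]
    push_cast
    rfl
  rw [objD_integrate]
  change completedIntegral (q + 1) _ (hM (q + 1)) (completedD M q (q + 1) (q + 1) (u.1 (q + 1))) = _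
  rw [completedIntegral_eq, completedD_eq, completedTensor_comp, Category.id_comp, stokes, map_sum,
    LinearMap.sum_apply, map_sum]
  refine Finset.sum_congr rfl fun i _ => ?_
  rw [map_completedIntegral, map_zsmul, LinearMap.smul_apply, map_zsmul]

theorem map_eq_zero_of_mem_normSub {q l : ℕ} (α : ⦋q⦌ ⟶ ⦋l⦌)
    (hα : ¬Function.Injective α.toOrderHom) (m : M.obj ⦋q⦌) (hm : m ∈ normSub (underlying M) q) :
    Hom.lin (M.map α) m = 0 := by
  cases q with
  | zero =>
    refine absurd (fun a b _ => ?_) hα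
    exact Subsingleton.elim (α := Fin 1) a b
  | succ q =>
    obtain ⟨i, θ, rfl⟩ := SimplexCategory.eq_σ_comp_of_not_injective α hα
    have h : Hom.lin (M.map (SimplexCategory.σ i)) m = 0 :=
      (mem_normSub_succ (underlying M) q m).1 hm i
    rw [M.map_comp, comp_lin, LinearMap.comp_apply, h, map_zero]

/-- The map `m ↦ ∑ α, ω_α ⊗ α^* m` from `M^q` to `Ω^q(Δ^l) ⊗̂ M^l`, where `ω_α` is the Whitney
form of the face `α`. -/
def whitneySum (q l : ℕ) : M.obj ⦋q⦌ →ₗ[K] FormTensor M q l l :=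
  ∑ α : ⦋q⦌ ⟶ ⦋l⦌,
    completedTensor (𝟙 (M.obj ⦋l⦌))
        (LinearMap.toSpanSingleton K _ (whitneyForm (K := K) α.toOrderHom)) ∘ₗ
      (completedLid (M.obj ⦋l⦌) (hM l)).symm.toLinearMap ∘ₗ Hom.lin (M.map α)

theorem whitneySum_apply (q l : ℕ) (m : M.obj ⦋q⦌) : whitneySum M hM q l m =
    ∑ α : ⦋q⦌ ⟶ ⦋l⦌,
      pureTensor (hM l) (Hom.lin (M.map α) m) (whitneyForm (K := K) α.toOrderHom) := by
  rw [whitneySum, LinearMap.sum_apply]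
  rfl

theorem coface_whitneySum (q : ℕ) {k l : ℕ} (α : ⦋k⦌ ⟶ ⦋l⦌) (m : M.obj ⦋q⦌)
    (hm : m ∈ normSub (underlying M) q) :
    coface M q α (whitneySum M hM q k m) = restrictForm M q α (whitneySum M hM q l m) := by
  classical
  have hcoface : coface M q α (whitneySum M hM q k m) = ∑ γ : ⦋q⦌ ⟶ ⦋k⦌,
      pureTensor (hM l) (Hom.lin (M.map (γ ≫ α)) m) (whitneyForm (K := K) γ.toOrderHom) := by
    simp only [coface_eq, whitneySum_apply, map_sum, completedTensor_pureTensor (hM k) (hM l),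
      M.map_comp, comp_lin, LinearMap.comp_apply, LinearMap.id_apply]
  have hrestrict : restrictForm M q α (whitneySum M hM q l m) = ∑ β : ⦋q⦌ ⟶ ⦋l⦌,
      pureTensor (hM l) (Hom.lin (M.map β) m)
        (formPullback (K := K) q α.toOrderHom (whitneyForm β.toOrderHom)) := by
    simp only [restrictForm_eq, whitneySum_apply, map_sum, completedTensor_pureTensor (hM l) (hM l),
      id_lin, LinearMap.id_apply]
  rw [hcoface, hrestrict, ← Finset.sum_fiberwise (g := fun γ : ⦋q⦌ ⟶ ⦋k⦌ => γ ≫ α)]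
  refine Finset.sum_congr rfl fun β _ => ?_
  by_cases hβ : Function.Injective β.toOrderHom
  · rw [formPullback_whitneyForm_of_injective α hβ, map_sum]
    refine Finset.sum_congr rfl fun γ hγ => ?_
    rw [(Finset.mem_filter.1 hγ).2]
  · rw [map_eq_zero_of_mem_normSub M β hβ m hm, pureTensor_zero_right]
    refine Finset.sum_eq_zero fun γ hγ => ?_
    rw [(Finset.mem_filter.1 hγ).2, map_eq_zero_of_mem_normSub M β hβ m hm, pureTensor_zero_right]

/-- Whitney's section `m ↦ (∑ α, ω_α ⊗ α^* m)_l` of the integration map in degree `q`. -/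
def whitneySection (q : ℕ) : normSub (underlying M) q →ₗ[K] thomSullivanSub M q :=
  LinearMap.codRestrict _
    (LinearMap.pi fun l => whitneySum M hM q l ∘ₗ (normSub (underlying M) q).subtype)
    fun m _ _ α => coface_whitneySum M hM q α m.1 m.2

theorem completedIntegral_whitneySum [CharZero K] (q : ℕ) (m : M.obj ⦋q⦌)
    (hm : m ∈ normSub (underlying M) q) :
    completedIntegral q (M.obj ⦋q⦌) (hM q) (whitneySum M hM q q m) = m := by
  rw [whitneySum_apply, Fintype.sum_eq_single (𝟙 ⦋q⦌)]
  · have hid : whitneyForm (K := K) (SimplexCategory.Hom.toOrderHom (𝟙 ⦋q⦌)) = whitneyForm id := rfl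
    rw [completedIntegral_eq, completedTensor_pureTensor (hM q) (hM q), hid,
      formIntegral_whitneyForm_id, completedLid_pureTensor_one, M.map_id]
    rfl
  · intro α hα
    have hinj : ¬Function.Injective α.toOrderHom := fun h =>
      haveI := SimplexCategory.mono_iff_injective.2 h
      hα (SimplexCategory.eq_id_of_mono α)
    rw [map_eq_zero_of_mem_normSub M α hinj m hm, pureTensor_zero_right]

theorem whitneySum_completedIntegral [CharZero K] (q l : ℕ) (u : thomSullivanSub M q) :
    whitneySum M hM q l (completedIntegral q (M.obj ⦋q⦌) (hM q) (u.1 q)) =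
      completedTensor (𝟙 (M.obj ⦋l⦌)) (whitneyProjection (K := K) q l) (u.1 l) := by
  rw [whitneySum_apply, whitneyProjection, map_sum, LinearMap.sum_apply]
  refine Finset.sum_congr rfl fun α _ => ?_
  rw [map_completedIntegral, pureTensor_completedLid]
  rfl

theorem integrate_whitneySection [CharZero K] (q : ℕ) (m : normSub (underlying M) q) :
    integrate M hM q (whitneySection M hM q m) = m :=
  Subtype.ext (completedIntegral_whitneySum M hM q m.1 m.2)

theorem whitneySection_integrate [CharZero K] (q l : ℕ) (u : thomSullivanSub M q) :
    (whitneySection M hM q (integrate M hM q u)).1 l =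
      completedTensor (𝟙 (M.obj ⦋l⦌)) (whitneyProjection (K := K) q l) (u.1 l) :=
  whitneySum_completedIntegral M hM q l u

/-- Dupont's homotopy on the complete Thom–Sullivan normalization. -/
def thomSullivanHomotopy [CharZero K] (q : ℕ) :
    thomSullivanSub M (q + 1) →ₗ[K] thomSullivanSub M q :=
  LinearMap.restrict (LinearMap.pi fun l => completedTensor (𝟙 (M.obj ⦋l⦌))
    ((formOperators K l).homotopy q) ∘ₗ LinearMap.proj l) (by
    intro u hu k l α
    have hcomm : formPullback (K := K) q α.toOrderHom ∘ₗ (formOperators K l).homotopy q =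
        (formOperators K k).homotopy q ∘ₗ formPullback (K := K) (q + 1) α.toOrderHom :=
      LinearMap.ext ((isPullback_formPullback α.toOrderHom).map_homotopy q)
    have h := congrArg (completedTensor (𝟙 (M.obj ⦋l⦌)) ((formOperators K k).homotopy q))
      (hu k l α)
    simp only [LinearMap.pi_apply, LinearMap.comp_apply, LinearMap.proj_apply]
    rw [coface_eq, restrictForm_eq, completedTensor_comp, completedTensor_comp] at h ⊢
    rw [hcomm]
    exact h)

theorem thomSullivanD_homotopy [CharZero K] (q : ℕ) (u : thomSullivanSub M (q + 1)) :
    thomSullivanD M q (thomSullivanHomotopy M q u) +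
      thomSullivanHomotopy M (q + 1) (thomSullivanD M (q + 1) u) =
        u - whitneySection M hM (q + 1) (integrate M hM (q + 1) u) := by
  refine Subtype.ext (funext fun l => ?_)
  have hform : formD (K := K) q l ∘ₗ (formOperators K l).homotopy q +
      (formOperators K l).homotopy (q + 1) ∘ₗ formD (K := K) (q + 1) l =
        LinearMap.id - whitneyProjection (K := K) (q + 1) l := by
    refine LinearMap.ext fun ω => ((formOperators K l).d_homotopy q ω).trans ?_
    rw [LinearMap.sub_apply, whitneyProjection_eq_smul_whitneyVertex, Nat.cast_succ, add_assoc,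
      one_add_one_eq_two]
    rfl
  change completedTensor _ _ (completedTensor _ _ (u.1 l)) +
    completedTensor _ _ (completedTensor _ _ (u.1 l)) =
      u.1 l - (whitneySection M hM (q + 1) (integrate M hM (q + 1) u)).1 l
  rw [whitneySection_integrate, ← completedTensor_id_sub, ← hform, map_add, completedTensor_comp,
    completedTensor_comp, Category.id_comp]
  rfl

theorem thomSullivanHomotopy_d_zero [CharZero K] (u : thomSullivanSub M 0) :
    thomSullivanHomotopy M 0 (thomSullivanD M 0 u) =
      u - whitneySection M hM 0 (integrate M hM 0 u) := by
  refine Subtype.ext (funext fun l => ?_)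
  have hform : (formOperators K l).homotopy 0 ∘ₗ formD (K := K) 0 l =
      LinearMap.id - whitneyProjection (K := K) 0 l := by
    refine LinearMap.ext fun ω => ((formOperators K l).homotopy_d_zero ω).trans ?_
    rw [LinearMap.sub_apply, whitneyProjection_eq_smul_whitneyVertex, Nat.cast_zero, zero_add,
      inv_one, one_smul]
    rfl
  change completedTensor _ _ (completedTensor _ _ (u.1 l)) =
    u.1 l - (whitneySection M hM 0 (integrate M hM 0 u)).1 l
  rw [whitneySection_integrate, ← completedTensor_id_sub, ← hform, completedTensor_comp,
    Category.id_comp]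

theorem thomSullivanD_thomSullivanD (q : ℕ) (u : thomSullivanSub M q) :
    thomSullivanD M (q + 1) (thomSullivanD M q u) = 0 :=
  Subtype.ext (funext fun l => completedD_completedD M q l l (u.1 l))

theorem whitneySection_integrate_thomSullivanD [CharZero K] (q : ℕ) (u : thomSullivanSub M q) :
    whitneySection M hM (q + 1) (integrate M hM (q + 1) (thomSullivanD M q u)) =
      thomSullivanD M q (whitneySection M hM q (integrate M hM q u)) := by
  have h1 := thomSullivanD_homotopy M hM q (thomSullivanD M q u)
  rw [thomSullivanD_thomSullivanD, map_zero, add_zero] at h1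
  have h2 : thomSullivanD M q (thomSullivanHomotopy M q (thomSullivanD M q u)) =
      thomSullivanD M q u -
        thomSullivanD M q (whitneySection M hM q (integrate M hM q u)) := by
    cases q with
    | zero => rw [thomSullivanHomotopy_d_zero M hM, map_sub]
    | succ q =>
      rw [← map_sub, ← thomSullivanD_homotopy M hM q, map_add, thomSullivanD_thomSullivanD,
        zero_add]
  exact sub_right_injective (h1.symm.trans h2)

/-- The differential of the standard normalization. -/
def normD (q : ℕ) : normSub (underlying M) q →ₗ[K] normSub (underlying M) (q + 1) :=
  (AlgebraicTopology.AlternatingCofaceMapComplex.objD (underlying M) q).hom.restrict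
    (objD_mem_normSub (underlying M) q)

theorem normD_integrate [CharZero K] (q : ℕ) (u : thomSullivanSub M q) :
    normD M q (integrate M hM q u) = integrate M hM (q + 1) (thomSullivanD M q u) :=
  Subtype.ext (integrate_thomSullivanD M hM q u).symm

theorem thomSullivanD_whitneySection [CharZero K] (q : ℕ) (m : normSub (underlying M) q) :
    thomSullivanD M q (whitneySection M hM q m) = whitneySection M hM (q + 1) (normD M q m) := by
  have h := whitneySection_integrate_thomSullivanD M hM q (whitneySection M hM q m)
  rw [← normD_integrate, integrate_whitneySection] at h
  exact h.symm

theorem thomSullivan_d (q : ℕ) :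
    (thomSullivan M).d q (q + 1) = ModuleCat.ofHom (thomSullivanD M q) :=
  CochainComplex.of_d (fun q => ModuleCat.of K (thomSullivanSub M q))
    (fun q => ModuleCat.ofHom (thomSullivanD M q)) q

theorem stdNormalization_d (q : ℕ) :
    (stdNormalization (underlying M)).d q (q + 1) = ModuleCat.ofHom (normD M q) :=
  CochainComplex.of_d (fun q => ModuleCat.of K (normSub (underlying M) q))
    (fun q => ModuleCat.ofHom (normD M q)) q

/-- The integration map, as a morphism of complexes. -/
def integrateHom [CharZero K] : thomSullivan M ⟶ stdNormalization (underlying M) :=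
  CochainComplex.ofHom (fun q => ModuleCat.ofHom (integrate M hM q)) fun q => by
    rw [thomSullivan_d, stdNormalization_d]
    exact ModuleCat.hom_ext (LinearMap.ext fun u => normD_integrate M hM q u)

/-- The section of the integration map, as a morphism of complexes. -/
def whitneySectionHom [CharZero K] : stdNormalization (underlying M) ⟶ thomSullivan M :=
  CochainComplex.ofHom (fun q => ModuleCat.ofHom (whitneySection M hM q)) fun q => by
    rw [thomSullivan_d, stdNormalization_d]
    exact ModuleCat.hom_ext (LinearMap.ext fun m => thomSullivanD_whitneySection M hM q m)

theorem whitneySectionHom_integrateHom [CharZero K] :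
    whitneySectionHom M hM ≫ integrateHom M hM = 𝟙 _ :=
  HomologicalComplex.hom_ext _ _ fun q =>
    ModuleCat.hom_ext (LinearMap.ext fun m => integrate_whitneySection M hM q m)

/-- The components of the homotopy between the identity and the composition of the integration
map with its section. -/
def homotopyComponent [CharZero K] (i j : ℕ) (h : (ComplexShape.up ℕ).Rel j i) :
    (thomSullivan M).X i ⟶ (thomSullivan M).X j :=
  eqToHom (congrArg (thomSullivan M).X (show i = j + 1 from h.symm)) ≫
    ModuleCat.ofHom (thomSullivanHomotopy M j)

theorem homotopyComponent_succ [CharZero K] (j : ℕ) (h : (ComplexShape.up ℕ).Rel j (j + 1)) :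
    homotopyComponent M (j + 1) j h = ModuleCat.ofHom (thomSullivanHomotopy M j) :=
  Category.id_comp _

theorem id_sub_integrateHom_whitneySectionHom [CharZero K] :
    𝟙 (thomSullivan M) - integrateHom M hM ≫ whitneySectionHom M hM =
      Homotopy.nullHomotopicMap' (homotopyComponent M) := by
  have hr : ∀ q, (ComplexShape.up ℕ).Rel q (q + 1) := fun _ => rfl
  refine HomologicalComplex.hom_ext _ _ fun q => ?_
  cases q with
  | zero =>
    rw [Homotopy.nullHomotopicMap'_f_of_not_rel_right (hr 0) (by simp),
      homotopyComponent_succ M 0, thomSullivan_d M 0]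
    exact ModuleCat.hom_ext (LinearMap.ext fun u => (thomSullivanHomotopy_d_zero M hM u).symm)
  | succ q =>
    rw [Homotopy.nullHomotopicMap'_f (hr q) (hr (q + 1)),
      homotopyComponent_succ M q, homotopyComponent_succ M (q + 1), thomSullivan_d M q,
      thomSullivan_d M (q + 1)]
    exact ModuleCat.hom_ext (LinearMap.ext fun u =>
      (thomSullivanD_homotopy M hM q u).symm.trans (add_comm _ _))

/-- The integration map is a homotopy equivalence. -/
def integrateEquiv [CharZero K] :
    HomotopyEquiv (thomSullivan M) (stdNormalization (underlying M)) where
  hom := integrateHom M hM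
  inv := whitneySectionHom M hM
  homotopyHomInvId := (Homotopy.equivSubZero.symm
    ((Homotopy.ofEq (id_sub_integrateHom_whitneySectionHom M hM)).trans
      (Homotopy.nullHomotopy' (homotopyComponent M)))).symm
  homotopyInvHomId := Homotopy.ofEq (whitneySectionHom_integrateHom M hM)

end Comparison

end

end DirInv

open CategoryTheory Simplicial DirInv in
theorem mainTheorem8 {K : Type u} [Field K] [CharZero K]
    (M : CosimplicialObject (DirInvModule K)) (hM : ∀ q : ℕ, (M.obj ⦋q⦌).IsComplete) :
    ∃ f : thomSullivan M ⟶ stdNormalization (underlying M),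
      (∀ (q : ℕ) (u : (thomSullivan M).X q),
        stdInclusion M q ((f.f q).hom u) =
          completedIntegral q (M.obj ⦋q⦌) (hM q) (thomSullivanEntry M q q u)) ∧
      QuasiIso f ∧
      ∃ e : HomotopyEquiv (thomSullivan M) (stdNormalization (underlying M)), e.hom = f :=
  ⟨integrateHom M hM, fun _ _ => rfl, (integrateEquiv M hM).quasiIso_hom, integrateEquiv M hM, rfl⟩
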